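/- **Definitions.** Let $V$ be a finite-dimensional real vector space and $\mathcal A\subset V^*$ a finite set of covectors spanning $V^*$. Put $G_{\mathcal A}(x,y)=\sum_{\alpha\in\mathcal A}\alpha(x)\alpha(y)$, and for $\alpha\in V^*$ let $\alpha^\vee\in V$ be the vector with $G_{\mathcal A}(\alpha^\vee,\cdot)=\alpha$. $\mathcal A$ is a *$\vee$-system* if for every two-dimensional plane $\Pi\subset V^*$ and every $\alpha\in\mathcal A\cap\Pi$ there is $\nu\in\mathbb R$ with $$\sum_{\beta\in\Pi\cap\mathcal A}\beta(\alpha^\vee)\,\beta^\vee=\nu\,\alpha^\vee .$$ It is *irreducible* if it is not the union of two non-empty subsets spanning subspaces in direct sum. The *matroid* of $\mathcal A$ is its matroid of linear (in)dependence. Its 2-flats with more than two elements correspond to the planes $\Pi$ containing more than two covectors of $\mathcal A$; the *$\nu$-function* assigns to each such flat the coefficient $\nu=\nu(\Pi)$ above, which for these planes does not depend on $\alpha$. **Catalogue.** The known irreducible $\vee$-systems in dimension three are the following (in coordinates of $V^*=\mathbb R^3$ with standard basis $e_1,e_2,e_3$, covectors up to sign, $1\le i<j\le 3$ in $e_i\pm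 e_j$, all choices of signs $\pm$; the real parameters are such that all radicands are positive and all covectors non-zero): 1. $A_3(c_1,c_2,c_3)$: $\sqrt{c_k}\,e_k$ ($k=1,2,3$), $\sqrt{c_ic_j}(e_i-e_j)$. 2. $D_3(t,s)$: $(1,\pm1,\pm1)$, $\sqrt{2(s-t+1)/t}\,e_2$, $\sqrt{2(t-s+1)/s}\,e_3$, $\sqrt{2(s+t-1)}\,e_1$. 3. $(E_6,A_3)$: $(2,\pm2,0)$, $2\sqrt6\,e_1$, $\tfrac12(\pm4,1,1)$, $(\pm2,-1,1)$, $\tfrac{\sqrt6}{2}(0,1,1)$. 4. $B_3(c_1,c_2,c_3,\gamma)$: $\sqrt{2c_k(c_k+\gamma)}\,e_k$ ($k=1,2,3$), $\sqrt{c_ic_j}(e_i\pm e_j)$. 5. $(E_6,A_1^3)$: $\sqrt2(1,\pm1,0)$, $2\sqrt3\,e_1$, $2e_2$, $\tfrac{\sqrt2}{2}(\pm2,\pm1,1)$, $(0,\pm1,1)$. 6. $(AB_4(t),A_1)_2$: $\sqrt2\,e_k$ ($k=1,2,3$), $e_i+e_j$, $\frac1{\sqrt{4t^2+1}}(e_i-e_j)$,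 $\frac{t\sqrt2}{\sqrt{t^2+1}}(1,1,1)$. 7. $(AB_4(t),A_1)_1$: $\sqrt{2(2t^2+1)}\,e_1$, $2\sqrt{2(t^2+1)}\,e_2$, $t\sqrt{\tfrac{2(2t^2-1)}{t^2+1}}\,e_3$, $\sqrt2(e_1\pm e_2)$, $t\sqrt2(e_1\pm e_3)$, $t(1,\pm2,\pm1)$. 8. $G_3(t)$: $\sqrt{2t+1}$ times $e_1,\ e_2,\ e_1+e_2$; $\sqrt{(2t-1)/3}$ times $e_1-e_2,\ 2e_1+e_2,\ e_1+2e_2$; $\sqrt{3/t}\,e_3$; $e_1\pm e_3$, $e_2\pm e_3$, $e_1+e_2\pm e_3$. 9. $(E_7,A_1^2\times A_2)$: $\sqrt3(1,\pm1,0)$, $2e_1$, $2\sqrt6\,e_2$, $e_3$, $\tfrac1{\sqrt2}(\pm1,\pm3,1)$, $\sqrt{3/2}\,(\pm1,\pm1,1)$. 10. $F_3(t)$: $\sqrt{4t^2+2}\,e_k$ ($k=1,2,3$), $e_i\pm e_j$, $t\sqrt2(1,\pm1,\pm1)$. 11. $H_3$: with $\phi=\frac{1+\sqrt5}2$: $2\phi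 e_k$ ($k=1,2,3$), and $(1,\pm\phi,\pm\phi^2)$ and their cyclic permutations. 12. $(E_8,A_1\times A_4)$: $\sqrt{10}(1,\pm1,0)$, $\sqrt2(1,0,\pm1)$, $\sqrt5(0,1,1)$, $\sqrt{10}(0,1,-1)$, $2e_1$, $2\sqrt{10}\,e_2$, $\tfrac12(\pm2,5,1)$, $\tfrac{\sqrt5}2(\pm2,-3,1)$, $\tfrac{\sqrt{10}}2(\pm2,1,1)$, $\tfrac1{\sqrt2}(0,-5,1)$, $\tfrac{\sqrt{10}}2(0,3,1)$. 13. $(E_8,A_2\times A_3)$: $2\sqrt3(1,\pm1,0)$, $2(0,1,\pm1)$, $\sqrt3(1,0,1)$, $\sqrt{15/2}\,(1,0,-1)$, $2\sqrt3\,e_1$, $2\sqrt6\,e_2$, $\tfrac12(3,\pm4,1)$, $(-3,\pm2,1)$, $\tfrac{\sqrt6}2(3,0,1)$, $\tfrac{\sqrt3}2(-1,\pm4,1)$, $\sqrt3(1,\pm2,1)$. 14. $(E_8,A_1^2\times A_3)$: $2(e_i\pm e_j)$, $2e_1$, $2\sqrt{10}\,e_2$, $2e_3$, $\tfrac{\sqrt2}2(1,\pm4,\pm1)$,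 $\sqrt2(1,\pm2,\pm1)$. 15. $(E_8,A_1^3\times A_2)$: $\sqrt2(1,\pm1,0)$, $\sqrt6(0,1,\pm1)$, $\sqrt6(1,0,\pm1)$, $2e_1$, $2\sqrt3\,e_2$, $2\sqrt6\,e_3$, $\tfrac{\sqrt2}2(1,\pm2,\pm3)$, $\tfrac{\sqrt6}2(1,\pm2,\pm1)$, $(1,0,\pm3)$. 16. $(E_8,A_2^2\times A_1)$: $\sqrt3(1,1,0)$, $3(1,0,1)$, $3(0,1,1)$, $(1,-1,0)$, $\sqrt3(1,0,-1)$, $\sqrt3(0,1,-1)$, $\sqrt6\,e_1$, $\sqrt6\,e_2$, $6\sqrt2\,e_3$, $\sqrt6(1,1,3)$, $\sqrt3(1,1,4)$, $3(1,1,2)$, $(1,2,3)$, $\sqrt3(1,0,3)$, $\sqrt3(0,1,3)$, $(2,1,3)$, $\sqrt6(1,0,2)$, $\sqrt6(0,1,2)$, $\sqrt6(1,1,1)$. 17. $(H_4,A_1)$: with $a=\frac{1+\sqrt5}4$, $b=\frac{-1+\sqrt5}4$, $w=\sqrt{b\sqrt5}$: $e_k$ ($k=1,2,3$), $\tfrac{\sqrt2}2(1,\pm1,\pm1)$,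 and $(a,\pm\tfrac12,\pm b)$, $\sqrt2(a,\pm b,0)$, $w(1,\pm2a,0)$ and their cyclic permutations. **Theorem.** Each system $\mathcal A$ of the catalogue is an irreducible $\vee$-system with a well-defined $\nu$-function, and both conjectures hold for it: * (Uniqueness) Let $\mathcal B\subset V^*$ be a $\vee$-system and $\mathcal A\to\mathcal B$ a bijection which is an isomorphism of matroids and carries the $\nu$-function of $\mathcal A$ to that of $\mathcal B$. Then there is $g\in GL(V^*)$ such that $\mathcal B$ and $g(\mathcal A)$ coincide up to the signs of the covectors (the bijection need not be the one induced by $g$). * (Rigidity) Label the covectors as $\mathcal A=\{\alpha_1,\dots,\alpha_n\}$. There is a neighbourhood of $(\alpha_1,\dots,\alpha_n)$ in $(V^*)^n$ such that every $\vee$-system $(\beta_1,\dots,\beta_n)$ in it with the same labelled matroid and the same $\nu$-function is of the form $\beta_i=g(\alpha_i)$, $i=1,\dots,n$, for some $g\in GL(V^*)$. -/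

import Mathlib

open Matrix Topology

/-!
Conventions.  We work with `V = ℝ^d`; vectors of `V` and covectors of `V* = ℝ^d` are both written
in coordinates as `Fin d → ℝ`, and the pairing of a covector `α` with a vector `x` is the dot
product `α ⬝ᵥ x`.  A finite set of covectors is given as a labelled family `a : ι → (Fin d → ℝ)`
which is required to be injective.
-/

section Vee

variable {d : ℕ} {ι : Type} [Fintype ι]

/-- The matrix of the canonical form `G(x, y) = ∑ α, α(x) α(y)` on `V`. -/
noncomputable def canonicalForm (a : ι → Fin d → ℝ) : Matrix (Fin d) (Fin d) ℝ :=
  ∑ i, vecMulVec (a i) (a i)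

/-- The vector `α^∨ ∈ V` with `G(α^∨, y) = α(y)` for all `y`.  It is meaningful if the covectors
`a i` span `V*`, since `G` is then positive definite. -/
noncomputable def dualVector (a : ι → Fin d → ℝ) (α : Fin d → ℝ) : Fin d → ℝ :=
  (canonicalForm a)⁻¹ *ᵥ α

open Classical in
/-- `ν` is the coefficient in the `∨`-condition for the covector `α` of the system and the
plane `P`, that is, `∑ β(α^∨) β^∨ = ν α^∨`, the sum being over the covectors `β` of the system
that lie in `P`. -/
def IsVeeCoefficient (a : ι → Fin d → ℝ) (P : Submodule ℝ (Fin d → ℝ)) (α : Fin d → ℝ)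
    (ν : ℝ) : Prop :=
  ∑ j with a j ∈ P, (a j ⬝ᵥ dualVector a α) • dualVector a (a j) = ν • dualVector a α

/-- A `∨`-system: a finite set of covectors which spans `V*` and satisfies the `∨`-conditions for
every two-dimensional plane `P ⊆ V*` and every covector of the system in `P`. -/
structure IsVeeSystem (a : ι → Fin d → ℝ) : Prop where
  injective : Function.Injective a
  span_eq_top : Submodule.span ℝ (Set.range a) = ⊤
  vee : ∀ P : Submodule ℝ (Fin d → ℝ), Module.finrank ℝ P = 2 → ∀ i, a i ∈ P →
    ∃ ν : ℝ, IsVeeCoefficient a P (a i) ν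

/-- Irreducibility: the system is not the union of two non-empty subsystems which span subspaces
of `V*` in direct sum. -/
def IsIrreducibleSystem (a : ι → Fin d → ℝ) : Prop :=
  ∀ S : Set ι, S.Nonempty → Sᶜ.Nonempty →
    ¬ Disjoint (Submodule.span ℝ (a '' S)) (Submodule.span ℝ (a '' Sᶜ))

/-- The vector matroid of a family of covectors, on the set of labels: a set of labels is
independent if the corresponding covectors are linearly independent. -/
def vectorMatroid (a : ι → Fin d → ℝ) : Matroid ι :=
  (IndepMatroid.ofFinite (E := Set.univ) Set.finite_univ (fun S => LinearIndepOn ℝ a S)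
    (linearIndepOn_empty ℝ a)
    (fun _ _ hJ hIJ => hJ.mono hIJ)
    (by
      intro I J hI hJ hlt
      by_contra hcon
      have hsub : a '' J ⊆ Submodule.span ℝ (a '' I) := by
        rintro _ ⟨e, he, rfl⟩
        by_cases heI : e ∈ I
        · exact Submodule.subset_span ⟨e, heI, rfl⟩
        · by_contra hes
          exact hcon ⟨e, he, heI, (linearIndepOn_insert heI).2 ⟨hI, hes⟩⟩
      have hle : Submodule.span ℝ (a '' J) ≤ Submodule.span ℝ (a '' I) :=
        Submodule.span_le.2 hsub
      have hrank : ∀ K : Set ι, LinearIndepOn ℝ a K →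
          Module.finrank ℝ (Submodule.span ℝ (a '' K)) = K.ncard := by
        intro K hK
        classical
        have h := finrank_span_eq_card (R := ℝ) (b := fun k : K => a k) hK
        rw [← Nat.card_eq_fintype_card, Nat.card_coe_set_eq] at h
        rw [← h, Set.image_eq_range]
      have := Submodule.finrank_mono hle
      rw [hrank I hI, hrank J hJ] at this
      omega)
    (fun _ _ => Set.subset_univ _)).matroid

/-- `ν` is the `ν`-function of the system: for every 2-flat `F` of the matroid containing more than
two elements, `ν F` is the coefficient in the `∨`-conditions for the plane representing `F`, for
every covector of the system in this plane.  (Values of `ν` on other sets are irrelevant.) -/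
def IsNuFunction (a : ι → Fin d → ℝ) (ν : Set ι → ℝ) : Prop :=
  ∀ F : Set ι, (vectorMatroid a).IsFlat F → (vectorMatroid a).eRk F = 2 → 2 < F.ncard →
    ∀ i ∈ F, IsVeeCoefficient a (Submodule.span ℝ (a '' F)) (a i) (ν F)

/-- The conclusion of the Uniqueness Conjecture for the system `a`: every `∨`-system which (after
a suitable labelling) has the same matroid and the same `ν`-function is, as a set of covectors
considered up to sign, the image of `a` under an element of `GL(V*)`. -/
def IsUniquelyDetermined (a : ι → Fin d → ℝ) : Prop :=
  ∀ ν : Set ι → ℝ, IsNuFunction a ν →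
    ∀ b : ι → Fin d → ℝ, IsVeeSystem b → vectorMatroid b = vectorMatroid a → IsNuFunction b ν →
      ∃ (g : (Fin d → ℝ) ≃ₗ[ℝ] (Fin d → ℝ)) (σ : Equiv.Perm ι),
        ∀ i, b (σ i) = g (a i) ∨ b (σ i) = -g (a i)

/-- The conclusion of the Rigidity Conjecture for the system `a`: every `∨`-system sufficiently
close to `a` which has the same matroid and the same `ν`-function is the image of `a` under an
element of `GL(V*)`. -/
def IsLocallyUniquelyDetermined (a : ι → Fin d → ℝ) : Prop :=
  ∀ ν : Set ι → ℝ, IsNuFunction a ν →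
    ∀ᶠ b in 𝓝 a, IsVeeSystem b → vectorMatroid b = vectorMatroid a → IsNuFunction b ν →
      ∃ g : (Fin d → ℝ) ≃ₗ[ℝ] (Fin d → ℝ), ∀ i, b i = g (a i)

end Vee

/-!
The catalogue.  The columns of each matrix are the covectors of the system; transposing turns the
matrix into the family of its columns.
-/

section Catalogue

noncomputable def sysA3 (c₁ c₂ c₃ : ℝ) : Fin 6 → Fin 3 → ℝ :=
  (!![√c₁, 0, 0, -√(c₁ * c₂), -√(c₁ * c₃), 0;
      0, √c₂, 0, √(c₁ * c₂), 0, -√(c₂ * c₃);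
      0, 0, √c₃, 0, √(c₁ * c₃), √(c₂ * c₃)])ᵀ

noncomputable def sysD3 (t s : ℝ) : Fin 7 → Fin 3 → ℝ :=
  (!![1, 1, 1, 1, 0, 0, √(2 * (s + t - 1));
      1, -1, -1, 1, √(2 * (s - t + 1) / t), 0, 0;
      1, -1, 1, -1, 0, √(2 * (t - s + 1) / s), 0])ᵀ

/-- `(E₆, A₃)` -/
noncomputable def sysE6A3 : Fin 8 → Fin 3 → ℝ :=
  (!![2, 2, 2 * √6, 2, -2, 2, -2, 0;
      2, -2, 0, 1 / 2, 1 / 2, -1, -1, √6 / 2;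
      0, 0, 0, 1 / 2, 1 / 2, 1, 1, √6 / 2])ᵀ

noncomputable def sysB3 (c₁ c₂ c₃ γ : ℝ) : Fin 9 → Fin 3 → ℝ :=
  (!![√(2 * c₁ * (c₁ + γ)), 0, 0, 0, √(c₁ * c₃), √(c₁ * c₂), 0, -√(c₁ * c₃), -√(c₁ * c₂);
      0, √(2 * c₂ * (c₂ + γ)), 0, √(c₂ * c₃), 0, √(c₁ * c₂), -√(c₂ * c₃), 0, √(c₁ * c₂);
      0, 0, √(2 * c₃ * (c₃ + γ)), √(c₂ * c₃), √(c₁ * c₃), 0, √(c₂ * c₃), √(c₁ * c₃), 0])ᵀ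

/-- `(E₆, A₁³)` -/
noncomputable def sysE6A1A1A1 : Fin 10 → Fin 3 → ℝ :=
  (!![√2, √2, 2 * √3, 0, √2, -√2, -√2, √2, 0, 0;
      √2, -√2, 0, 2, √2 / 2, -√2 / 2, √2 / 2, -√2 / 2, 1, -1;
      0, 0, 0, 0, √2 / 2, √2 / 2, √2 / 2, √2 / 2, 1, 1])ᵀ

/-- `(AB₄(t), A₁)₂` -/
noncomputable def sysAB4second (t : ℝ) : Fin 10 → Fin 3 → ℝ :=
  (!![√2, 0, 0, 1, 1 / √(4 * t ^ 2 + 1), 1, 1 / √(4 * t ^ 2 + 1), 0, 0,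
        t * √2 / √(t ^ 2 + 1);
      0, √2, 0, 1, -1 / √(4 * t ^ 2 + 1), 0, 0, 1, 1 / √(4 * t ^ 2 + 1),
        t * √2 / √(t ^ 2 + 1);
      0, 0, √2, 0, 0, 1, -1 / √(4 * t ^ 2 + 1), 1, -1 / √(4 * t ^ 2 + 1),
        t * √2 / √(t ^ 2 + 1)])ᵀ

/-- `(AB₄(t), A₁)₁` -/
noncomputable def sysAB4first (t : ℝ) : Fin 11 → Fin 3 → ℝ :=
  (!![√(2 * (2 * t ^ 2 + 1)), 0, 0, √2, √2, t * √2, t * √2, t, t, t, t;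
      0, 2 * √(2 * (t ^ 2 + 1)), 0, √2, -√2, 0, 0, 2 * t, -2 * t, 2 * t, -2 * t;
      0, 0, t * √(2 * (2 * t ^ 2 - 1) / (t ^ 2 + 1)), 0, 0, t * √2, -t * √2, t, t, -t, -t])ᵀ

noncomputable def sysG3 (t : ℝ) : Fin 13 → Fin 3 → ℝ :=
  (!![√(2 * t + 1), 0, √(2 * t + 1),
        √((2 * t - 1) / 3), 2 * √((2 * t - 1) / 3), √((2 * t - 1) / 3), 0,
        1, 1, 0, 0, 1, 1;
      0, √(2 * t + 1), √(2 * t + 1),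
        -√((2 * t - 1) / 3), √((2 * t - 1) / 3), 2 * √((2 * t - 1) / 3), 0,
        0, 0, 1, 1, 1, 1;
      0, 0, 0, 0, 0, 0, √(3 / t), 1, -1, 1, -1, 1, -1])ᵀ

/-- `(E₇, A₁² × A₂)` -/
noncomputable def sysE7A1A1A2 : Fin 13 → Fin 3 → ℝ :=
  (!![√3, √3, 2, 0, 0, 1 / √2, -1 / √2, -1 / √2, 1 / √2,
        √(3 / 2), -√(3 / 2), -√(3 / 2), √(3 / 2);
      √3, -√3, 0, 2 * √6, 0, 3 / √2, -3 / √2, 3 / √2, -3 / √2,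
        √(3 / 2), -√(3 / 2), √(3 / 2), -√(3 / 2);
      0, 0, 0, 0, 1, 1 / √2, 1 / √2, 1 / √2, 1 / √2,
        √(3 / 2), √(3 / 2), √(3 / 2), √(3 / 2)])ᵀ

noncomputable def sysF3 (t : ℝ) : Fin 13 → Fin 3 → ℝ :=
  (!![√(4 * t ^ 2 + 2), 0, 0, 1, 1, 1, 1, 0, 0, t * √2, t * √2, t * √2, t * √2;
      0, √(4 * t ^ 2 + 2), 0, 1, -1, 0, 0, 1, 1, t * √2, -t * √2, t * √2, -t * √2;
      0, 0, √(4 * t ^ 2 + 2), 0, 0, 1, -1, 1, -1, t * √2, t * √2, -t * √2, -t * √2])ᵀ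

/-- The Coxeter system `H₃`, for `φ` the golden ratio. -/
noncomputable def sysH3 (φ : ℝ) : Fin 15 → Fin 3 → ℝ :=
  (!![2 * φ, 0, 0, 1, -1, 1, 1, φ, -φ, φ, φ, φ ^ 2, φ ^ 2, -φ ^ 2, φ ^ 2;
      0, 2 * φ, 0, φ, φ, -φ, φ, -φ ^ 2, φ ^ 2, φ ^ 2, φ ^ 2, 1, -1, 1, 1;
      0, 0, 2 * φ, φ ^ 2, φ ^ 2, φ ^ 2, -φ ^ 2, 1, 1, -1, 1, -φ, φ, φ, φ])ᵀ

/-- `(E₈, A₁ × A₄)` -/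
noncomputable def sysE8A1A4 : Fin 16 → Fin 3 → ℝ :=
  (!![√10, √10, √2, √2, 0, 0, 2, 0, 1, -1, √5, -√5,
        √10, -√10, 0, 0;
      √10, -√10, 0, 0, √5, √10, 0, 2 * √10, 5 / 2, 5 / 2, -3 * √5 / 2, -3 * √5 / 2,
        √10 / 2, √10 / 2, -5 / √2, 3 * √10 / 2;
      0, 0, √2, -√2, √5, -√10, 0, 0, 1 / 2, 1 / 2, √5 / 2, √5 / 2,
        √10 / 2, √10 / 2, 1 / √2, √10 / 2])ᵀ

/-- `(E₈, A₂ × A₃)` -/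
noncomputable def sysE8A2A3 : Fin 17 → Fin 3 → ℝ :=
  (!![2 * √3, 2 * √3, 0, 0, √3, √(15 / 2), 2 * √3, 0, 3 / 2, 3 / 2, -3, -3, 3 * √6 / 2,
        -√3 / 2, -√3 / 2, √3, √3;
      2 * √3, -2 * √3, 2, 2, 0, 0, 0, 2 * √6, 2, -2, 2, -2, 0,
        2 * √3, -2 * √3, 2 * √3, -2 * √3;
      0, 0, 2, -2, √3, -√(15 / 2), 0, 0, 1 / 2, 1 / 2, 1, 1, √6 / 2,
        √3 / 2, √3 / 2, √3, √3])ᵀ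

/-- `(E₈, A₁² × A₃)` -/
noncomputable def sysE8A1A1A3 : Fin 17 → Fin 3 → ℝ :=
  (!![2, 2, 0, 0, 2, 2, 2, 0, 0, √2 / 2, √2 / 2, √2 / 2, √2 / 2,
        √2, √2, √2, √2;
      2, -2, 2, 2, 0, 0, 0, 2 * √10, 0, 2 * √2, -2 * √2, -2 * √2, 2 * √2,
        2 * √2, -2 * √2, -2 * √2, 2 * √2;
      0, 0, 2, -2, 2, -2, 0, 0, 2, √2 / 2, -√2 / 2, √2 / 2, -√2 / 2,
        √2, -√2, √2, -√2])ᵀ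

/-- `(E₈, A₁³ × A₂)` -/
noncomputable def sysE8A1A1A1A2 : Fin 19 → Fin 3 → ℝ :=
  (!![√2, √2, 0, 0, √6, √6, 2, 0, 0, √2 / 2, √2 / 2, √2 / 2, √2 / 2,
        √6 / 2, √6 / 2, √6 / 2, √6 / 2, 1, 1;
      √2, -√2, √6, √6, 0, 0, 0, 2 * √3, 0, √2, √2, -√2, -√2,
        √6, -√6, √6, -√6, 0, 0;
      0, 0, -√6, √6, -√6, √6, 0, 0, 2 * √6, -3 * √2 / 2, 3 * √2 / 2, 3 * √2 / 2, -3 * √2 / 2,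
        -√6 / 2, -√6 / 2, √6 / 2, √6 / 2, -3, 3])ᵀ

/-- `(E₈, A₂² × A₁)` -/
noncomputable def sysE8A2A2A1 : Fin 19 → Fin 3 → ℝ :=
  (!![√3, 3, 0, 1, √3, 0, √6, 0, 0, √6, √3, 3, 1, √3, 0, 2, √6, 0, √6;
      √3, 0, 3, -1, 0, √3, 0, √6, 0, √6, √3, 3, 2, 0, √3, 1, 0, √6, √6;
      0, 3, 3, 0, -√3, -√3, 0, 0, 6 * √2, 3 * √6, 4 * √3, 6, 3, 3 * √3, 3 * √3, 3,
        2 * √6, 2 * √6, √6])ᵀ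

/-- `(H₄, A₁)`, for `a = (1 + √5) / 4`, `b = (-1 + √5) / 4` and `w = √(b √5)`. -/
noncomputable def sysH4A1 (a b w : ℝ) : Fin 31 → Fin 3 → ℝ :=
  (!![1, 0, 0, √2 / 2, √2 / 2, √2 / 2, √2 / 2, a, a, a, a, b, b, b, b,
        1 / 2, 1 / 2, 1 / 2, 1 / 2, a * √2, a * √2, 0, 0, b * √2, b * √2,
        w, w, 0, 0, 2 * a * w, -2 * a * w;
      0, 1, 0, √2 / 2, √2 / 2, -√2 / 2, -√2 / 2, 1 / 2, 1 / 2, -1 / 2, -1 / 2, a, a, -a, -a,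
        b, b, -b, -b, b * √2, -b * √2, a * √2, a * √2, 0, 0,
        2 * a * w, -2 * a * w, w, w, 0, 0;
      0, 0, 1, √2 / 2, -√2 / 2, √2 / 2, -√2 / 2, b, -b, b, -b, 1 / 2, -1 / 2, 1 / 2, -1 / 2,
        a, -a, a, -a, 0, 0, b * √2, -b * √2, a * √2, -a * √2,
        0, 0, 2 * a * w, -2 * a * w, w, w])ᵀ

/-- The catalogue of the known irreducible `∨`-systems in dimension three.  The parameters are such
that all the covectors are real (all the radicands are positive) and non-zero. -/
inductive IsKnownVeeSystem : {n : ℕ} → (Fin n → Fin 3 → ℝ) → Prop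
  | A3 (c₁ c₂ c₃ : ℝ) (h₁ : 0 < c₁) (h₂ : 0 < c₂) (h₃ : 0 < c₃) :
      IsKnownVeeSystem (sysA3 c₁ c₂ c₃)
  | D3 (t s : ℝ) (h₁ : 0 < s + t - 1) (h₂ : 0 < (s - t + 1) / t) (h₃ : 0 < (t - s + 1) / s) :
      IsKnownVeeSystem (sysD3 t s)
  | E6A3 : IsKnownVeeSystem sysE6A3
  | B3 (c₁ c₂ c₃ γ : ℝ) (h₁₂ : 0 < c₁ * c₂) (h₁₃ : 0 < c₁ * c₃) (h₂₃ : 0 < c₂ * c₃)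
      (h₁ : 0 < c₁ * (c₁ + γ)) (h₂ : 0 < c₂ * (c₂ + γ)) (h₃ : 0 < c₃ * (c₃ + γ)) :
      IsKnownVeeSystem (sysB3 c₁ c₂ c₃ γ)
  | E6A1A1A1 : IsKnownVeeSystem sysE6A1A1A1
  | AB4second (t : ℝ) (h : t ≠ 0) : IsKnownVeeSystem (sysAB4second t)
  | AB4first (t : ℝ) (h : 0 < 2 * t ^ 2 - 1) : IsKnownVeeSystem (sysAB4first t)
  | G3 (t : ℝ) (h : 0 < 2 * t - 1) : IsKnownVeeSystem (sysG3 t)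
  | E7A1A1A2 : IsKnownVeeSystem sysE7A1A1A2
  | F3 (t : ℝ) (h : t ≠ 0) : IsKnownVeeSystem (sysF3 t)
  | H3 : IsKnownVeeSystem (sysH3 ((1 + √5) / 2))
  | E8A1A4 : IsKnownVeeSystem sysE8A1A4
  | E8A2A3 : IsKnownVeeSystem sysE8A2A3
  | E8A1A1A3 : IsKnownVeeSystem sysE8A1A1A3
  | E8A1A1A1A2 : IsKnownVeeSystem sysE8A1A1A1A2
  | E8A2A2A1 : IsKnownVeeSystem sysE8A2A2A1
  | H4A1 : IsKnownVeeSystem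
      (sysH4A1 ((1 + √5) / 4) ((-1 + √5) / 4) √((-1 + √5) / 4 * √5))

end Catalogue

/-!
Each covector of a system of the catalogue is a real multiple `s i • u i` of a direction `u i` with
coordinates in `ℤ` or, for `H₃` and `(H₄, A₁)`, in `ℤ[√5]`.  Let `h` be the form on covectors which
is inverse to the canonical form, so that `∑ j, h (a j) x • a j = x` for all `x`.  The `∨`-condition
for a covector `a i` and a plane says that `a i` is an eigenvector of the partial sum over the
covectors in the plane.  It is checked on the list of all 2-flats of the matroid
(`IsLineCover.exists_isVeeConfig`); up to the factors `s i ^ 2` this is a computation with the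
directions.  Every covector lies on a 2-flat with at least three elements, whence irreducibility and
the independence of `ν` of the covector.

Uniqueness rests on three facts about a `∨`-system `b` with the same matroid and `ν`-function.

* Pairing the `∨`-conditions for `a i` with `a i` and adding them up over all 2-flats through `i`
  gives `h (a i) (a i) + ∑ (ν F - h (a i) (a i)) = 1`, the sum being over the 2-flats `F ∋ i` with
  more than two elements.  If there are at least two of these, the norm of `a i` is determined by
  the matroid and `ν` (`IsVeeConfig.norm_eq`), so that `a` and `b` have the same norms.
* The matroid determines the directions up to a linear map.  Over `ℤ`, all the points of the
  projective plane given by the covectors are constructed from a projective frame by intersecting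
  lines (`Constructs.forall_eq_smul`).  Over `ℤ[√5]` one more point is needed, and a configuration
  of nine points shows that its coordinate is a root of `τ ^ 2 = τ + 1` (`golden_of_incidence`).
  The two roots give Galois conjugate directions, and conjugation is the composition of a linear map
  with a permutation of the labels which preserves the norms
  (`isRigidVeeSystem_of_golden`).  Hence `b (σ i) = l i • g (a i)` for some scalars `l i`, a linear
  map `g`, and a norm-preserving permutation `σ`.
* On a 2-flat with three elements, the norms determine the squares of the coefficients of the linear
  relation between the covectors, up to a common factor.  Therefore `l i ^ 2` is constant on such
  2-flats.  A basis of covectors which are linked by such 2-flats and pairwise span 2-flats with at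
  most three elements then shows that the forms of `a` and of the pull-back of `b` are proportional,
  so that `l i ^ 2` does not depend on `i` at all (`sq_scale_eq`).

Local uniqueness follows from uniqueness, since for given signs and a given permutation the systems
`b` of the form in the uniqueness statement lie in a linear subspace, which is closed
(`IsUniquelyDetermined.isLocallyUniquelyDetermined`).
-/

/-! ### Determinants and planes in dimension three -/

section Dimension3

variable {R : Type*} [CommRing R]

/-- The determinant of three vectors in dimension three, written out so that it can be evaluated
in computable rings. -/
def det3 (x y z : Fin 3 → R) : R :=
  x 0 * (y 1 * z 2 - y 2 * z 1) - x 1 * (y 0 * z 2 - y 2 * z 0) + x 2 * (y 0 * z 1 - y 1 * z 0)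

/-- The cross product, written out so that it can be evaluated in computable rings. -/
def cross3 (x y : Fin 3 → R) : Fin 3 → R :=
  ![x 1 * y 2 - x 2 * y 1, x 2 * y 0 - x 0 * y 2, x 0 * y 1 - x 1 * y 0]

lemma det3_eq_det (x y z : Fin 3 → R) : det3 x y z = (Matrix.of ![x, y, z]).det := by
  simp [det3, Matrix.det_fin_three]; ring

lemma det3_map {S : Type*} [CommRing S] (f : R →+* S) (x y z : Fin 3 → R) :
    det3 (fun m => f (x m)) (fun m => f (y m)) (fun m => f (z m)) = f (det3 x y z) := by
  simp [det3]

lemma cross3_map {S : Type*} [CommRing S] (f : R →+* S) (x y : Fin 3 → R) :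
    cross3 (fun m => f (x m)) (fun m => f (y m)) = fun m => f (cross3 x y m) := by
  funext m; fin_cases m <;> simp [cross3]

lemma det3_smul (r s t : R) (x y z : Fin 3 → R) :
    det3 (r • x) (s • y) (t • z) = r * s * t * det3 x y z := by
  simp [det3]; ring

lemma det3_swap (x y z : Fin 3 → R) : det3 y x z = - det3 x y z := by simp [det3]; ring

lemma det3_rotate (x y z : Fin 3 → R) : det3 y z x = det3 x y z := by simp [det3]; ring

@[simp] lemma det3_self_left (x z : Fin 3 → R) : det3 x x z = 0 := by simp [det3]; ring

@[simp] lemma det3_self_right (x z : Fin 3 → R) : det3 x z z = 0 := by simp [det3]; ring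

@[simp] lemma det3_self_outer (x z : Fin 3 → R) : det3 x z x = 0 := by simp [det3]; ring

lemma det3_cross3 (x y : Fin 3 → R) : det3 x y (cross3 x y) =
    cross3 x y 0 ^ 2 + cross3 x y 1 ^ 2 + cross3 x y 2 ^ 2 := by
  simp [det3, cross3]; ring

lemma cross3_swap (x y : Fin 3 → R) : cross3 y x = - cross3 x y := by
  funext m; fin_cases m <;> simp [cross3] <;> ring

lemma cross3_smul (r s : R) (x y : Fin 3 → R) : cross3 (r • x) (s • y) = (r * s) • cross3 x y := by
  funext m; fin_cases m <;> simp [cross3] <;> ring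

lemma det3_comb (α β : R) (x y z : Fin 3 → R) : det3 x y (α • x + β • y + z) = det3 x y z := by
  simp [det3]; ring

/-- Cramer's rule in dimension three. -/
lemma det3_smul_eq (x y z w : Fin 3 → R) :
    det3 x y z • w = det3 w y z • x + det3 x w z • y + det3 x y w • z := by
  funext m; fin_cases m <;> simp [det3] <;> ring

variable {x y z w : Fin 3 → ℝ}

lemma det3_cross3_ne_zero (h : cross3 x y ≠ 0) : det3 x y (cross3 x y) ≠ 0 := by
  rw [det3_cross3]
  contrapose! h
  have h0 := sq_nonneg (cross3 x y 0)
  have h1 := sq_nonneg (cross3 x y 1)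
  have h2 := sq_nonneg (cross3 x y 2)
  funext m
  fin_cases m
  · exact pow_eq_zero_iff two_ne_zero |>.1 (by linarith : cross3 x y 0 ^ 2 = 0)
  · exact pow_eq_zero_iff two_ne_zero |>.1 (by linarith : cross3 x y 1 ^ 2 = 0)
  · exact pow_eq_zero_iff two_ne_zero |>.1 (by linarith : cross3 x y 2 ^ 2 = 0)

lemma exists_eq_comb_of_det3_eq_zero (hxy : cross3 x y ≠ 0) (h : det3 x y z = 0) :
    ∃ α β : ℝ, z = α • x + β • y := by
  have hd := det3_cross3_ne_zero hxy
  have h1 := det3_smul_eq x y (cross3 x y) z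
  rw [h, zero_smul, add_zero] at h1
  refine ⟨det3 z y (cross3 x y) / det3 x y (cross3 x y),
    det3 x z (cross3 x y) / det3 x y (cross3 x y), ?_⟩
  rw [div_eq_inv_mul, div_eq_inv_mul, mul_smul, mul_smul, ← smul_add, ← h1, smul_smul,
    inv_mul_cancel₀ hd, one_smul]

lemma exists_eq_comb_of_det3_ne_zero (h : det3 x y z ≠ 0) (w : Fin 3 → ℝ) :
    w = (det3 w y z / det3 x y z) • x + (det3 x w z / det3 x y z) • y +
      (det3 x y w / det3 x y z) • z := by
  have h1 := det3_smul_eq x y z w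
  simp only [div_eq_inv_mul, mul_smul, ← smul_add]
  rw [← h1, smul_smul, inv_mul_cancel₀ h, one_smul]

lemma exists_eq_smul_of_cross3_eq_zero (hx : x ≠ 0) (h : cross3 x y = 0) : ∃ c : ℝ, y = c • x := by
  have e0 := congrFun h 0
  have e1 := congrFun h 1
  have e2 := congrFun h 2
  simp only [cross3, cons_val_zero, cons_val_one, cons_val, Pi.zero_apply] at e0 e1 e2
  obtain ⟨m, hm⟩ := Function.ne_iff.1 hx
  refine ⟨y m / x m, ?_⟩
  have hm' : x m ≠ 0 := hm
  funext l
  simp only [Pi.smul_apply, smul_eq_mul]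
  rw [div_mul_eq_mul_div, eq_div_iff hm']
  fin_cases m <;> fin_cases l <;> simp <;> linarith

lemma linearIndependent_triple_iff : LinearIndependent ℝ ![x, y, z] ↔ det3 x y z ≠ 0 := by
  have h : (![x, y, z] : Fin 3 → Fin 3 → ℝ) = (Matrix.of ![x, y, z]).row := rfl
  rw [h, linearIndependent_rows_iff_isUnit, Matrix.isUnit_iff_isUnit_det, isUnit_iff_ne_zero,
    det3_eq_det]

lemma linearIndependent_pair_iff : LinearIndependent ℝ ![x, y] ↔ cross3 x y ≠ 0 := by
  constructor
  · intro h h0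
    have hx : x ≠ 0 := h.ne_zero 0
    obtain ⟨c, rfl⟩ := exists_eq_smul_of_cross3_eq_zero hx h0
    have := LinearIndependent.pair_iff.1 h c (-1) (by simp)
    norm_num at this
  · intro h
    have h3 := linearIndependent_triple_iff.2 (det3_cross3_ne_zero h)
    have := h3.comp ![0, 1] (by intro i j; fin_cases i <;> fin_cases j <;> simp)
    convert this using 1
    funext i; fin_cases i <;> rfl

lemma mem_span_pair_iff_det3 (hxy : cross3 x y ≠ 0) :
    z ∈ Submodule.span ℝ {x, y} ↔ det3 x y z = 0 := by
  rw [Submodule.mem_span_pair]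
  constructor
  · rintro ⟨α, β, rfl⟩
    have := det3_comb α β x y 0
    rw [add_zero] at this
    rw [this]; simp [det3]
  · intro h
    obtain ⟨α, β, h⟩ := exists_eq_comb_of_det3_eq_zero hxy h
    exact ⟨α, β, h.symm⟩

lemma finrank_span_pair (hxy : cross3 x y ≠ 0) :
    Module.finrank ℝ (Submodule.span ℝ {x, y}) = 2 := by
  have := finrank_span_eq_card (linearIndependent_pair_iff.2 hxy)
  rwa [Matrix.range_cons_cons_empty, Fintype.card_fin] at this

lemma span_pair_eq_of_mem {P : Submodule ℝ (Fin 3 → ℝ)} (hP : Module.finrank ℝ P = 2)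
    (hx : x ∈ P) (hy : y ∈ P) (hxy : cross3 x y ≠ 0) : Submodule.span ℝ {x, y} = P := by
  apply Submodule.eq_of_le_of_finrank_eq
  · rw [Submodule.span_le]
    rintro v (rfl | rfl) <;> assumption
  · rw [finrank_span_pair hxy, hP]

lemma det3_map_linearEquiv (g : (Fin 3 → ℝ) ≃ₗ[ℝ] (Fin 3 → ℝ)) :
    det3 (g x) (g y) (g z) = 0 ↔ det3 x y z = 0 := by
  rw [← not_iff_not, ← ne_eq, ← ne_eq, ← linearIndependent_triple_iff,
    ← linearIndependent_triple_iff]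
  have : ![g x, g y, g z] = g ∘ ![x, y, z] := by
    funext i; fin_cases i <;> rfl
  rw [this]
  exact g.toLinearMap.linearIndependent_iff (LinearEquiv.ker g)

/-- Two covectors lying on the same two distinct planes are proportional. -/
lemma exists_eq_smul_of_det3_eq_zero {p q r s : Fin 3 → ℝ} (hx : x ≠ 0)
    (hne : cross3 (cross3 p q) (cross3 r s) ≠ 0) (hx1 : det3 x p q = 0) (hx2 : det3 x r s = 0)
    (hy1 : det3 y p q = 0) (hy2 : det3 y r s = 0) : ∃ c : ℝ, y = c • x := by
  set v := cross3 (cross3 p q) (cross3 r s) with hv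
  have key : ∀ z : Fin 3 → ℝ, det3 z p q = 0 → det3 z r s = 0 → cross3 v z = 0 := by
    intro z h1 h2
    simp only [det3] at h1 h2
    funext m
    fin_cases m <;> simp [hv, cross3]
    · linear_combination (r 1 * s 2 - r 2 * s 1) * h1 - (p 1 * q 2 - p 2 * q 1) * h2
    · linear_combination (r 2 * s 0 - r 0 * s 2) * h1 - (p 2 * q 0 - p 0 * q 2) * h2
    · linear_combination (r 0 * s 1 - r 1 * s 0) * h1 - (p 0 * q 1 - p 1 * q 0) * h2
  obtain ⟨c, hc⟩ := exists_eq_smul_of_cross3_eq_zero hne (key x hx1 hx2)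
  obtain ⟨d, hd⟩ := exists_eq_smul_of_cross3_eq_zero hne (key y hy1 hy2)
  have hc0 : c ≠ 0 := by rintro rfl; exact hx (by simp [hc])
  exact ⟨d / c, by rw [hd, hc, smul_smul, div_mul_cancel₀ _ hc0]⟩

end Dimension3

/-! ### The metric of a `∨`-system -/

section Metric

variable {ι : Type} [Fintype ι]

/-- The bilinear form on covectors which is inverse to the canonical form of the family `b`.  It is
characterised by the fact that `b` is a tight frame for it. -/
structure IsDualForm (b : ι → Fin 3 → ℝ) (h : LinearMap.BilinForm ℝ (Fin 3 → ℝ)) : Prop where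
  symm : ∀ x y, h x y = h y x
  pos : ∀ x, x ≠ 0 → 0 < h x x
  sum_eq : ∀ x, ∑ j, h (b j) x • b j = x

/-- Positivity follows from completeness: `h x x` is the sum of the squares `h (b j) x ^ 2`. -/
lemma IsDualForm.of_symm {b : ι → Fin 3 → ℝ} {h : LinearMap.BilinForm ℝ (Fin 3 → ℝ)}
    (hsymm : ∀ x y, h x y = h y x)
    (hsum : ∀ x, ∑ j, h (b j) x • b j = x) : IsDualForm b h := by
  refine ⟨hsymm, fun x hx => ?_, hsum⟩
  have h1 : ∑ j, h (b j) x ^ 2 = h x x := by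
    have h1 := congrArg (fun v => h v x) (hsum x)
    simp only [map_sum, map_smul, LinearMap.sum_apply, LinearMap.smul_apply, smul_eq_mul] at h1
    simpa only [sq] using h1
  rw [← h1]
  refine lt_of_le_of_ne (Finset.sum_nonneg fun j _ => sq_nonneg _) fun h0 => hx ?_
  rw [← hsum x]
  refine Finset.sum_eq_zero fun j hj => ?_
  have := (Finset.sum_eq_zero_iff_of_nonneg (fun j _ => sq_nonneg (h (b j) x))).1 h0.symm j hj
  rw [pow_eq_zero_iff two_ne_zero |>.1 this, zero_smul]

open Classical in
/-- The labels of the covectors in the plane spanned by the covectors labelled `i` and `j`; it is a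
2-flat of the matroid if these two are not proportional. -/
noncomputable def lineThrough (a : ι → Fin 3 → ℝ) (i j : ι) : Finset ι :=
  {k | det3 (a i) (a j) (a k) = 0}

@[simp] lemma mem_lineThrough {a : ι → Fin 3 → ℝ} {i j k : ι} :
    k ∈ lineThrough a i j ↔ det3 (a i) (a j) (a k) = 0 := by simp [lineThrough]

/-- A family of pairwise non-proportional covectors which satisfies the `∨`-conditions with respect
to the form `h`, the planes being described by pairs of covectors of the family. -/
structure IsVeeConfig (a : ι → Fin 3 → ℝ) (h : LinearMap.BilinForm ℝ (Fin 3 → ℝ)) : Prop extends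
    IsDualForm a h where
  cross_ne : ∀ i j, i ≠ j → cross3 (a i) (a j) ≠ 0
  vee : ∀ i j, i ≠ j → ∃ ν : ℝ, ∑ k ∈ lineThrough a i j, h (a k) (a i) • a k = ν • a i

lemma canonicalForm_mulVec (b : ι → Fin 3 → ℝ) (x : Fin 3 → ℝ) :
    canonicalForm b *ᵥ x = ∑ j, (b j ⬝ᵥ x) • b j := by
  rw [canonicalForm, Matrix.sum_mulVec]
  refine Finset.sum_congr rfl fun j _ => ?_
  rw [vecMulVec_mulVec]
  funext m; simp [mul_comm]

lemma canonicalForm_transpose (b : ι → Fin 3 → ℝ) : (canonicalForm b)ᵀ = canonicalForm b := by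
  rw [canonicalForm, Matrix.transpose_sum]
  refine Finset.sum_congr rfl fun j _ => ?_
  rw [transpose_vecMulVec]

lemma isUnit_canonicalForm {b : ι → Fin 3 → ℝ} (hb : Submodule.span ℝ (Set.range b) = ⊤) :
    IsUnit (canonicalForm b) := by
  rw [← Matrix.mulVec_injective_iff_isUnit]
  refine (injective_iff_map_eq_zero (canonicalForm b).mulVecLin).2 fun x hx => ?_
  have h1 : ∑ j, (b j ⬝ᵥ x) ^ 2 = 0 := by
    have : x ⬝ᵥ (canonicalForm b *ᵥ x) = 0 := by
      rw [Matrix.mulVecLin_apply] at hx; rw [hx, dotProduct_zero]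
    rw [canonicalForm_mulVec, dotProduct_sum] at this
    rw [← this]
    refine Finset.sum_congr rfl fun j _ => ?_
    rw [dotProduct_smul, dotProduct_comm x, smul_eq_mul, sq]
  have h2 : ∀ j, b j ⬝ᵥ x = 0 := fun j => by
    have := (Finset.sum_eq_zero_iff_of_nonneg (fun j _ => sq_nonneg (b j ⬝ᵥ x))).1 h1 j
      (Finset.mem_univ j)
    exact pow_eq_zero_iff two_ne_zero |>.1 this
  have h3 : ∀ y, y ⬝ᵥ x = 0 := fun y => by
    have hy : y ∈ Submodule.span ℝ (Set.range b) := hb ▸ Submodule.mem_top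
    induction hy using Submodule.span_induction with
    | mem v hv => obtain ⟨j, rfl⟩ := hv; exact h2 j
    | zero => simp
    | add u v _ _ hu hv => rw [add_dotProduct, hu, hv, add_zero]
    | smul c u _ hu => rw [smul_dotProduct, hu, smul_zero]
  exact dotProduct_self_eq_zero.1 (h3 x)

lemma exists_isDualForm {b : ι → Fin 3 → ℝ} (hb : Submodule.span ℝ (Set.range b) = ⊤) :
    ∃ h, IsDualForm b h := by
  have hu := isUnit_canonicalForm hb
  have hdet : IsUnit (canonicalForm b).det := (Matrix.isUnit_iff_isUnit_det _).1 hu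
  have happ : ∀ x y, Matrix.toBilin' (canonicalForm b)⁻¹ x y =
      x ⬝ᵥ ((canonicalForm b)⁻¹ *ᵥ y) := fun x y => Matrix.toBilin'_apply' _ x y
  have hsymm : ∀ x y, x ⬝ᵥ ((canonicalForm b)⁻¹ *ᵥ y) = y ⬝ᵥ ((canonicalForm b)⁻¹ *ᵥ x) := by
    intro x y
    rw [dotProduct_comm, dotProduct_mulVec, ← mulVec_transpose, transpose_nonsing_inv,
      canonicalForm_transpose, dotProduct_comm]
  have hsum : ∀ x, ∑ j, (b j ⬝ᵥ ((canonicalForm b)⁻¹ *ᵥ x)) • b j = x := fun x => by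
    rw [← canonicalForm_mulVec, mulVec_mulVec, Matrix.mul_nonsing_inv _ hdet, one_mulVec]
  refine ⟨Matrix.toBilin' (canonicalForm b)⁻¹, IsDualForm.of_symm (fun x y => ?_) fun x => ?_⟩
  · rw [happ, happ, hsymm]
  · simp only [happ]
    exact hsum x

namespace IsDualForm

variable {b : ι → Fin 3 → ℝ} {h : LinearMap.BilinForm ℝ (Fin 3 → ℝ)}

lemma span_eq_top (hb : IsDualForm b h) : Submodule.span ℝ (Set.range b) = ⊤ := by
  refine eq_top_iff.2 fun x _ => ?_
  rw [← hb.sum_eq x]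
  exact Submodule.sum_mem _ fun j _ => Submodule.smul_mem _ _ (Submodule.subset_span ⟨j, rfl⟩)

lemma apply_eq (hb : IsDualForm b h) (x y : Fin 3 → ℝ) : h x y = x ⬝ᵥ dualVector b y := by
  have hdet : IsUnit (canonicalForm b).det :=
    (Matrix.isUnit_iff_isUnit_det _).1 (isUnit_canonicalForm hb.span_eq_top)
  have happ : ∀ x y, h x y = x ⬝ᵥ (LinearMap.toMatrix₂' ℝ h *ᵥ y) := fun x y => by
    conv_lhs => rw [← Matrix.toLinearMap₂'_toMatrix' (R := ℝ) h]
    exact Matrix.toLinearMap₂'_apply' _ x y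
  have hmul : canonicalForm b * LinearMap.toMatrix₂' ℝ h = 1 := by
    apply Matrix.toLin'.injective
    ext1
    refine LinearMap.ext fun x => ?_
    simp only [LinearMap.comp_apply, Matrix.toLin'_apply, one_mulVec, ← mulVec_mulVec]
    rw [canonicalForm_mulVec]
    simp only [← happ]
    exact hb.sum_eq _
  rw [happ, dualVector, ← Matrix.inv_eq_right_inv hmul]

open Classical in
lemma isVeeCoefficient_iff (hb : IsDualForm b h) (P : Submodule ℝ (Fin 3 → ℝ)) (α : Fin 3 → ℝ)
    (ν : ℝ) : IsVeeCoefficient b P α ν ↔ ∑ j with b j ∈ P, h (b j) α • b j = ν • α := by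
  have hu := isUnit_canonicalForm hb.span_eq_top
  have hinj : Function.Injective ((canonicalForm b)⁻¹ *ᵥ · : (Fin 3 → ℝ) → Fin 3 → ℝ) :=
    Matrix.mulVec_injective_iff_isUnit.2 ((Matrix.isUnit_nonsing_inv_iff).2 hu)
  rw [IsVeeCoefficient, ← hinj.eq_iff (a := ∑ j with b j ∈ P, h (b j) α • b j)]
  simp only [Matrix.mulVec_sum, Matrix.mulVec_smul, hb.apply_eq]
  rfl

lemma isVeeCoefficient_span_pair (hb : IsDualForm b h) {i j : ι} (hij : cross3 (b i) (b j) ≠ 0)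
    (ν : ℝ) (l : ι) : IsVeeCoefficient b (Submodule.span ℝ {b i, b j}) (b l) ν ↔
      ∑ k ∈ lineThrough b i j, h (b k) (b l) • b k = ν • b l := by
  rw [hb.isVeeCoefficient_iff, lineThrough]
  simp only [mem_span_pair_iff_det3 hij]

/-- Scalar form of completeness of the frame. -/
lemma sum_sq (hb : IsDualForm b h) (x : Fin 3 → ℝ) : ∑ j, h (b j) x ^ 2 = h x x := by
  have h1 := congrArg (fun v => h v x) (hb.sum_eq x)
  simp only [map_sum, map_smul, LinearMap.sum_apply, LinearMap.smul_apply, smul_eq_mul] at h1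
  simpa only [sq] using h1

end IsDualForm

lemma isVeeConfig_of_isVeeSystem {b : ι → Fin 3 → ℝ} {h : LinearMap.BilinForm ℝ (Fin 3 → ℝ)}
    (hb : IsVeeSystem b) (hh : IsDualForm b h) (hc : ∀ i j, i ≠ j → cross3 (b i) (b j) ≠ 0) :
    IsVeeConfig b h := by
  refine ⟨hh, hc, fun i j hij => ?_⟩
  obtain ⟨ν, hν⟩ := hb.vee (Submodule.span ℝ {b i, b j}) (finrank_span_pair (hc i j hij)) i
    (Submodule.subset_span (by simp))
  exact ⟨ν, (hh.isVeeCoefficient_span_pair (hc i j hij) ν i).1 hν⟩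

namespace IsVeeConfig

variable {a : ι → Fin 3 → ℝ} {h : LinearMap.BilinForm ℝ (Fin 3 → ℝ)}

lemma ne_zero_of_ne (ha : IsVeeConfig a h) {i j : ι} (hij : i ≠ j) : a i ≠ 0 := by
  intro h0
  apply ha.cross_ne i j hij
  rw [h0]
  funext m; fin_cases m <;> simp [cross3]

lemma exists_ne (ha : IsVeeConfig a h) (i : ι) : ∃ j, i ≠ j := by
  by_contra! hcon
  have hspan := ha.span_eq_top
  have hrange : Set.range a = {a i} := by
    ext v; constructor
    · rintro ⟨j, rfl⟩; rw [hcon j]; rfl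
    · rintro rfl; exact ⟨i, rfl⟩
  rw [hrange] at hspan
  have h1 := finrank_span_le_card (R := ℝ) ({a i} : Set (Fin 3 → ℝ))
  rw [hspan] at h1
  simp at h1

lemma ne_zero (ha : IsVeeConfig a h) (i : ι) : a i ≠ 0 := by
  obtain ⟨j, hj⟩ := ha.exists_ne i
  exact ha.ne_zero_of_ne hj

lemma injective (ha : IsVeeConfig a h) : Function.Injective a := by
  intro i j hij
  by_contra hne
  apply ha.cross_ne i j hne
  rw [hij]
  funext m; fin_cases m <;> simp [cross3] <;> ring

lemma isVeeSystem (ha : IsVeeConfig a h) : IsVeeSystem a := by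
  classical
  refine ⟨ha.injective, ha.span_eq_top, fun P hP i hi => ?_⟩
  by_cases hex : ∃ j, j ≠ i ∧ a j ∈ P
  · obtain ⟨j, hji, hj⟩ := hex
    obtain ⟨ν, hν⟩ := ha.vee i j hji.symm
    refine ⟨ν, ?_⟩
    rw [← span_pair_eq_of_mem hP hi hj (ha.cross_ne i j hji.symm),
      ha.isVeeCoefficient_span_pair (ha.cross_ne i j hji.symm)]
    exact hν
  · push Not at hex
    refine ⟨h (a i) (a i), ?_⟩
    rw [ha.isVeeCoefficient_iff]
    have : (Finset.univ.filter fun j => a j ∈ P) = {i} := by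
      ext j
      simp only [Finset.mem_filter, Finset.mem_univ, true_and, Finset.mem_singleton]
      exact ⟨fun hj => by_contra fun hne => hex j hne hj, fun hj => hj ▸ hi⟩
    rw [this, Finset.sum_singleton]

/-- Covectors spanning a 2-flat with two elements are orthogonal. -/
lemma orthogonal [DecidableEq ι] (ha : IsVeeConfig a h) {i j : ι} (hij : i ≠ j)
    (hl : lineThrough a i j = {i, j}) : h (a i) (a j) = 0 := by
  obtain ⟨ν, hν⟩ := ha.vee i j hij
  rw [hl, Finset.sum_pair hij] at hν
  have hlin := LinearIndependent.pair_iff.1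
    (linearIndependent_pair_iff.2 (ha.cross_ne i j hij)) (h (a i) (a i) - ν) (h (a j) (a i))
    (by rw [sub_smul, ← sub_eq_zero.2 hν]; abel)
  rw [ha.symm, hlin.2]

end IsVeeConfig

end Metric

/-! ### Families with the same matroid -/

section Matroid

variable {ι : Type}

/-- Two families have the same linearly dependent triples of labels. -/
def SamePattern (a b : ι → Fin 3 → ℝ) : Prop :=
  ∀ i j k, det3 (a i) (a j) (a k) = 0 ↔ det3 (b i) (b j) (b k) = 0

lemma SamePattern.lineThrough_eq [Fintype ι] {a b : ι → Fin 3 → ℝ} (hab : SamePattern a b)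
    (i j : ι) :
    lineThrough a i j = lineThrough b i j := by
  ext k; simp only [mem_lineThrough, hab i j k]

lemma linearIndepOn_triple_iff_det3 {a : ι → Fin 3 → ℝ} {i j k : ι} (hij : i ≠ j) (hik : i ≠ k)
    (hjk : j ≠ k) : LinearIndepOn ℝ a {i, j, k} ↔ det3 (a i) (a j) (a k) ≠ 0 := by
  have hinj : Function.Injective ![i, j, k] := by
    intro x y; fin_cases x <;> fin_cases y <;> simp [hij, hik, hjk, hij.symm, hik.symm, hjk.symm]
  have hr : Set.range ![i, j, k] = {i, j, k} := by
    ext x; simp [eq_comm]; tauto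
  have hc : a ∘ ![i, j, k] = ![a i, a j, a k] := by
    funext x; fin_cases x <;> rfl
  rw [← hr, linearIndepOn_range_iff hinj, hc, linearIndependent_triple_iff]

lemma linearIndepOn_pair_iff_cross3 {a : ι → Fin 3 → ℝ} {i j : ι} (hij : i ≠ j) :
    LinearIndepOn ℝ a {i, j} ↔ cross3 (a i) (a j) ≠ 0 := by
  have hinj : Function.Injective ![i, j] := by
    intro x y; fin_cases x <;> fin_cases y <;> simp [hij, hij.symm]
  have hr : Set.range ![i, j] = {i, j} := Matrix.range_cons_cons_empty _ _ _
  have hc : a ∘ ![i, j] = ![a i, a j] := by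
    funext x; fin_cases x <;> rfl
  rw [← hr, linearIndepOn_range_iff hinj, hc, linearIndependent_pair_iff]

variable [Fintype ι]

lemma vectorMatroid_indep {a : ι → Fin 3 → ℝ} {S : Set ι} :
    (vectorMatroid a).Indep S ↔ LinearIndepOn ℝ a S := by
  simp [vectorMatroid]

lemma samePattern_of_vectorMatroid_eq {a b : ι → Fin 3 → ℝ}
    (h : vectorMatroid b = vectorMatroid a) : SamePattern a b := by
  intro i j k
  by_cases hij : i = j
  · simp [hij]
  by_cases hik : i = k
  · simp [hik]
  by_cases hjk : j = k
  · simp [hjk]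
  rw [← not_iff_not, ← ne_eq, ← ne_eq, ← linearIndepOn_triple_iff_det3 hij hik hjk,
    ← linearIndepOn_triple_iff_det3 hij hik hjk, ← vectorMatroid_indep, ← vectorMatroid_indep, h]

lemma cross3_ne_zero_of_vectorMatroid_eq {a b : ι → Fin 3 → ℝ}
    (h : vectorMatroid b = vectorMatroid a) {i j : ι} (hij : i ≠ j)
    (ha : cross3 (a i) (a j) ≠ 0) : cross3 (b i) (b j) ≠ 0 := by
  rwa [← linearIndepOn_pair_iff_cross3 hij, ← vectorMatroid_indep, h, vectorMatroid_indep,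
    linearIndepOn_pair_iff_cross3 hij]

lemma mem_closure_pair_iff {a : ι → Fin 3 → ℝ} {i j : ι} (hij : i ≠ j)
    (hc : cross3 (a i) (a j) ≠ 0) (k : ι) :
    k ∈ (vectorMatroid a).closure {i, j} ↔ det3 (a i) (a j) (a k) = 0 := by
  have hI : (vectorMatroid a).Indep {i, j} :=
    vectorMatroid_indep.2 ((linearIndepOn_pair_iff_cross3 hij).2 hc)
  by_cases hk : k ∈ ({i, j} : Set ι)
  · refine iff_of_true (Matroid.mem_closure_of_mem _ hk hI.subset_ground) ?_
    rcases hk with rfl | rfl <;> simp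
  · rw [hI.mem_closure_iff_of_notMem hk, ← Matroid.not_indep_iff
      (Set.insert_subset (by simp [vectorMatroid]) hI.subset_ground), vectorMatroid_indep]
    simp only [Set.mem_insert_iff, Set.mem_singleton_iff, not_or] at hk
    rw [linearIndepOn_triple_iff_det3 hk.1 hk.2 hij, not_not, ← det3_rotate]

lemma coe_lineThrough {a : ι → Fin 3 → ℝ} {i j : ι} (hij : i ≠ j)
    (hc : cross3 (a i) (a j) ≠ 0) :
    (lineThrough a i j : Set ι) = (vectorMatroid a).closure {i, j} := by
  ext k; simp [mem_closure_pair_iff hij hc]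

lemma isFlat_lineThrough {a : ι → Fin 3 → ℝ} {i j : ι} (hij : i ≠ j)
    (hc : cross3 (a i) (a j) ≠ 0) : (vectorMatroid a).IsFlat (lineThrough a i j) ∧
      (vectorMatroid a).eRk (lineThrough a i j) = 2 := by
  have hI : (vectorMatroid a).Indep {i, j} :=
    vectorMatroid_indep.2 ((linearIndepOn_pair_iff_cross3 hij).2 hc)
  rw [coe_lineThrough hij hc]
  refine ⟨Matroid.isFlat_closure _, ?_⟩
  rw [Matroid.eRk_closure_eq, hI.eRk_eq_encard, Set.encard_pair hij]

lemma span_image_lineThrough {a : ι → Fin 3 → ℝ} {i j : ι} (hc : cross3 (a i) (a j) ≠ 0) :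
    Submodule.span ℝ (a '' (lineThrough a i j)) = Submodule.span ℝ {a i, a j} := by
  apply le_antisymm
  · rw [Submodule.span_le]
    rintro _ ⟨k, hk, rfl⟩
    exact (mem_span_pair_iff_det3 hc).2 (by simpa using hk)
  · apply Submodule.span_mono
    rintro _ (rfl | rfl)
    · exact ⟨i, by simp, rfl⟩
    · exact ⟨j, by simp, rfl⟩

/-- A 2-flat is the closure of any two of its elements. -/
lemma eq_lineThrough_of_isFlat {a : ι → Fin 3 → ℝ} {F : Set ι}
    (hF : (vectorMatroid a).IsFlat F) (hr : (vectorMatroid a).eRk F = 2) {i j : ι} (hi : i ∈ F)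
    (hj : j ∈ F) (hij : i ≠ j) (hc : cross3 (a i) (a j) ≠ 0) : F = lineThrough a i j := by
  have hI : (vectorMatroid a).Indep {i, j} :=
    vectorMatroid_indep.2 ((linearIndepOn_pair_iff_cross3 hij).2 hc)
  have hsub : ({i, j} : Set ι) ⊆ F := by rintro _ (rfl | rfl) <;> assumption
  have hB : (vectorMatroid a).IsBasis {i, j} F := by
    refine Matroid.Indep.isBasis_of_eRk_ge hI (Set.toFinite _) hsub ?_
    rw [hr, hI.eRk_eq_encard, Set.encard_pair hij]
  rw [coe_lineThrough hij hc, hB.closure_eq_closure, hF.closure]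

end Matroid

/-! ### The `ν`-function and irreducibility -/

section Nu

variable {ι : Type} [Fintype ι] {a : ι → Fin 3 → ℝ}
  {h : LinearMap.BilinForm ℝ (Fin 3 → ℝ)}

lemma IsDualForm.sum_eq_of_isNuFunction {b : ι → Fin 3 → ℝ} (hb : IsDualForm b h)
    {ν : Set ι → ℝ} (hν : IsNuFunction b ν) {i j : ι} (hij : i ≠ j)
    (hc : cross3 (b i) (b j) ≠ 0) (h2 : 2 < (lineThrough b i j).card) :
    ∑ k ∈ lineThrough b i j, h (b k) (b i) • b k = ν (lineThrough b i j) • b i := by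
  have hfl := isFlat_lineThrough hij hc
  have := hν _ hfl.1 hfl.2 (by rwa [Set.ncard_coe_finset]) i (by simp)
  rwa [span_image_lineThrough hc, hb.isVeeCoefficient_span_pair hc] at this

/-- The coefficient `ν` does not depend on the covector in the plane: a linear map of the plane
with three pairwise non-proportional eigenvectors is a multiple of the identity. -/
theorem IsVeeConfig.exists_isNuFunction (ha : IsVeeConfig a h) :
    ∃ ν : Set ι → ℝ, IsNuFunction a ν := by
  classical
  have key : ∀ F : Set ι, (vectorMatroid a).IsFlat F → (vectorMatroid a).eRk F = 2 →
      2 < F.ncard →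
      ∃ ν : ℝ, ∀ i ∈ F, IsVeeCoefficient a (Submodule.span ℝ (a '' F)) (a i) ν := by
    intro F hF hr h2
    obtain ⟨i, j, k, hi, hj, hk, hij, hik, hjk⟩ := (Set.two_lt_ncard_iff).1 h2
    have hcij := ha.cross_ne i j hij
    have hFl := eq_lineThrough_of_isFlat hF hr hi hj hij hcij
    set P := Submodule.span ℝ (a '' F) with hP
    -- the linear map of the `∨`-condition
    let T : (Fin 3 → ℝ) →ₗ[ℝ] (Fin 3 → ℝ) :=
      ∑ m with a m ∈ P, (h (a m)).smulRight (a m)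
    have hT : ∀ x, T x = ∑ m with a m ∈ P, h (a m) x • a m := fun x => by
      simp [T, LinearMap.sum_apply]
    have hfin : Module.finrank ℝ P = 2 := by
      rw [hP, hFl, span_image_lineThrough hcij, finrank_span_pair hcij]
    have heig : ∀ l ∈ F, ∃ ν : ℝ, T (a l) = ν • a l := by
      intro l hl
      obtain ⟨ν, hν⟩ := ha.isVeeSystem.vee P hfin l (Submodule.subset_span ⟨l, hl, rfl⟩)
      rw [ha.isVeeCoefficient_iff] at hν
      exact ⟨ν, by rw [hT, hν]⟩
    -- three eigenvectors in a plane have the same eigenvalue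
    have heq : ∀ l ∈ F, ∀ m ∈ F, ∀ p ∈ F, l ≠ m → l ≠ p → m ≠ p → ∀ ν μ : ℝ,
        T (a l) = ν • a l → T (a m) = μ • a m → ν = μ := by
      intro l hl m hm p hp hlm hlp hmp ν μ hν hμ
      have hclm := ha.cross_ne l m hlm
      have hp' : det3 (a l) (a m) (a p) = 0 := by
        have hFlm := eq_lineThrough_of_isFlat hF hr hl hm hlm hclm
        rw [hFlm] at hp
        simpa using hp
      obtain ⟨α, β, hαβ⟩ := exists_eq_comb_of_det3_eq_zero hclm hp'
      obtain ⟨ρ, hρ⟩ := heig p hp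
      rw [hαβ, map_add, map_smul, map_smul, hν, hμ] at hρ
      have hlin := LinearIndependent.pair_iff.1 (linearIndependent_pair_iff.2 hclm)
        (α * ν - ρ * α) (β * μ - ρ * β) (by
          simp only [sub_smul, mul_smul]
          rw [smul_add] at hρ
          rw [← sub_eq_zero] at hρ
          rw [← hρ]; abel)
      have hα : α ≠ 0 := by
        rintro rfl
        apply ha.cross_ne m p hmp
        rw [hαβ]
        funext t; fin_cases t <;> simp [cross3] <;> ring
      have hβ : β ≠ 0 := by
        rintro rfl
        apply ha.cross_ne l p hlp
        rw [hαβ]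
        funext t; fin_cases t <;> simp [cross3] <;> ring
      have h1 : ν = ρ := mul_left_cancel₀ hα (by linarith [hlin.1])
      have h2 : μ = ρ := mul_left_cancel₀ hβ (by linarith [hlin.2])
      rw [h1, h2]
    obtain ⟨ν, hν⟩ := heig i hi
    refine ⟨ν, fun l hl => ?_⟩
    rw [ha.isVeeCoefficient_iff, ← hT]
    by_cases hli : l = i
    · rw [hli, hν]
    obtain ⟨μ, hμ⟩ := heig l hl
    by_cases hlj : l = j
    · rw [hμ, heq i hi l hl k hk (Ne.symm hli) hik (hlj ▸ hjk) ν μ hν hμ]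
    · rw [hμ, heq i hi l hl j hj (Ne.symm hli) hij hlj ν μ hν hμ]
  choose! ν hν using key
  exact ⟨ν, hν⟩

/-- In dimension three, a decomposition into two parts spanning complementary subspaces isolates a
covector, and such a covector lies on no 2-flat with more than two elements. -/
theorem IsVeeConfig.isIrreducibleSystem (ha : IsVeeConfig a h)
    (hl : ∀ i, ∃ j k, i ≠ j ∧ i ≠ k ∧ j ≠ k ∧ det3 (a i) (a j) (a k) = 0) :
    IsIrreducibleSystem a := by
  intro S hS hS' hdis
  have hS0 := (Submodule.disjoint_def).1 hdis
  -- a dependent triple which meets a part of the decomposition lies in this part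
  have two : ∀ (S : Set ι), S.Nonempty →
      Disjoint (Submodule.span ℝ (a '' S)) (Submodule.span ℝ (a '' Sᶜ)) →
      2 ≤ Module.finrank ℝ (Submodule.span ℝ (a '' S)) := by
    rintro S ⟨i, hi⟩ hdis
    have hS0 := (Submodule.disjoint_def).1 hdis
    obtain ⟨j, k, hij, hik, hjk, hd⟩ := hl i
    have hjS : j ∈ S ∨ k ∈ S := by
      by_contra! hcon
      obtain ⟨α, β, hαβ⟩ := exists_eq_comb_of_det3_eq_zero (z := a i) (ha.cross_ne j k hjk)
        (by rwa [det3_rotate])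
      refine ha.ne_zero i (hS0 _ (Submodule.subset_span ⟨i, hi, rfl⟩) ?_)
      rw [hαβ]
      exact Submodule.add_mem _
        (Submodule.smul_mem _ _ (Submodule.subset_span ⟨j, hcon.1, rfl⟩))
        (Submodule.smul_mem _ _ (Submodule.subset_span ⟨k, hcon.2, rfl⟩))
    obtain ⟨l, hl, hil⟩ : ∃ l ∈ S, i ≠ l := by
      rcases hjS with hj | hk
      · exact ⟨j, hj, hij⟩
      · exact ⟨k, hk, hik⟩
    rw [← finrank_span_pair (ha.cross_ne i l hil)]
    apply Submodule.finrank_mono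
    apply Submodule.span_mono
    rintro _ (rfl | rfl)
    · exact ⟨i, hi, rfl⟩
    · exact ⟨l, hl, rfl⟩
  have h1 := two S hS hdis
  have h2 := two Sᶜ hS' (by rw [compl_compl]; exact hdis.symm)
  have h3 := Submodule.finrank_add_finrank_le_of_disjoint hdis
  rw [Module.finrank_fin_fun] at h3
  omega

lemma IsVeeConfig.lineThrough_eq_iff (ha : IsVeeConfig a h) {i j k : ι} (hij : i ≠ j)
    (hik : i ≠ k) : lineThrough a i k = lineThrough a i j ↔ k ∈ lineThrough a i j := by
  constructor
  · intro heq
    rw [← heq]; simp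
  · intro hk
    have hfl := isFlat_lineThrough hij (ha.cross_ne i j hij)
    have := eq_lineThrough_of_isFlat hfl.1 hfl.2 (by simp) (by exact_mod_cast hk) hik
      (ha.cross_ne i k hik)
    exact_mod_cast this.symm

end Nu

/-! ### The norms of the covectors are determined by the `ν`-function -/

section Norms

variable {ι : Type} [Fintype ι] [DecidableEq ι] {a b : ι → Fin 3 → ℝ}
  {h h' : LinearMap.BilinForm ℝ (Fin 3 → ℝ)}

/-- The 2-flats through `i` with more than two elements. -/
noncomputable def richLines (a : ι → Fin 3 → ℝ) (i : ι) : Finset (Finset ι) :=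
  ((Finset.univ.erase i).image (lineThrough a i)).filter fun F => 2 < F.card

/-- Completeness of the frame `a` at the covector `a i`, summed line by line. -/
lemma IsVeeConfig.norm_add_sum (ha : IsVeeConfig a h) {ν : Set ι → ℝ} (hν : IsNuFunction a ν)
    (i : ι) : h (a i) (a i) + ∑ F ∈ richLines a i, (ν F - h (a i) (a i)) = 1 := by
  have hn : 0 < h (a i) (a i) := ha.pos _ (ha.ne_zero i)
  set n := h (a i) (a i) with hndef
  set L := (Finset.univ.erase i).image (lineThrough a i) with hL
  have h1 : n ^ 2 + ∑ j ∈ Finset.univ.erase i, h (a j) (a i) ^ 2 = n := by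
    have := ha.sum_sq (a i)
    rwa [← Finset.add_sum_erase _ _ (Finset.mem_univ i)] at this
  rw [← Finset.sum_fiberwise_of_maps_to (g := lineThrough a i) (t := L)
    (fun j hj => Finset.mem_image_of_mem _ hj)] at h1
  have h2 : ∀ F ∈ L, ∑ j ∈ Finset.univ.erase i with lineThrough a i j = F, h (a j) (a i) ^ 2 =
      if 2 < F.card then n * (ν F - n) else 0 := by
    intro F hF
    obtain ⟨j, hj, rfl⟩ := Finset.mem_image.1 hF
    have hij : i ≠ j := (Finset.ne_of_mem_erase hj).symm
    have hfil : (Finset.univ.erase i).filter (fun k => lineThrough a i k = lineThrough a i j) =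
        (lineThrough a i j).erase i := by
      ext k
      simp only [Finset.mem_filter, Finset.mem_erase, Finset.mem_univ, and_true]
      refine and_congr_right fun hk => ha.lineThrough_eq_iff hij (Ne.symm hk)
    rw [hfil]
    split_ifs with hc
    · have h3 := ha.sum_eq_of_isNuFunction hν hij (ha.cross_ne i j hij) hc
      have h4 := congrArg (fun v => h v (a i)) h3
      simp only [map_sum, map_smul, LinearMap.sum_apply, LinearMap.smul_apply, smul_eq_mul] at h4
      rw [← Finset.add_sum_erase _ _ (show i ∈ lineThrough a i j by simp), ← hndef] at h4
      simp only [← sq] at h4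
      linarith
    · have hsub : ({i, j} : Finset ι) ⊆ lineThrough a i j := by
        intro x hx
        rcases Finset.mem_insert.1 hx with rfl | hx
        · simp
        · rw [Finset.mem_singleton.1 hx]; simp
      have h3 : lineThrough a i j = {i, j} :=
        (Finset.eq_of_subset_of_card_le hsub (by rw [Finset.card_pair hij]; omega)).symm
      rw [h3, Finset.erase_insert (by simpa using hij), Finset.sum_singleton, ha.symm,
        ha.orthogonal hij h3]
      simp
  rw [Finset.sum_congr rfl h2, ← Finset.sum_filter, ← Finset.mul_sum] at h1
  have h5 : n * (n + ∑ F ∈ L with 2 < F.card, (ν F - n)) = n * 1 := by linarith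
  exact mul_left_cancel₀ hn.ne' h5

/-- A covector lying on at least two 2-flats with more than two elements has its norm determined by
the matroid and the `ν`-function. -/
theorem IsVeeConfig.norm_eq (ha : IsVeeConfig a h) (hb : IsVeeConfig b h')
    (hab : SamePattern a b) {ν : Set ι → ℝ} (hνa : IsNuFunction a ν) (hνb : IsNuFunction b ν)
    (i : ι) (hi : 2 ≤ (richLines a i).card) : h (a i) (a i) = h' (b i) (b i) := by
  have h1 := ha.norm_add_sum hνa i
  have h2 := hb.norm_add_sum hνb i
  have hr : richLines b i = richLines a i := by
    simp only [richLines]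
    congr 2
    funext j
    exact (hab.lineThrough_eq i j).symm
  rw [hr] at h2
  rw [Finset.sum_sub_distrib, Finset.sum_const, nsmul_eq_mul] at h1 h2
  have hk : (2 : ℝ) ≤ (richLines a i).card := by exact_mod_cast hi
  have h3 : ((richLines a i).card - 1 : ℝ) * (h (a i) (a i) - h' (b i) (b i)) = 0 := by linarith
  rcases mul_eq_zero.1 h3 with h4 | h4 <;> linarith

end Norms

/-! ### Determination of the scale factors -/

section Scale

variable {ι : Type} [Fintype ι] [DecidableEq ι] {a b : ι → Fin 3 → ℝ}
  {h h' : LinearMap.BilinForm ℝ (Fin 3 → ℝ)}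

lemma IsVeeConfig.coeff_eq (ha : IsVeeConfig a h) {i j k : ι} (hij : i ≠ j) (hik : i ≠ k)
    (hjk : j ≠ k) (hl : lineThrough a i j = {i, j, k}) {x y z : ℝ}
    (hrel : x • a i + y • a j + z • a k = 0) :
    ∃ ν : ℝ, x * h (a j) (a i) = y * (h (a i) (a i) - ν) ∧
      x * h (a k) (a i) = z * (h (a i) (a i) - ν) ∧
      x ^ 2 * h (a i) (a i) = - (y ^ 2 + z ^ 2) * (h (a i) (a i) - ν) := by
  obtain ⟨ν, hν⟩ := ha.vee i j hij
  rw [hl, Finset.sum_insert (by simp [hij, hik]), Finset.sum_pair hjk] at hν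
  set n := h (a i) (a i) with hn
  have hlin := LinearIndependent.pair_iff.1
    (linearIndependent_pair_iff.2 (ha.cross_ne j k hjk))
    (x * h (a j) (a i) - (n - ν) * y) (x * h (a k) (a i) - (n - ν) * z) (by
      have e1 : x • (n • a i + (h (a j) (a i) • a j + h (a k) (a i) • a k) - ν • a i) -
        (n - ν) • (x • a i + y • a j + z • a k) = 0 := by
          rw [hrel, hν]; simp
      rw [← e1]; module)
  have e1 : x * h (a j) (a i) = y * (n - ν) := by linarith [hlin.1]
  have e2 : x * h (a k) (a i) = z * (n - ν) := by linarith [hlin.2]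
  have e3 : x * n + y * h (a j) (a i) + z * h (a k) (a i) = 0 := by
    have := congrArg (fun v => h v (a i)) hrel
    simpa [hn] using this
  refine ⟨ν, e1, e2, ?_⟩
  linear_combination x * e3 - y * e1 - z * e2

/-- The three covectors of a 2-flat with three elements form a tight frame of its plane; the
squares of the coefficients of the linear relation between them are determined by their norms,
up to a common factor. -/
lemma IsVeeConfig.norms_of_relation (ha : IsVeeConfig a h) {i j k : ι} (hij : i ≠ j)
    (hik : i ≠ k) (hjk : j ≠ k) (hl : lineThrough a i j = {i, j, k}) {x y z : ℝ} (hx : x ≠ 0)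
    (hy : y ≠ 0) (hz : z ≠ 0) (hrel : x • a i + y • a j + z • a k = 0) :
    ∃ κ : ℝ, h (a i) (a i) = κ * (y ^ 2 + z ^ 2) ∧ h (a j) (a j) = κ * (x ^ 2 + z ^ 2) ∧
      h (a k) (a k) = κ * (x ^ 2 + y ^ 2) := by
  have hmemk : k ∈ lineThrough a i j := by rw [hl]; simp
  have hlj : lineThrough a j i = {j, i, k} := by
    have : lineThrough a j i = lineThrough a i j := by
      ext m; simp [det3_swap (a i) (a j)]
    rw [this, hl, Finset.insert_comm]
  have hlk : lineThrough a k i = {k, i, j} := by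
    have h1 : lineThrough a k i = lineThrough a i k := by
      ext m; simp [det3_swap (a i) (a k)]
    rw [h1, (ha.lineThrough_eq_iff hij hik).2 hmemk, hl]
    ext m; simp; tauto
  obtain ⟨ν, h1, h2, h3⟩ := ha.coeff_eq hij hik hjk hl hrel
  obtain ⟨μ, h4, h5, h6⟩ := ha.coeff_eq hij.symm hjk hik hlj (x := y) (y := x) (z := z)
    (by rw [← hrel]; abel)
  obtain ⟨ρ, h7, h8, h9⟩ := ha.coeff_eq hik.symm hjk.symm hij hlk (x := z) (y := x) (z := y)
    (by rw [← hrel]; abel)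
  rw [ha.symm (a i) (a j)] at h4
  rw [ha.symm (a i) (a k)] at h7
  have hx2 : x ^ 2 ≠ 0 := pow_ne_zero 2 hx
  refine ⟨-(h (a i) (a i) - ν) / x ^ 2, ?_, ?_, ?_⟩
  · rw [div_mul_eq_mul_div, eq_div_iff hx2]; linear_combination h3
  · have e1 : y * y * (h (a i) (a i) - ν) = x * x * (h (a j) (a j) - μ) := by
      linear_combination x * h4 - y * h1
    rw [div_mul_eq_mul_div, eq_div_iff hx2]
    apply mul_left_cancel₀ (pow_ne_zero 2 hy)
    linear_combination x ^ 2 * h6 - (x ^ 2 + z ^ 2) * e1 * (-1)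
  · have e1 : z * z * (h (a i) (a i) - ν) = x * x * (h (a k) (a k) - ρ) := by
      linear_combination x * h7 - z * h2
    rw [div_mul_eq_mul_div, eq_div_iff hx2]
    apply mul_left_cancel₀ (pow_ne_zero 2 hz)
    linear_combination x ^ 2 * h9 - (x ^ 2 + y ^ 2) * e1 * (-1)

variable {l : ι → ℝ}

/-- On a 2-flat with three elements, equality of the norms forces the scale factors to be equal up
to sign. -/
lemma sq_scale_eq_of_line (ha : IsVeeConfig a h) (hb : IsVeeConfig b h')
    (hl0 : ∀ i, l i ≠ 0) (hlab : ∀ i, b i = l i • a i)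
    (hn : ∀ i, h (a i) (a i) = h' (b i) (b i)) {i j k : ι} (hij : i ≠ j) (hik : i ≠ k)
    (hjk : j ≠ k) (hl : lineThrough a i j = {i, j, k}) :
    l j ^ 2 = l i ^ 2 ∧ l k ^ 2 = l i ^ 2 := by
  have hab : SamePattern a b := fun p q r => by
    rw [hlab, hlab, hlab, det3_smul]; simp [hl0]
  have hmemk : det3 (a i) (a j) (a k) = 0 := by
    have : k ∈ lineThrough a i j := by rw [hl]; simp
    simpa using this
  obtain ⟨x, y, hxy⟩ := exists_eq_comb_of_det3_eq_zero (ha.cross_ne i j hij) hmemk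
  have hx : x ≠ 0 := by
    rintro rfl
    apply ha.cross_ne j k hjk
    rw [hxy]; funext t; fin_cases t <;> simp [cross3] <;> ring
  have hy : y ≠ 0 := by
    rintro rfl
    apply ha.cross_ne i k hik
    rw [hxy]; funext t; fin_cases t <;> simp [cross3] <;> ring
  obtain ⟨κ, h1, h2, h3⟩ := ha.norms_of_relation hij hik hjk hl hx hy (z := -1) (by norm_num)
    (by rw [hxy]; module)
  have hne : ∀ i, (l i)⁻¹ ≠ 0 := fun i => inv_ne_zero (hl0 i)
  obtain ⟨μ, h4, h5, h6⟩ := hb.norms_of_relation hij hik hjk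
    (by rw [← hab.lineThrough_eq, hl]) (x := x * (l i)⁻¹) (y := y * (l j)⁻¹)
    (z := -1 * (l k)⁻¹) (mul_ne_zero hx (hne i)) (mul_ne_zero hy (hne j))
    (mul_ne_zero (by norm_num) (hne k)) (by
      rw [hlab, hlab, hlab, smul_smul, smul_smul, smul_smul, mul_assoc, mul_assoc, mul_assoc,
        inv_mul_cancel₀ (hl0 i), inv_mul_cancel₀ (hl0 j), inv_mul_cancel₀ (hl0 k), hxy]
      module)
  rw [← hn] at h4 h5 h6
  have e1 : κ * x ^ 2 = μ * (x * (l i)⁻¹) ^ 2 := by linarith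
  have e2 : κ * y ^ 2 = μ * (y * (l j)⁻¹) ^ 2 := by linarith
  have e3 : κ * (-1) ^ 2 = μ * (-1 * (l k)⁻¹) ^ 2 := by linarith
  have hκ : κ ≠ 0 := by
    rintro rfl
    have := ha.pos _ (ha.ne_zero i)
    rw [h1, zero_mul] at this
    exact lt_irrefl _ this
  have f : ∀ (x : ℝ) (m : ι), x ≠ 0 → κ * x ^ 2 = μ * (x * (l m)⁻¹) ^ 2 → l m ^ 2 = μ / κ := by
    intro x m hx he
    have hm := hl0 m
    rw [eq_div_iff hκ]
    field_simp at he
    linarith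
  rw [f x i hx e1, f y j hy e2, f (-1) k (by norm_num) e3]
  exact ⟨rfl, rfl⟩

/-- The 2-flat through `i` and `j` has at most three elements, so that its metric is determined by
the norms. -/
def OnShortLine (a : ι → Fin 3 → ℝ) (i j : ι) : Prop :=
  lineThrough a i j = {i, j} ∨ ∃ v, i ≠ v ∧ j ≠ v ∧ lineThrough a i j = {i, j, v}

/-- The 2-flat through `i` and `j` has exactly three elements. -/
def OnTripleLine (a : ι → Fin 3 → ℝ) (i j : ι) : Prop :=
  ∃ k, i ≠ j ∧ i ≠ k ∧ j ≠ k ∧ lineThrough a i j = {i, j, k}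

lemma sq_scale_eq_of_reflTransGen (ha : IsVeeConfig a h) (hb : IsVeeConfig b h')
    (hl0 : ∀ i, l i ≠ 0) (hlab : ∀ i, b i = l i • a i)
    (hn : ∀ i, h (a i) (a i) = h' (b i) (b i)) {i j : ι}
    (hij : Relation.ReflTransGen (OnTripleLine a) i j) : l j ^ 2 = l i ^ 2 := by
  induction hij with
  | refl => rfl
  | tail _ hjk ih =>
    obtain ⟨k, h1, h2, h3, hl⟩ := hjk
    rw [(sq_scale_eq_of_line ha hb hl0 hlab hn h1 h2 h3 hl).1, ih]

/-- If the covectors of a basis `a p`, `a q`, `a r` are linked by 2-flats with three elements, and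
pairwise span 2-flats with at most three elements, then the forms of `a` and of its rescaling `b`
with the same norms are proportional, because the difference `l p ^ 2 • h' - h` vanishes on all
pairs of basis vectors. -/
theorem sq_scale_eq (ha : IsVeeConfig a h) (hb : IsVeeConfig b h')
    (hl0 : ∀ i, l i ≠ 0) (hlab : ∀ i, b i = l i • a i)
    (hn : ∀ i, h (a i) (a i) = h' (b i) (b i)) {p q r : ι}
    (hd : det3 (a p) (a q) (a r) ≠ 0)
    (hpq : Relation.ReflTransGen (OnTripleLine a) p q)
    (hpr : Relation.ReflTransGen (OnTripleLine a) p r)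
    (spq : OnShortLine a p q) (sqr : OnShortLine a q r) (spr : OnShortLine a p r) (i : ι) :
    l i ^ 2 = l p ^ 2 := by
  have npq : p ≠ q := by rintro rfl; simp at hd
  have nqr : q ≠ r := by rintro rfl; simp at hd
  have npr : p ≠ r := by rintro rfl; simp at hd
  have hab : SamePattern a b := fun p q r => by
    rw [hlab, hlab, hlab, det3_smul]; simp [hl0]
  have hq := sq_scale_eq_of_reflTransGen ha hb hl0 hlab hn hpq
  have hr := sq_scale_eq_of_reflTransGen ha hb hl0 hlab hn hpr
  set c := l p ^ 2 with hc
  have diag : ∀ m, l m ^ 2 = c → c * h' (a m) (a m) = h (a m) (a m) := by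
    intro m hm
    rw [hn m, hlab m, ← hm]
    simp; ring
  -- polarisation on a dependent triple
  have polar : ∀ x y z : ι, x ≠ z → y ≠ z → x ≠ y → det3 (a x) (a y) (a z) = 0 →
      l x ^ 2 = c → l y ^ 2 = c → l z ^ 2 = c →
      c * h' (a x) (a y) = h (a x) (a y) := by
    intro x y z hxz hyz hxy hdet hx hy hz
    obtain ⟨α, β, hαβ⟩ := exists_eq_comb_of_det3_eq_zero (ha.cross_ne x y hxy) hdet
    have hα : α ≠ 0 := by
      rintro rfl
      apply ha.cross_ne y z hyz
      rw [hαβ]; funext t; fin_cases t <;> simp [cross3] <;> ring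
    have hβ : β ≠ 0 := by
      rintro rfl
      apply ha.cross_ne x z hxz
      rw [hαβ]; funext t; fin_cases t <;> simp [cross3] <;> ring
    have d1 := diag x hx
    have d2 := diag y hy
    have d3 := diag z hz
    rw [hαβ] at d3
    simp only [map_add, map_smul, LinearMap.add_apply, LinearMap.smul_apply, smul_eq_mul] at d3
    rw [ha.symm (a y) (a x), hb.symm (a y) (a x)] at d3
    apply mul_left_cancel₀ (mul_ne_zero (mul_ne_zero two_ne_zero hα) hβ)
    linear_combination d3 - α ^ 2 * d1 - β ^ 2 * d2
  have short : ∀ {x y : ι}, x ≠ y → l x ^ 2 = c → l y ^ 2 = c → OnShortLine a x y →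
      c * h' (a x) (a y) = h (a x) (a y) := by
    rintro x y hxy hx hy (hl | ⟨v, hxv, hyv, hl⟩)
    · have h1 := ha.orthogonal hxy hl
      have h2 := hb.orthogonal hxy (by rw [← hab.lineThrough_eq, hl])
      rw [hlab, hlab] at h2
      simp only [map_smul, LinearMap.smul_apply, smul_eq_mul, mul_eq_zero, hl0, false_or] at h2
      rw [h1, h2, mul_zero]
    · have hv := (sq_scale_eq_of_line ha hb hl0 hlab hn hxy hxv hyv hl).2
      refine polar x y v hxv hyv hxy ?_ hx hy (hv.trans hx)
      have : v ∈ lineThrough a x y := by rw [hl]; simp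
      simpa using this
  have hpq2 := short npq rfl hq spq
  have hqr2 := short nqr hq hr sqr
  have hpr2 := short npr rfl hr spr
  have hp1 := diag p rfl
  have hq1 := diag q hq
  have hr1 := diag r hr
  have hi : c * h' (a i) (a i) = h (a i) (a i) := by
    obtain ⟨α, β, γ, hi⟩ : ∃ α β γ : ℝ, a i = α • a p + β • a q + γ • a r :=
      ⟨_, _, _, exists_eq_comb_of_det3_ne_zero hd (a i)⟩
    rw [hi]
    simp only [map_add, map_smul, LinearMap.add_apply, LinearMap.smul_apply, smul_eq_mul]
    rw [ha.symm (a q) (a p), ha.symm (a r) (a p), ha.symm (a r) (a q), hb.symm (a q) (a p),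
      hb.symm (a r) (a p), hb.symm (a r) (a q)]
    linear_combination α ^ 2 * hp1 + β ^ 2 * hq1 + γ ^ 2 * hr1 + 2 * α * β * hpq2 +
      2 * β * γ * hqr2 + 2 * α * γ * hpr2
  have hpos : h' (a i) (a i) ≠ 0 := (hb.pos _ (ha.ne_zero i)).ne'
  apply mul_right_cancel₀ hpos
  rw [hi, hn i, hlab i]
  simp; ring

end Scale

/-! ### From projective rigidity to uniqueness and local uniqueness -/

section Criterion

variable {ι : Type} [Fintype ι]

lemma IsVeeConfig.pullback {b : ι → Fin 3 → ℝ} {h : LinearMap.BilinForm ℝ (Fin 3 → ℝ)}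
    (hb : IsVeeConfig b h) (g : (Fin 3 → ℝ) ≃ₗ[ℝ] (Fin 3 → ℝ)) (σ : Equiv.Perm ι) :
    IsVeeConfig (fun i => g.symm (b (σ i)))
      (h.compl₁₂ g.toLinearMap g.toLinearMap) := by
  have hcross : ∀ i j, i ≠ j → cross3 (g.symm (b (σ i))) (g.symm (b (σ j))) ≠ 0 := by
    intro i j hij
    rw [← linearIndependent_pair_iff]
    have h1 := linearIndependent_pair_iff.2 (hb.cross_ne (σ i) (σ j) (σ.injective.ne hij))
    have h2 : ![g.symm (b (σ i)), g.symm (b (σ j))] = g.symm ∘ ![b (σ i), b (σ j)] := by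
      funext x; fin_cases x <;> rfl
    rw [h2]
    exact (g.symm.toLinearMap.linearIndependent_iff (LinearEquiv.ker g.symm)).2 h1
  refine ⟨⟨fun x y => ?_, fun x hx => ?_, fun x => ?_⟩, hcross, fun i j hij => ?_⟩
  · simp [hb.symm (g x)]
  · simpa using hb.pos (g x) (by simpa using hx)
  · apply g.injective
    rw [map_sum]
    simp only [map_smul, LinearMap.compl₁₂_apply, LinearEquiv.coe_coe, LinearEquiv.apply_symm_apply]
    rw [Equiv.sum_comp σ (fun j => h (b j) (g x) • b j), hb.sum_eq]
  · obtain ⟨ν, hν⟩ := hb.vee (σ i) (σ j) (σ.injective.ne hij)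
    refine ⟨ν, ?_⟩
    apply g.injective
    rw [map_sum]
    simp only [map_smul, LinearMap.compl₁₂_apply, LinearEquiv.coe_coe, LinearEquiv.apply_symm_apply]
    rw [← hν]
    refine Finset.sum_equiv σ (fun k => ?_) (fun k _ => rfl)
    simp only [mem_lineThrough]
    exact det3_map_linearEquiv g.symm

/-- A `∨`-system is determined by its matroid and `ν`-function if every realisation of its matroid
is, up to a linear map, a rescaling of the system in which the covectors are possibly permuted by
a permutation that preserves their norms. -/
theorem isUniquelyDetermined_of_projective [DecidableEq ι] {a : ι → Fin 3 → ℝ}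
    {h : LinearMap.BilinForm ℝ (Fin 3 → ℝ)} (ha : IsVeeConfig a h)
    (hrich : ∀ i, 2 ≤ (richLines a i).card)
    (hcore : ∃ p q r, det3 (a p) (a q) (a r) ≠ 0 ∧
      Relation.ReflTransGen (OnTripleLine a) p q ∧ Relation.ReflTransGen (OnTripleLine a) p r ∧
      OnShortLine a p q ∧ OnShortLine a q r ∧ OnShortLine a p r)
    (hproj : ∀ b : ι → Fin 3 → ℝ, SamePattern a b → (∀ i, b i ≠ 0) →
      ∃ (σ : Equiv.Perm ι) (g : (Fin 3 → ℝ) ≃ₗ[ℝ] (Fin 3 → ℝ)) (l : ι → ℝ), (∀ i, l i ≠ 0) ∧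
        (∀ i, b (σ i) = l i • g (a i)) ∧ ∀ i, h (a (σ i)) (a (σ i)) = h (a i) (a i)) :
    IsUniquelyDetermined a := by
  intro ν hνa b hbv hM hνb
  have hab := samePattern_of_vectorMatroid_eq hM
  obtain ⟨h', hh'⟩ := exists_isDualForm hbv.span_eq_top
  have hb := isVeeConfig_of_isVeeSystem hbv hh' fun i j hij =>
    cross3_ne_zero_of_vectorMatroid_eq hM hij (ha.cross_ne i j hij)
  have hnorm : ∀ i, h (a i) (a i) = h' (b i) (b i) := fun i =>
    ha.norm_eq hb hab hνa hνb i (hrich i)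
  obtain ⟨σ, g, l, hl0, hl, hσ⟩ := hproj b hab hb.ne_zero
  obtain ⟨p, q, r, hd, hpq, hpr, spq, sqr, spr⟩ := hcore
  have hsq := sq_scale_eq ha (hb.pullback g σ) hl0 (fun i => by simp [hl]) (fun i => by
    rw [← hσ, hnorm]; simp) hd hpq hpr spq sqr spr
  refine ⟨g.trans (LinearEquiv.smulOfNeZero ℝ (Fin 3 → ℝ) (l p) (hl0 p)), σ, fun i => ?_⟩
  rw [hl i]
  rcases sq_eq_sq_iff_eq_or_eq_neg.1 (hsq i) with h1 | h1
  · left; simp [h1]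
  · right; simp [h1]

/-- Uniqueness implies local uniqueness.  For fixed signs `ε` and a fixed permutation `σ`, the
families of the form `b (σ i) = ε i • g (a i)` with `g` linear form a linear subspace, which is
closed.  Near `a` only the subspaces containing `a` matter, and these consist of images of `a` under
linear maps with trivial signs and permutation. -/
theorem IsUniquelyDetermined.isLocallyUniquelyDetermined {a : ι → Fin 3 → ℝ}
    (hspan : Submodule.span ℝ (Set.range a) = ⊤) (hu : IsUniquelyDetermined a) :
    IsLocallyUniquelyDetermined a := by
  classical
  intro ν hν
  let T : (ι → ℤˣ) → Equiv.Perm ι → ((Fin 3 → ℝ) →ₗ[ℝ] (Fin 3 → ℝ)) →ₗ[ℝ] (ι → Fin 3 → ℝ) :=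
    fun ε σ => LinearMap.pi fun j =>
      (((ε (σ.symm j) : ℤ) : ℝ)) • LinearMap.applyₗ (a (σ.symm j))
  have hT : ∀ ε σ g i, T ε σ g (σ i) = ((ε i : ℤ) : ℝ) • g (a i) := by
    intro ε σ g i; simp [T]
  have hcl : ∀ ε σ, IsClosed ((LinearMap.range (T ε σ) : Set (ι → Fin 3 → ℝ))) := fun ε σ =>
    Submodule.closed_of_finiteDimensional _
  have hev : ∀ᶠ b in 𝓝 a, ∀ ε σ, a ∉ LinearMap.range (T ε σ) → b ∉ LinearMap.range (T ε σ) := by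
    rw [Filter.eventually_all]; intro ε
    rw [Filter.eventually_all]; intro σ
    by_cases hmem : a ∈ LinearMap.range (T ε σ)
    · exact Filter.Eventually.of_forall fun b hb => absurd hmem hb
    · filter_upwards [(hcl ε σ).isOpen_compl.mem_nhds hmem] with b hb _
      exact hb
  filter_upwards [hev] with b hb hbv hM hνb
  obtain ⟨g, σ, hg⟩ := hu ν hν b hbv hM hνb
  have hsign : ∀ i, ∃ ε : ℤˣ, b (σ i) = ((ε : ℤ) : ℝ) • g (a i) := fun i => by
    rcases hg i with h1 | h1
    · exact ⟨1, by simp [h1]⟩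
    · exact ⟨-1, by simp [h1]⟩
  choose ε hε using hsign
  have hbT : b ∈ LinearMap.range (T ε σ) := by
    refine ⟨g.toLinearMap, funext fun j => ?_⟩
    obtain ⟨i, rfl⟩ := σ.surjective j
    rw [hT, hε]; rfl
  obtain ⟨k, hk⟩ : a ∈ LinearMap.range (T ε σ) := by
    by_contra hcon
    exact hb ε σ hcon hbT
  have hk' : ∀ i, a (σ i) = ((ε i : ℤ) : ℝ) • k (a i) := fun i => by
    rw [← hT, hk]
  have hksurj : Function.Surjective k := by
    rw [← LinearMap.range_eq_top, ← top_le_iff, ← hspan, Submodule.span_le]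
    rintro _ ⟨j, rfl⟩
    obtain ⟨i, rfl⟩ := σ.surjective j
    exact ⟨((ε i : ℤ) : ℝ) • a i, by rw [map_smul, hk']⟩
  let e : (Fin 3 → ℝ) ≃ₗ[ℝ] (Fin 3 → ℝ) :=
    LinearEquiv.ofBijective k ⟨LinearMap.injective_iff_surjective.2 hksurj, hksurj⟩
  refine ⟨e.symm.trans g, fun j => ?_⟩
  obtain ⟨i, rfl⟩ := σ.surjective j
  have h1 : e.symm (a (σ i)) = ((ε i : ℤ) : ℝ) • a i := by
    rw [LinearEquiv.symm_apply_eq, map_smul, hk']; rfl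
  rw [LinearEquiv.trans_apply, h1, map_smul, hε]

end Criterion

/-! ### Projective rigidity by intersecting lines -/

section Projective

/-- Two projective frames in dimension three differ by a linear map, up to scale factors. -/
lemma exists_linearEquiv_of_frame {x₀ x₁ x₂ x₃ y₀ y₁ y₂ y₃ : Fin 3 → ℝ}
    (hx : det3 x₀ x₁ x₂ ≠ 0) (hx₀ : det3 x₃ x₁ x₂ ≠ 0) (hx₁ : det3 x₀ x₃ x₂ ≠ 0)
    (hx₂ : det3 x₀ x₁ x₃ ≠ 0) (hy : det3 y₀ y₁ y₂ ≠ 0) (hy₀ : det3 y₃ y₁ y₂ ≠ 0)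
    (hy₁ : det3 y₀ y₃ y₂ ≠ 0) (hy₂ : det3 y₀ y₁ y₃ ≠ 0) :
    ∃ g : (Fin 3 → ℝ) ≃ₗ[ℝ] (Fin 3 → ℝ), (∃ c : ℝ, c ≠ 0 ∧ y₀ = c • g x₀) ∧
      (∃ c : ℝ, c ≠ 0 ∧ y₁ = c • g x₁) ∧ (∃ c : ℝ, c ≠ 0 ∧ y₂ = c • g x₂) ∧
      (∃ c : ℝ, c ≠ 0 ∧ y₃ = c • g x₃) := by
  have ex := exists_eq_comb_of_det3_ne_zero hx x₃
  have ey := exists_eq_comb_of_det3_ne_zero hy y₃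
  have a0 := div_ne_zero hx₀ hx
  have a1 := div_ne_zero hx₁ hx
  have a2 := div_ne_zero hx₂ hx
  have b0 := div_ne_zero hy₀ hy
  have b1 := div_ne_zero hy₁ hy
  have b2 := div_ne_zero hy₂ hy
  set α₀ := det3 x₃ x₁ x₂ / det3 x₀ x₁ x₂
  set α₁ := det3 x₀ x₃ x₂ / det3 x₀ x₁ x₂
  set α₂ := det3 x₀ x₁ x₃ / det3 x₀ x₁ x₂
  set β₀ := det3 y₃ y₁ y₂ / det3 y₀ y₁ y₂
  set β₁ := det3 y₀ y₃ y₂ / det3 y₀ y₁ y₂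
  set β₂ := det3 y₀ y₁ y₃ / det3 y₀ y₁ y₂
  let X := basisOfLinearIndependentOfCardEqFinrank (linearIndependent_triple_iff.2 hx) (by simp)
  let Y := basisOfLinearIndependentOfCardEqFinrank (linearIndependent_triple_iff.2
    (show det3 ((β₀ / α₀) • y₀) ((β₁ / α₁) • y₁) ((β₂ / α₂) • y₂) ≠ 0 by
      rw [det3_smul]
      exact mul_ne_zero (mul_ne_zero (mul_ne_zero (div_ne_zero b0 a0) (div_ne_zero b1 a1))
        (div_ne_zero b2 a2)) hy)) (by simp)
  let g := X.equiv Y (Equiv.refl _)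
  have g0 : g x₀ = (β₀ / α₀) • y₀ := by
    have := X.equiv_apply 0 Y (Equiv.refl _)
    simpa [X, Y] using this
  have g1 : g x₁ = (β₁ / α₁) • y₁ := by
    have := X.equiv_apply 1 Y (Equiv.refl _)
    simpa [X, Y] using this
  have g2 : g x₂ = (β₂ / α₂) • y₂ := by
    have := X.equiv_apply 2 Y (Equiv.refl _)
    simpa [X, Y] using this
  have g3 : g x₃ = y₃ := by
    rw [ex, map_add, map_add, map_smul, map_smul, map_smul, g0, g1, g2, smul_smul, smul_smul,
      smul_smul, mul_div_cancel₀ _ a0, mul_div_cancel₀ _ a1, mul_div_cancel₀ _ a2, ← ey]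
  have hmul : ∀ {α β : ℝ}, α ≠ 0 → β ≠ 0 → α / β * (β / α) = 1 := by
    intro α β hα hβ; field_simp
  refine ⟨g, ⟨α₀ / β₀, div_ne_zero a0 b0, ?_⟩, ⟨α₁ / β₁, div_ne_zero a1 b1, ?_⟩,
    ⟨α₂ / β₂, div_ne_zero a2 b2, ?_⟩, ⟨1, one_ne_zero, by rw [g3, one_smul]⟩⟩
  · rw [g0, smul_smul, hmul a0 b0, one_smul]
  · rw [g1, smul_smul, hmul a1 b1, one_smul]
  · rw [g2, smul_smul, hmul a2 b2, one_smul]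

variable {R : Type*} [CommRing R] {n : ℕ}

/-- The real covectors given by directions with coordinates in `R`. -/
def realize (f : R →+* ℝ) (u : Fin n → Fin 3 → R) : Fin n → Fin 3 → ℝ := fun i m => f (u i m)

lemma det3_realize_eq_zero_iff {f : R →+* ℝ} (hf : Function.Injective f)
    {u : Fin n → Fin 3 → R} {i j k : Fin n} :
    det3 (realize f u i) (realize f u j) (realize f u k) = 0 ↔ det3 (u i) (u j) (u k) = 0 := by
  change det3 (fun m => f (u i m)) (fun m => f (u j m)) (fun m => f (u k m)) = 0 ↔ _
  rw [det3_map]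
  exact map_eq_zero_iff f hf

lemma cross3_realize_ne_zero {f : R →+* ℝ} (hf : Function.Injective f) {x y : Fin 3 → R}
    (h : cross3 x y ≠ 0) : cross3 (fun m => f (x m)) (fun m => f (y m)) ≠ 0 := by
  rw [cross3_map]
  obtain ⟨m, hm⟩ := Function.ne_iff.1 h
  exact Function.ne_iff.2 ⟨m, fun h0 => hm ((map_eq_zero_iff f hf).1 h0)⟩

/-- The point `point` is the intersection of the lines `p q` and `r s` of the projective plane. -/
structure Intersection (n : ℕ) where
  (point p q r s : Fin n)

/-- Beginning with the labels in `K`, all labels are reached by taking the listed intersections of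
lines through points found before. -/
def Constructs (u : Fin n → Fin 3 → R) : List (Fin n) → List (Intersection n) → Prop
  | K, [] => ∀ i, i ∈ K
  | K, e :: S => (e.p ∈ K ∧ e.q ∈ K ∧ e.r ∈ K ∧ e.s ∈ K ∧
      det3 (u e.point) (u e.p) (u e.q) = 0 ∧ det3 (u e.point) (u e.r) (u e.s) = 0 ∧
      cross3 (cross3 (u e.p) (u e.q)) (cross3 (u e.r) (u e.s)) ≠ 0) ∧
      Constructs u (e.point :: K) S

instance Constructs.decidable [DecidableEq R] (u : Fin n → Fin 3 → R) :
    ∀ (K : List (Fin n)) (S : List (Intersection n)), Decidable (Constructs u K S)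
  | K, [] => inferInstanceAs (Decidable (∀ i, i ∈ K))
  | K, e :: S =>
    haveI := Constructs.decidable u (e.point :: K) S
    inferInstanceAs (Decidable ((e.p ∈ K ∧ e.q ∈ K ∧ e.r ∈ K ∧ e.s ∈ K ∧
      det3 (u e.point) (u e.p) (u e.q) = 0 ∧ det3 (u e.point) (u e.r) (u e.s) = 0 ∧
      cross3 (cross3 (u e.p) (u e.q)) (cross3 (u e.r) (u e.s)) ≠ 0) ∧
      Constructs u (e.point :: K) S))

/-- If two families have the same matroid and agree projectively on the labels in `K`, then they
agree on all points constructed from these. -/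
theorem Constructs.forall_eq_smul {f : R →+* ℝ} (hf : Function.Injective f)
    {u : Fin n → Fin 3 → R} {b : Fin n → Fin 3 → ℝ} (hb : SamePattern (realize f u) b)
    (hb0 : ∀ i, b i ≠ 0) (hu0 : ∀ i, realize f u i ≠ 0) (g : (Fin 3 → ℝ) ≃ₗ[ℝ] (Fin 3 → ℝ)) :
    ∀ {S : List (Intersection n)} {K : List (Fin n)}, Constructs u K S →
      (∀ i ∈ K, ∃ c : ℝ, c ≠ 0 ∧ b i = c • g (realize f u i)) →
      ∀ i, ∃ c : ℝ, c ≠ 0 ∧ b i = c • g (realize f u i) := by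
  intro S
  induction S with
  | nil => intro K hS hK i; exact hK i (hS i)
  | cons e S ih =>
    rintro K ⟨⟨hp, hq, hr, hs, h1, h2, h3⟩, hS⟩ hK
    refine ih hS fun i hi => ?_
    rcases List.mem_cons.1 hi with rfl | hi
    swap
    · exact hK i hi
    have onLine : ∀ {p q : Fin n}, p ∈ K → q ∈ K → det3 (u e.point) (u p) (u q) = 0 →
        det3 (g.symm (b e.point)) (realize f u p) (realize f u q) = 0 := by
      intro p q hp hq hd
      obtain ⟨c, hc, hcp⟩ := hK p hp
      obtain ⟨d, hd0, hdq⟩ := hK q hq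
      have h4 := (hb e.point p q).1 ((det3_realize_eq_zero_iff hf).2 hd)
      have h5 : b e.point = (1 : ℝ) • g (g.symm (b e.point)) := by simp
      rw [hcp, hdq, h5, det3_smul] at h4
      rw [← det3_map_linearEquiv g]
      simpa [hc, hd0] using h4
    have hcr : cross3 (cross3 (realize f u e.p) (realize f u e.q))
        (cross3 (realize f u e.r) (realize f u e.s)) ≠ 0 := by
      have h4 := cross3_realize_ne_zero hf h3
      rwa [← cross3_map f, ← cross3_map f] at h4
    obtain ⟨c, hc⟩ := exists_eq_smul_of_det3_eq_zero (hu0 e.point) hcr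
      ((det3_realize_eq_zero_iff hf).2 h1) ((det3_realize_eq_zero_iff hf).2 h2)
      (onLine hp hq h1) (onLine hr hs h2)
    have hc' : b e.point = c • g (realize f u e.point) := by
      rw [LinearEquiv.symm_apply_eq] at hc
      rw [hc, map_smul]
    refine ⟨c, ?_, hc'⟩
    rintro rfl
    exact hb0 e.point (by rw [hc', zero_smul])

/-- A family of directions whose points are all constructed from a projective frame is
projectively rigid. -/
theorem exists_forall_eq_smul_of_frame {f : R →+* ℝ} (hf : Function.Injective f)
    {u : Fin n → Fin 3 → R} {b : Fin n → Fin 3 → ℝ} (hb : SamePattern (realize f u) b)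
    (hb0 : ∀ i, b i ≠ 0) (hu0 : ∀ i, realize f u i ≠ 0) {p₀ p₁ p₂ p₃ : Fin n}
    (h : det3 (u p₀) (u p₁) (u p₂) ≠ 0) (h₀ : det3 (u p₃) (u p₁) (u p₂) ≠ 0)
    (h₁ : det3 (u p₀) (u p₃) (u p₂) ≠ 0) (h₂ : det3 (u p₀) (u p₁) (u p₃) ≠ 0)
    {S : List (Intersection n)} (hS : Constructs u [p₀, p₁, p₂, p₃] S) :
    ∃ g : (Fin 3 → ℝ) ≃ₗ[ℝ] (Fin 3 → ℝ), ∀ i, ∃ c : ℝ, c ≠ 0 ∧ b i = c • g (realize f u i) := by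
  have tr : ∀ {i j k}, det3 (u i) (u j) (u k) ≠ 0 →
      det3 (realize f u i) (realize f u j) (realize f u k) ≠ 0 :=
    fun h => (det3_realize_eq_zero_iff hf).not.2 h
  have tb : ∀ {i j k}, det3 (u i) (u j) (u k) ≠ 0 → det3 (b i) (b j) (b k) ≠ 0 :=
    fun h => (hb _ _ _).not.1 (tr h)
  obtain ⟨g, g0, g1, g2, g3⟩ := exists_linearEquiv_of_frame (tr h) (tr h₀) (tr h₁) (tr h₂)
    (tb h) (tb h₀) (tb h₁) (tb h₂)
  refine ⟨g, hS.forall_eq_smul hf hb hb0 hu0 g fun i hi => ?_⟩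
  simp only [List.mem_cons, List.not_mem_nil, or_false] at hi
  rcases hi with rfl | rfl | rfl | rfl <;> assumption

end Projective

/-! ### Verification of the `∨`-conditions along a list of lines -/

section Verification

variable {R : Type*} [CommRing R] {n : ℕ}

/-- The list `L` has no repetitions and consists of the labels in the plane spanned by its first two
members. -/
def IsFlatList (u : Fin n → Fin 3 → R) : List (Fin n) → Prop
  | i :: j :: L => (i :: j :: L).Nodup ∧ ∀ k, det3 (u i) (u j) (u k) = 0 ↔ k ∈ i :: j :: L
  | _ => False

instance IsFlatList.decidable [DecidableEq R] (u : Fin n → Fin 3 → R) :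
    ∀ L, Decidable (IsFlatList u L)
  | [] => inferInstanceAs (Decidable False)
  | [_] => inferInstanceAs (Decidable False)
  | i :: j :: L => inferInstanceAs (Decidable ((i :: j :: L).Nodup ∧
      ∀ k, det3 (u i) (u j) (u k) = 0 ↔ k ∈ i :: j :: L))

/-- `lines` is the list of all 2-flats of the pairwise non-proportional directions `u`, and every
label lies on two of them which have more than two elements. -/
def IsLineCover (u : Fin n → Fin 3 → R) (lines : List (List (Fin n))) : Prop :=
  (∀ i j, i < j → cross3 (u i) (u j) ≠ 0) ∧ (∀ L ∈ lines, IsFlatList u L) ∧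
    (∀ i j, i < j → ∃ L ∈ lines, i ∈ L ∧ j ∈ L) ∧
    ∀ i, ∃ L ∈ lines, (i ∈ L ∧ 2 < L.length) ∧
      ∃ M ∈ lines, (i ∈ M ∧ 2 < M.length) ∧ ∃ l ∈ M, l ∉ L

set_option synthInstance.maxSize 1000 in
instance IsLineCover.decidable [DecidableEq R] (u : Fin n → Fin 3 → R)
    (lines : List (List (Fin n))) :
    Decidable (IsLineCover u lines) := by
  unfold IsLineCover; infer_instance

/-- The bilinear form with matrix `B`, written out so that it can be evaluated in computable
rings. -/
def bil3 (B : Fin 3 → Fin 3 → R) (x y : Fin 3 → R) : R :=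
  x 0 * (B 0 0 * y 0 + B 0 1 * y 1 + B 0 2 * y 2) +
    x 1 * (B 1 0 * y 0 + B 1 1 * y 1 + B 1 2 * y 2) +
    x 2 * (B 2 0 * y 0 + B 2 1 * y 1 + B 2 2 * y 2)

variable {f : R →+* ℝ} {u : Fin n → Fin 3 → R} {lines : List (List (Fin n))}
  {s : Fin n → ℝ}

lemma IsLineCover.cross3_ne_zero (hl : IsLineCover u lines) (hf : Function.Injective f)
    (i j : Fin n) (hij : i ≠ j) : cross3 (realize f u i) (realize f u j) ≠ 0 := by
  rcases lt_or_gt_of_ne hij with h | h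
  · exact cross3_realize_ne_zero hf (hl.1 i j h)
  · rw [cross3_swap, neg_ne_zero]
    exact cross3_realize_ne_zero hf (hl.1 j i h)

lemma IsLineCover.lineThrough_eq (hl : IsLineCover u lines) (hf : Function.Injective f)
    {L : List (Fin n)} (hL : L ∈ lines) {i j : Fin n} (hij : i ≠ j) (hi : i ∈ L) (hj : j ∈ L) :
    L.Nodup ∧ lineThrough (realize f u) i j = L.toFinset := by
  have hF := hl.2.1 L hL
  match L, hF with
  | i₀ :: j₀ :: L, ⟨hnd, hF⟩ =>
    refine ⟨hnd, ?_⟩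
    have hij₀ : i₀ ≠ j₀ := by
      rintro rfl; simp at hnd
    have hc₀ := hl.cross3_ne_zero hf _ _ hij₀
    have hmem : ∀ k, k ∈ i₀ :: j₀ :: L ↔
        realize f u k ∈ Submodule.span ℝ {realize f u i₀, realize f u j₀} := fun k => by
      rw [mem_span_pair_iff_det3 hc₀, det3_realize_eq_zero_iff hf, hF]
    have hc := hl.cross3_ne_zero hf _ _ hij
    ext k
    rw [mem_lineThrough, ← mem_span_pair_iff_det3 hc, List.mem_toFinset, hmem,
      span_pair_eq_of_mem (finrank_span_pair hc₀) ((hmem i).1 hi) ((hmem j).1 hj) hc]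

lemma IsLineCover.exists_lineThrough_eq (hl : IsLineCover u lines) (hf : Function.Injective f)
    {i j : Fin n} (hij : i ≠ j) : ∃ L ∈ lines, i ∈ L ∧ j ∈ L ∧ L.Nodup ∧
      lineThrough (realize f u) i j = L.toFinset := by
  obtain ⟨L, hL, hi, hj⟩ : ∃ L ∈ lines, i ∈ L ∧ j ∈ L := by
    rcases lt_or_gt_of_ne hij with h | h
    · exact hl.2.2.1 i j h
    · obtain ⟨L, hL, hj, hi⟩ := hl.2.2.1 j i h
      exact ⟨L, hL, hi, hj⟩
  exact ⟨L, hL, hi, hj, hl.lineThrough_eq hf hL hij hi hj⟩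

lemma samePattern_smul (v : Fin n → Fin 3 → ℝ) (hs0 : ∀ i, s i ≠ 0) :
    SamePattern v (fun i => s i • v i) := fun i j k => by
  rw [det3_smul]; simp [hs0]

lemma IsLineCover.two_le_card_richLines (hl : IsLineCover u lines) (hf : Function.Injective f)
    (i : Fin n) : 2 ≤ (richLines (realize f u) i).card := by
  obtain ⟨L, hL, ⟨hiL, hcL⟩, M, hM, ⟨hiM, hcM⟩, l, hlM, hlL⟩ := hl.2.2.2 i
  have hrich : ∀ {L}, L ∈ lines → i ∈ L → 2 < L.length →
      L.toFinset ∈ richLines (realize f u) i := by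
    intro L hL hi hc
    have hnd : L.Nodup := by
      have := hl.2.1 L hL
      match L, this with
      | _ :: _ :: _, h => exact h.1
    have hcard : 2 < L.toFinset.card := by rwa [List.toFinset_card_of_nodup hnd]
    obtain ⟨j, hj, hji⟩ := Finset.exists_mem_ne (by omega : 1 < L.toFinset.card) i
    rw [List.mem_toFinset] at hj
    have hline := (hl.lineThrough_eq hf hL hji.symm hi hj).2
    rw [richLines, Finset.mem_filter]
    exact ⟨Finset.mem_image.2 ⟨j, by simp [hji], hline⟩, hcard⟩
  refine Finset.one_lt_card.2 ⟨_, hrich hL hiL hcL, _, hrich hM hiM hcM, fun heq => hlL ?_⟩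
  rw [← List.mem_toFinset, heq, List.mem_toFinset]
  exact hlM

/-- The `∨`-conditions may be checked on the listed 2-flats.  The squares of the scale factors `s`
are proportional to the weights `w`, and the form `B` is inverse to the weighted canonical form, up
to a factor. -/
theorem IsLineCover.exists_isVeeConfig (hl : IsLineCover u lines) (hf : Function.Injective f)
    (hs0 : ∀ i, s i ≠ 0) {w : Fin n → ℝ} {ρ c : ℝ} (hρ : ρ ≠ 0) (hc : c ≠ 0)
    (hs : ∀ i, s i ^ 2 = ρ * w i) {B : Fin 3 → Fin 3 → ℝ} (hB : ∀ k l, B k l = B l k)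
    (hdual : ∀ k l, ∑ i, w i * (B k 0 * realize f u i 0 + B k 1 * realize f u i 1 +
      B k 2 * realize f u i 2) * realize f u i l = if k = l then c else 0)
    (hvee : ∀ L ∈ lines, ∀ i ∈ L, cross3 (fun m => (L.map fun k =>
      w k * bil3 B (realize f u k) (realize f u i) * realize f u k m).sum) (realize f u i) = 0) :
    ∃ h, IsVeeConfig (fun i => s i • realize f u i) h ∧
      ∀ x y, h x y = (ρ * c)⁻¹ * bil3 B x y := by
  set v := realize f u with hv
  let h : LinearMap.BilinForm ℝ (Fin 3 → ℝ) :=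
    LinearMap.mk₂ ℝ (fun x y => (ρ * c)⁻¹ * bil3 B x y)
      (fun x y z => by simp [bil3]; ring) (fun r x y => by simp [bil3]; ring)
      (fun x y z => by simp [bil3]; ring) (fun r x y => by simp [bil3]; ring)
  have happ : ∀ x y, h x y = (ρ * c)⁻¹ * bil3 B x y := fun x y => rfl
  have hscale : ∀ k x, h (s k • v k) x • (s k • v k) =
      (c⁻¹ * (w k * bil3 B (v k) x)) • v k := by
    intro k x
    rw [map_smul, LinearMap.smul_apply, smul_eq_mul, smul_smul, happ]
    congr 1
    rw [mul_inv]
    have := hs k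
    field_simp
    linear_combination bil3 B (v k) x * this
  refine ⟨h, ⟨IsDualForm.of_symm (fun x y => ?_) fun x => ?_, fun i j hij => ?_,
    fun i j hij => ?_⟩, happ⟩
  · rw [happ, happ]
    congr 1
    simp only [bil3]
    rw [hB 1 0, hB 2 0, hB 2 1]
    ring
  · simp only [hscale]
    funext l
    rw [Finset.sum_apply]
    have key : ∀ k, ∑ i, w i * (B k 0 * v i 0 + B k 1 * v i 1 + B k 2 * v i 2) * v i l =
      if k = l then c else 0 := fun k => hdual k l
    have e : ∀ i, ((c⁻¹ * (w i * bil3 B (v i) x)) • v i) l =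
        c⁻¹ * (x 0 * (w i * (B 0 0 * v i 0 + B 0 1 * v i 1 + B 0 2 * v i 2) * v i l) +
          x 1 * (w i * (B 1 0 * v i 0 + B 1 1 * v i 1 + B 1 2 * v i 2) * v i l) +
          x 2 * (w i * (B 2 0 * v i 0 + B 2 1 * v i 1 + B 2 2 * v i 2) * v i l)) := by
      intro i
      rw [Pi.smul_apply, smul_eq_mul, bil3, hB 1 0, hB 2 0, hB 2 1]
      ring
    simp only [e]
    rw [← Finset.mul_sum, Finset.sum_add_distrib, Finset.sum_add_distrib, ← Finset.mul_sum,
      ← Finset.mul_sum, ← Finset.mul_sum, key, key, key]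
    fin_cases l <;> simp [hc, mul_comm]
  · rw [cross3_smul]
    exact smul_ne_zero (mul_ne_zero (hs0 i) (hs0 j)) (hl.cross3_ne_zero hf i j hij)
  · obtain ⟨L, hL, hi, hj, hnd, hline⟩ := hl.exists_lineThrough_eq hf hij
    rw [← (samePattern_smul v hs0).lineThrough_eq, hv, hline, ← hv]
    have hvi : v i ≠ 0 := by
      intro h0
      apply hl.cross3_ne_zero hf i j hij
      rw [← hv, h0]; funext m; fin_cases m <;> simp [cross3]
    have h1 := hvee L hL i hi
    rw [cross3_swap, neg_eq_zero] at h1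
    obtain ⟨μ, hμ⟩ := exists_eq_smul_of_cross3_eq_zero hvi h1
    refine ⟨c⁻¹ * μ, ?_⟩
    have h2 : ∑ k ∈ L.toFinset, h (s k • v k) (v i) • (s k • v k) = c⁻¹ • (μ • v i) := by
      rw [← hμ]
      simp only [hscale]
      rw [List.sum_toFinset _ hnd]
      funext m
      have e : ∀ L : List (Fin n), (L.map fun k => (c⁻¹ * (w k * bil3 B (v k) (v i))) • v k).sum m =
          c⁻¹ * (L.map fun k => w k * bil3 B (v k) (v i) * v k m).sum := by
        intro L
        induction L with
        | nil => simp
        | cons k L ih => simp only [List.map_cons, List.sum_cons, Pi.add_apply, ih]; simp; ring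
      rw [e]; rfl
    have h3 : ∀ k ∈ L.toFinset, h (s k • v k) (s i • v i) • s k • v k =
        s i • (h (s k • v k) (v i) • s k • v k) := fun k _ => by
      rw [map_smul (h (s k • v k)), smul_assoc]
    refine (Finset.sum_congr rfl h3).trans ?_
    rw [← Finset.smul_sum, h2, smul_smul c⁻¹, smul_comm]

end Verification

/-! ### The criterion for a family given by computable directions -/

section Data

variable {R : Type*} [CommRing R] {n : ℕ}

/-- The weighted directions satisfy the `∨`-conditions on the listed 2-flats, for the form `B`,
which is inverse to the weighted canonical form up to the factor `c`. -/
def IsWeightedVee (u : Fin n → Fin 3 → R) (lines : List (List (Fin n))) (w : Fin n → R)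
    (B : Fin 3 → Fin 3 → R) (c : R) : Prop :=
  (∀ k l, B k l = B l k) ∧
    (∀ k l, ∑ i, w i * (B k 0 * u i 0 + B k 1 * u i 1 + B k 2 * u i 2) * u i l =
      if k = l then c else 0) ∧
    ∀ L ∈ lines, ∀ i ∈ L,
      cross3 (fun m => (L.map fun k => w k * bil3 B (u k) (u i) * u k m).sum) (u i) = 0

instance IsWeightedVee.decidable [DecidableEq R] (u : Fin n → Fin 3 → R)
    (lines : List (List (Fin n))) (w : Fin n → R) (B : Fin 3 → Fin 3 → R) (c : R) :
    Decidable (IsWeightedVee u lines w B c) := by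
  unfold IsWeightedVee; infer_instance

lemma bil3_map (f : R →+* ℝ) (B : Fin 3 → Fin 3 → R) (x y : Fin 3 → R) :
    bil3 (fun k l => f (B k l)) (fun m => f (x m)) (fun m => f (y m)) = f (bil3 B x y) := by
  simp [bil3]

variable {f : R →+* ℝ} {u : Fin n → Fin 3 → R} {lines : List (List (Fin n))} {s : Fin n → ℝ}

lemma IsWeightedVee.exists_isVeeConfig {w : Fin n → R} {B : Fin 3 → Fin 3 → R} {c : R}
    (hv : IsWeightedVee u lines w B c) (hl : IsLineCover u lines) (hf : Function.Injective f)
    (hs0 : ∀ i, s i ≠ 0) {ρ : ℝ} (hρ : ρ ≠ 0) (hc : c ≠ 0) (hs : ∀ i, s i ^ 2 = ρ * f (w i)) :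
    ∃ h, IsVeeConfig (fun i => s i • realize f u i) h ∧
      ∀ x y, h x y = (ρ * f c)⁻¹ * bil3 (fun k l => f (B k l)) x y := by
  refine hl.exists_isVeeConfig hf hs0 hρ ((map_ne_zero_iff f hf).2 hc) hs
    (fun k l => by rw [hv.1]) (fun k l => ?_) fun L hL i hi => ?_
  · have := congrArg f (hv.2.1 k l)
    rw [map_sum, apply_ite f, map_zero] at this
    rw [← this]
    refine Finset.sum_congr rfl fun i _ => ?_
    simp [realize]
  · have h1 := hv.2.2 L hL i hi
    have h2 : (fun m => (L.map fun k => f (w k) * bil3 (fun k l => f (B k l)) (realize f u k)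
        (realize f u i) * realize f u k m).sum) =
        fun m => f ((L.map fun k => w k * bil3 B (u k) (u i) * u k m).sum) := by
      funext m
      rw [map_list_sum, List.map_map]
      congr 1
      refine List.map_congr_left fun k _ => ?_
      simp only [Function.comp_apply, map_mul, ← bil3_map]
      rfl
    rw [h2]
    exact (cross3_map f _ _).trans (by rw [h1]; funext m; simp)

/-- The labels of the plane spanned by `i` and `j` are only `i`, `j` and possibly `v`. -/
def IsShort (u : Fin n → Fin 3 → R) (i j v : Fin n) : Prop :=
  (∀ k, det3 (u i) (u j) (u k) = 0 ↔ k = i ∨ k = j) ∨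
    (i ≠ v ∧ j ≠ v ∧ ∀ k, det3 (u i) (u j) (u k) = 0 ↔ k = i ∨ k = j ∨ k = v)

/-- A list of pairs `(j, k)` describes a path from `i` to `l` with steps from a label to a label `j`
on a 2-flat with exactly three elements, of which `k` is the third one. -/
def IsTriplePath (u : Fin n → Fin 3 → R) : Fin n → List (Fin n × Fin n) → Fin n → Prop
  | i, [], l => i = l
  | i, (j, k) :: L, l => (i ≠ j ∧ i ≠ k ∧ j ≠ k ∧
      ∀ m, det3 (u i) (u j) (u m) = 0 ↔ m = i ∨ m = j ∨ m = k) ∧ IsTriplePath u j L l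

instance IsTriplePath.decidable [DecidableEq R] (u : Fin n → Fin 3 → R) :
    ∀ i L l, Decidable (IsTriplePath u i L l)
  | i, [], l => inferInstanceAs (Decidable (i = l))
  | i, (j, k) :: L, l =>
    haveI := IsTriplePath.decidable u j L l
    inferInstanceAs (Decidable ((i ≠ j ∧ i ≠ k ∧ j ≠ k ∧
      ∀ m, det3 (u i) (u j) (u m) = 0 ↔ m = i ∨ m = j ∨ m = k) ∧ IsTriplePath u j L l))

/-- A basis of labels `p`, `q`, `r` which are linked by 2-flats with three elements and pairwise
span 2-flats with at most three elements; `thirds` are the third elements on the latter, if there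
are any. -/
structure Core (n : ℕ) where
  (p q r : Fin n)
  thirds : Fin 3 → Fin n
  (pathQ pathR : List (Fin n × Fin n))

/-- The core has the properties required with respect to the directions `u`. -/
def Core.IsValid (C : Core n) (u : Fin n → Fin 3 → R) : Prop :=
  det3 (u C.p) (u C.q) (u C.r) ≠ 0 ∧
    (IsShort u C.p C.q (C.thirds 0) ∧ IsShort u C.q C.r (C.thirds 1) ∧
      IsShort u C.p C.r (C.thirds 2)) ∧
    IsTriplePath u C.p C.pathQ C.q ∧ IsTriplePath u C.p C.pathR C.r

instance Core.IsValid.decidable [DecidableEq R] (C : Core n) (u : Fin n → Fin 3 → R) :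
    Decidable (C.IsValid u) := by
  unfold Core.IsValid IsShort; infer_instance

/-- Everything that is asserted about a system of the catalogue. -/
def IsRigidVeeSystem (a : Fin n → Fin 3 → ℝ) : Prop :=
  (IsVeeSystem a ∧ IsIrreducibleSystem a ∧ ∃ ν : Set (Fin n) → ℝ, IsNuFunction a ν) ∧
    IsUniquelyDetermined a ∧ IsLocallyUniquelyDetermined a

/-- Realisations of the matroid are rescalings of the given directions, up to linear maps and
norm-preserving permutations of the labels; the remaining scale factors are then determined by the
norms along a core. -/
theorem isRigidVeeSystem_of_projective (hf : Function.Injective f) (hs0 : ∀ i, s i ≠ 0)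
    (hl : IsLineCover u lines) {C : Core n} (hcore : C.IsValid u)
    {h : LinearMap.BilinForm ℝ (Fin 3 → ℝ)}
    (ha : IsVeeConfig (fun i => s i • realize f u i) h)
    (hproj : ∀ b : Fin n → Fin 3 → ℝ, SamePattern (realize f u) b → (∀ i, b i ≠ 0) →
      ∃ (σ : Equiv.Perm (Fin n)) (g : (Fin 3 → ℝ) ≃ₗ[ℝ] (Fin 3 → ℝ)),
        (∀ i, ∃ c : ℝ, c ≠ 0 ∧ b (σ i) = c • g (realize f u i)) ∧
        ∀ i, h (s (σ i) • realize f u (σ i)) (s (σ i) • realize f u (σ i)) =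
          h (s i • realize f u i) (s i • realize f u i)) :
    IsRigidVeeSystem fun i => s i • realize f u i := by
  have hpat : SamePattern (realize f u) (fun i => s i • realize f u i) := samePattern_smul _ hs0
  have hrich : ∀ i, 2 ≤ (richLines (fun i => s i • realize f u i) i).card := by
    intro i
    have hr : richLines (fun i => s i • realize f u i) i = richLines (realize f u) i := by
      simp only [richLines]
      congr 2
      funext j
      exact (hpat.lineThrough_eq i j).symm
    rw [hr]
    exact hl.two_le_card_richLines hf i
  have hline : ∀ {i j : Fin n} {F : Finset (Fin n)},
      (∀ k, det3 (u i) (u j) (u k) = 0 ↔ k ∈ F) →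
      lineThrough (fun i => s i • realize f u i) i j = F := by
    intro i j F hF
    rw [← hpat.lineThrough_eq]
    ext k
    rw [mem_lineThrough, det3_realize_eq_zero_iff hf, hF]
  have huniq : IsUniquelyDetermined fun i => s i • realize f u i := by
    refine isUniquelyDetermined_of_projective ha hrich ?_ fun b hb hb0 => ?_
    · obtain ⟨hd, ⟨h1, h2, h3⟩, h4, h5⟩ := hcore
      have short : ∀ {i j v}, IsShort u i j v →
          OnShortLine (fun i => s i • realize f u i) i j := by
        rintro i j v (h | ⟨h6, h7, h8⟩)
        · exact Or.inl (hline (by simpa using h))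
        · exact Or.inr ⟨v, h6, h7, hline (by simpa using h8)⟩
      have path : ∀ (L : List (Fin n × Fin n)) {i l}, IsTriplePath u i L l →
          Relation.ReflTransGen (OnTripleLine fun i => s i • realize f u i) i l := by
        intro L
        induction L with
        | nil => rintro i l rfl; exact Relation.ReflTransGen.refl
        | cons e L ih =>
          rintro i l ⟨⟨h6, h7, h8, h9⟩, hL⟩
          exact Relation.ReflTransGen.head ⟨e.2, h6, h7, h8, hline (by simpa using h9)⟩ (ih hL)
      exact ⟨C.p, C.q, C.r, (hpat _ _ _).not.1 ((det3_realize_eq_zero_iff hf).not.2 hd),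
        path _ h4, path _ h5, short h1, short h2, short h3⟩
    · obtain ⟨σ, g, hg, hσ⟩ := hproj b (fun i j k => (hpat i j k).trans (hb i j k)) hb0
      choose c hc0 hc using hg
      refine ⟨σ, g, fun i => c i * (s i)⁻¹, fun i => mul_ne_zero (hc0 i) (inv_ne_zero (hs0 i)),
        fun i => ?_, hσ⟩
      rw [hc, map_smul, smul_smul, mul_assoc, inv_mul_cancel₀ (hs0 i), mul_one]
  refine ⟨⟨ha.isVeeSystem, ha.isIrreducibleSystem fun i => ?_, ha.exists_isNuFunction⟩, huniq,
    huniq.isLocallyUniquelyDetermined ha.span_eq_top⟩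
  obtain ⟨F, hF⟩ := Finset.card_pos.1 (lt_of_lt_of_le two_pos (hrich i))
  obtain ⟨hF, hcard⟩ := Finset.mem_filter.1 hF
  obtain ⟨j, hj, rfl⟩ := Finset.mem_image.1 hF
  obtain ⟨k, hk, hkn⟩ := Finset.exists_mem_notMem_of_card_lt_card
    (lt_of_le_of_lt (Finset.card_le_two (a := i) (b := j)) hcard)
  simp only [Finset.mem_insert, Finset.mem_singleton, not_or] at hkn
  exact ⟨j, k, (Finset.ne_of_mem_erase hj).symm, Ne.symm hkn.1, Ne.symm hkn.2, by simpa using hk⟩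

/-- The matroid of a family of directions: the 2-flats, a core for the determination of the scale
factors, and a projective frame with a construction of points from it. -/
structure IncidenceData (n : ℕ) where
  lines : List (List (Fin n))
  core : Core n
  (f₀ f₁ f₂ f₃ : Fin n)
  steps : List (Intersection n)

/-- The incidence data describe the matroid of the directions `u`; the construction of points may
use the labels in `extra` besides the frame. -/
def IncidenceData.IsValid (D : IncidenceData n) (u : Fin n → Fin 3 → R) (extra : List (Fin n)) :
    Prop :=
  IsLineCover u D.lines ∧ D.core.IsValid u ∧
    (det3 (u D.f₀) (u D.f₁) (u D.f₂) ≠ 0 ∧ det3 (u D.f₃) (u D.f₁) (u D.f₂) ≠ 0 ∧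
      det3 (u D.f₀) (u D.f₃) (u D.f₂) ≠ 0 ∧ det3 (u D.f₀) (u D.f₁) (u D.f₃) ≠ 0) ∧
    Constructs u ([D.f₀, D.f₁, D.f₂, D.f₃] ++ extra) D.steps

instance IncidenceData.IsValid.decidable [DecidableEq R] (D : IncidenceData n)
    (u : Fin n → Fin 3 → R) (extra : List (Fin n)) : Decidable (D.IsValid u extra) := by
  unfold IncidenceData.IsValid; infer_instance

/-- A system whose directions are all constructed from a projective frame by intersecting lines is
determined, without any permutation of the labels. -/
theorem isRigidVeeSystem_of_frame {D : IncidenceData n} (hD : D.IsValid u [])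
    (hf : Function.Injective f) (hs0 : ∀ i, s i ≠ 0)
    (ha : ∃ h, IsVeeConfig (fun i => s i • realize f u i) h) :
    IsRigidVeeSystem fun i => s i • realize f u i := by
  obtain ⟨hl, hcore, ⟨h0, h1, h2, h3⟩, hS⟩ := hD
  obtain ⟨h, ha⟩ := ha
  refine isRigidVeeSystem_of_projective hf hs0 hl hcore ha fun b hb hb0 => ?_
  have hu0 : ∀ i, realize f u i ≠ 0 := fun i h0 => ha.ne_zero i (by simp [h0])
  obtain ⟨g, hg⟩ := exists_forall_eq_smul_of_frame hf hb hb0 hu0 h0 h1 h2 h3 hS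
  exact ⟨Equiv.refl _, g, hg, fun i => rfl⟩

end Data

/-! ### Matroids defined over the golden field -/

section Golden

/-- The nine-point configuration which forces the golden ratio: in the frame given by the coordinate
vectors and `(1, 1, 1)`, the point `x` on the first coordinate line is `(1, τ, 0)` with
`τ ^ 2 = τ + 1`. -/
lemma golden_of_incidence {x y₄ y₅ y₇ y₉ : Fin 3 → ℝ}
    (hx : det3 ![1, 0, 0] ![0, 1, 0] x = 0) (hx' : det3 x ![0, 1, 0] ![0, 0, 1] ≠ 0)
    (h₄ : y₄ ≠ 0) (h₅ : y₅ ≠ 0) (h₇ : y₇ ≠ 0) (h₉ : y₉ ≠ 0)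
    (h₄₁ : det3 y₄ ![1, 0, 0] ![0, 1, 0] = 0) (h₄₂ : det3 y₄ ![0, 0, 1] ![1, 1, 1] = 0)
    (h₅₁ : det3 y₅ ![1, 0, 0] ![1, 1, 1] = 0) (h₅₂ : det3 y₅ ![0, 1, 0] ![0, 0, 1] = 0)
    (h₇₁ : det3 y₇ ![0, 0, 1] x = 0) (h₇₂ : det3 y₇ y₄ y₅ = 0)
    (h₉₁ : det3 y₉ ![0, 1, 0] ![1, 1, 1] = 0) (h₉₂ : det3 y₉ ![1, 0, 0] y₇ = 0)
    (h₉₃ : det3 y₉ y₅ x = 0) :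
    ∃ α τ : ℝ, α ≠ 0 ∧ τ ^ 2 = τ + 1 ∧ x = α • ![1, τ, 0] := by
  simp [det3] at hx hx' h₄₁ h₄₂ h₅₁ h₅₂ h₇₁ h₉₁ h₉₂
  have e4 : y₄ 1 = y₄ 0 := by linarith
  have e5 : y₅ 2 = y₅ 1 := by linarith
  have e9 : y₉ 2 = y₉ 0 := by linarith
  have n4 : y₄ 0 ≠ 0 := by
    intro h0; apply h₄; funext m; fin_cases m
    · exact h0
    · exact e4.trans h0
    · exact h₄₁
  have n5 : y₅ 1 ≠ 0 := by
    intro h0; apply h₅; funext m; fin_cases m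
    · exact h₅₂
    · exact h0
    · exact e5.trans h0
  simp only [det3, e4, e5, h₄₁, h₅₂] at h₇₂
  have e7 : y₇ 1 = y₇ 0 + y₇ 2 := by
    apply mul_left_cancel₀ (mul_ne_zero n4 n5)
    linarith
  have n7 : y₇ 0 ≠ 0 := by
    intro h0
    have h1 : y₇ 1 = 0 := by
      apply mul_left_cancel₀ hx'
      rw [h0] at h₇₁
      linarith
    apply h₇; funext m; fin_cases m
    · exact h0
    · exact h1
    · change y₇ 2 = 0
      linarith
  have e9' : y₉ 1 * x 0 = y₉ 0 * (x 0 + x 1) := by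
    simp only [det3, e5, e9, h₅₂, hx] at h₉₃
    apply mul_left_cancel₀ n5
    linarith
  have n9 : y₉ 0 ≠ 0 := by
    intro h0
    have h1 : y₉ 1 = 0 := by
      apply mul_right_cancel₀ hx'
      rw [e9', h0]; ring
    apply h₉; funext m; fin_cases m
    · exact h0
    · exact h1
    · exact e9.trans h0
  have key : x 1 ^ 2 = x 0 * x 1 + x 0 ^ 2 := by
    have k1 : y₉ 1 * y₇ 2 = y₉ 0 * y₇ 1 := by rw [← e9]; linarith
    have k2 : y₇ 1 * x 0 = y₇ 0 * x 1 := by linarith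
    have k3 : (x 0 + x 1) * y₇ 2 = x 0 * y₇ 1 := by
      apply mul_left_cancel₀ n9
      linear_combination x 0 * k1 - y₇ 2 * e9'
    apply mul_left_cancel₀ n7
    linear_combination (-x 1) * k2 + x 0 * k3 + (x 0 * (x 0 + x 1)) * e7
  refine ⟨x 0, x 1 / x 0, hx', ?_, ?_⟩
  · field_simp
    linarith
  · funext m; fin_cases m
    · simp
    · simp [mul_div_cancel₀ _ hx']
    · simpa using hx

/-- The action of a matrix on a vector, written out so that it can be evaluated in computable
rings. -/
def apply3 {R : Type*} [CommRing R] (M : Fin 3 → Fin 3 → R) (x : Fin 3 → R) : Fin 3 → R :=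
  fun k => M k 0 * x 0 + M k 1 * x 1 + M k 2 * x 2

lemma exists_linearEquiv_apply3 {M : Fin 3 → Fin 3 → ℝ} (hM : det3 (M 0) (M 1) (M 2) ≠ 0) :
    ∃ g : (Fin 3 → ℝ) ≃ₗ[ℝ] (Fin 3 → ℝ), ∀ x, g x = apply3 M x := by
  have hdet : IsUnit (Matrix.of M).det := by
    have : (Matrix.of M).det = det3 (M 0) (M 1) (M 2) := by
      rw [det3_eq_det]; congr 1; ext i j; fin_cases i <;> rfl
    rw [this]; exact hM.isUnit
  refine ⟨Matrix.toLinearEquiv' (Matrix.of M) (Matrix.invertibleOfIsUnitDet _ hdet), fun x => ?_⟩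
  change (Matrix.of M) *ᵥ x = _
  funext k
  simp [Matrix.mulVec, dotProduct, Fin.sum_univ_three, apply3]

lemma apply3_map {R : Type*} [CommRing R] (f : R →+* ℝ) (M : Fin 3 → Fin 3 → R) (x : Fin 3 → R) :
    apply3 (fun k l => f (M k l)) (fun m => f (x m)) = fun m => f (apply3 M x m) := by
  funext k; simp [apply3]

/-- The embedding `√5 ↦ √5` of `ℤ[√5]`. -/
noncomputable def embPos : ℤ√5 →+* ℝ := Zsqrtd.lift ⟨√5, by norm_num⟩

/-- The embedding `√5 ↦ -√5` of `ℤ[√5]`. -/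
noncomputable def embNeg : ℤ√5 →+* ℝ := Zsqrtd.lift ⟨-√5, by norm_num⟩

lemma embPos_apply (x : ℤ√5) : embPos x = x.re + x.im * √5 := rfl

lemma embNeg_apply (x : ℤ√5) : embNeg x = x.re + x.im * -√5 := rfl

lemma embNeg_eq_embPos_star (x : ℤ√5) : embNeg x = embPos (star x) := by
  simp [embPos_apply, embNeg_apply]

lemma five_ne_mul_self (n : ℤ) : (5 : ℤ) ≠ n * n := by
  intro h
  have h1 : n < 3 := by nlinarith
  have h2 : -3 < n := by nlinarith
  interval_cases n <;> omega

lemma embPos_injective : Function.Injective embPos := Zsqrtd.lift_injective _ five_ne_mul_self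

lemma embNeg_injective : Function.Injective embNeg := Zsqrtd.lift_injective _ five_ne_mul_self

variable {n : ℕ}

/-- Additional incidence data over `ℤ[√5]`: labels of a nine-point configuration forcing the golden
ratio, a matrix `M` bringing its frame to standard position, and a permutation of the labels which,
up to the matrix `N`, is induced by Galois conjugation. -/
structure GoldenData (n : ℕ) where
  (x y₄ y₅ y₇ y₉ : Fin n)
  (M N : Fin 3 → Fin 3 → ℤ√5)
  perm : Fin n → Fin n

/-- The golden data fit to the directions `u`, for the frame of the incidence data `D`. -/
def GoldenData.IsValid (G : GoldenData n) (D : IncidenceData n) (u : Fin n → Fin 3 → ℤ√5) : Prop :=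
  ((det3 (u D.f₀) (u D.f₁) (u G.x) = 0 ∧ det3 (u G.x) (u D.f₁) (u D.f₂) ≠ 0) ∧
    (det3 (u G.y₄) (u D.f₀) (u D.f₁) = 0 ∧ det3 (u G.y₄) (u D.f₂) (u D.f₃) = 0) ∧
    (det3 (u G.y₅) (u D.f₀) (u D.f₃) = 0 ∧ det3 (u G.y₅) (u D.f₁) (u D.f₂) = 0) ∧
    (det3 (u G.y₇) (u D.f₂) (u G.x) = 0 ∧ det3 (u G.y₇) (u G.y₄) (u G.y₅) = 0) ∧
    (det3 (u G.y₉) (u D.f₁) (u D.f₃) = 0 ∧ det3 (u G.y₉) (u D.f₀) (u G.y₇) = 0) ∧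
    det3 (u G.y₉) (u G.y₅) (u G.x) = 0) ∧
  (det3 (G.M 0) (G.M 1) (G.M 2) ≠ 0 ∧
    cross3 (apply3 G.M (u D.f₀)) ![1, 0, 0] = 0 ∧ cross3 (apply3 G.M (u D.f₁)) ![0, 1, 0] = 0 ∧
    cross3 (apply3 G.M (u D.f₂)) ![0, 0, 1] = 0 ∧ cross3 (apply3 G.M (u D.f₃)) ![1, 1, 1] = 0 ∧
    cross3 (apply3 G.M (u G.x)) ![2, ⟨1, -1⟩, 0] = 0) ∧
  (det3 (G.N 0) (G.N 1) (G.N 2) ≠ 0 ∧ Function.Injective G.perm ∧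
    ∀ i, cross3 (apply3 G.N fun m => star (u i m)) (u (G.perm i)) = 0)

instance GoldenData.IsValid.decidable (G : GoldenData n) (D : IncidenceData n)
    (u : Fin n → Fin 3 → ℤ√5) : Decidable (G.IsValid D u) := by
  unfold GoldenData.IsValid; infer_instance

lemma exists_smul_of_cross3_apply3 {f : ℤ√5 →+* ℝ} {M : Fin 3 → Fin 3 → ℤ√5}
    {g : (Fin 3 → ℝ) ≃ₗ[ℝ] (Fin 3 → ℝ)} (hg : ∀ x, g x = apply3 (fun k l => f (M k l)) x)
    {x : Fin 3 → ℤ√5} (hx : (fun m => f (x m)) ≠ 0) {e : Fin 3 → ℤ√5}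
    (he : (fun m => f (e m)) ≠ 0) (h : cross3 (apply3 M x) e = 0) :
    ∃ c : ℝ, c ≠ 0 ∧ (fun m => f (e m)) = c • g fun m => f (x m) := by
  have h1 : cross3 (g fun m => f (x m)) (fun m => f (e m)) = 0 := by
    rw [hg, apply3_map, cross3_map, h]; funext m; simp
  obtain ⟨c, hc⟩ := exists_eq_smul_of_cross3_eq_zero (by simpa using hx) h1
  refine ⟨c, ?_, hc⟩
  rintro rfl
  exact he (by rw [hc, zero_smul])

/-- Given the frame and the golden point, all points are constructed. -/
lemma GoldenData.IsValid.exists_forall_eq_smul {G : GoldenData n} {D : IncidenceData n}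
    {u : Fin n → Fin 3 → ℤ√5} (hG : G.IsValid D u) (hS : Constructs u
      [D.f₀, D.f₁, D.f₂, D.f₃, G.x] D.steps) {f : ℤ√5 →+* ℝ} (hf : Function.Injective f)
    {b : Fin n → Fin 3 → ℝ} (hb : SamePattern (realize f u) b) (hb0 : ∀ i, b i ≠ 0)
    (hu0 : ∀ i, realize f u i ≠ 0) {g₀ : (Fin 3 → ℝ) ≃ₗ[ℝ] (Fin 3 → ℝ)}
    (h0 : ∃ c : ℝ, c ≠ 0 ∧ b D.f₀ = c • g₀ ![1, 0, 0])
    (h1 : ∃ c : ℝ, c ≠ 0 ∧ b D.f₁ = c • g₀ ![0, 1, 0])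
    (h2 : ∃ c : ℝ, c ≠ 0 ∧ b D.f₂ = c • g₀ ![0, 0, 1])
    (h3 : ∃ c : ℝ, c ≠ 0 ∧ b D.f₃ = c • g₀ ![1, 1, 1])
    (hx : ∃ c : ℝ, c ≠ 0 ∧ b G.x = c • g₀ ![1, f ⟨1, -1⟩ / 2, 0]) :
    ∃ g : (Fin 3 → ℝ) ≃ₗ[ℝ] (Fin 3 → ℝ), ∀ i, ∃ c : ℝ, c ≠ 0 ∧ b i = c • g (realize f u i) := by
  obtain ⟨-, ⟨hM, m0, m1, m2, m3, mx⟩, -⟩ := hG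
  have hMr : det3 (fun l => f (G.M 0 l)) (fun l => f (G.M 1 l)) (fun l => f (G.M 2 l)) ≠ 0 := by
    rw [det3_map]; exact (map_ne_zero_iff f hf).2 hM
  obtain ⟨g, hg⟩ := exists_linearEquiv_apply3 (M := fun k l => f (G.M k l)) hMr
  have step : ∀ {i : Fin n} {e : Fin 3 → ℤ√5} {e' : Fin 3 → ℝ} {r : ℝ}, r ≠ 0 →
      (fun m => f (e m)) = r • e' → e' ≠ 0 → cross3 (apply3 G.M (u i)) e = 0 →
      (∃ c : ℝ, c ≠ 0 ∧ b i = c • g₀ e') →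
      ∃ c : ℝ, c ≠ 0 ∧ b i = c • (g.trans g₀) (realize f u i) := by
    rintro i e e' r hr he he' hc ⟨c, hc0, hbc⟩
    obtain ⟨d, hd0, hd⟩ := exists_smul_of_cross3_apply3 hg (hu0 i)
      (by rw [he]; exact smul_ne_zero hr he') hc
    refine ⟨c * (r⁻¹ * d), mul_ne_zero hc0 (mul_ne_zero (inv_ne_zero hr) hd0), ?_⟩
    have h1 : e' = (r⁻¹ * d) • g (realize f u i) := by
      rw [mul_smul]
      change _ = r⁻¹ • (d • g fun m => f (u i m))
      rw [← hd, he, smul_smul, inv_mul_cancel₀ hr, one_smul]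
    rw [hbc, h1, map_smul, smul_smul, LinearEquiv.trans_apply]
  refine ⟨g.trans g₀, hS.forall_eq_smul hf hb hb0 hu0 _ fun i hi => ?_⟩
  have ne : ∀ {e : Fin 3 → ℝ} (m : Fin 3), e m ≠ 0 → e ≠ 0 := fun m h h0 => h (by rw [h0]; rfl)
  simp only [List.mem_cons, List.not_mem_nil, or_false] at hi
  rcases hi with rfl | rfl | rfl | rfl | rfl
  · exact step one_ne_zero (by funext m; fin_cases m <;> simp) (ne 0 (by simp)) m0 h0
  · exact step one_ne_zero (by funext m; fin_cases m <;> simp) (ne 1 (by simp)) m1 h1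
  · exact step one_ne_zero (by funext m; fin_cases m <;> simp) (ne 2 (by simp)) m2 h2
  · exact step one_ne_zero (by funext m; fin_cases m <;> simp) (ne 0 (by simp)) m3 h3
  · exact step two_ne_zero
      (by funext m; fin_cases m <;> simp [mul_div_cancel₀, map_ofNat f 2]) (ne 0 (by simp))
      mx hx

/-- A realisation of the matroid is projectively equivalent to the directions or to their Galois
conjugates, depending on the root of `τ ^ 2 = τ + 1` which occurs. -/
lemma GoldenData.IsValid.dichotomy {G : GoldenData n} {D : IncidenceData n}
    {u : Fin n → Fin 3 → ℤ√5} (hG : G.IsValid D u) (hD : D.IsValid u [G.x])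
    {b : Fin n → Fin 3 → ℝ} (hb : SamePattern (realize embPos u) b) (hb0 : ∀ i, b i ≠ 0)
    (hu0 : ∀ i, u i ≠ 0) :
    (∃ g : (Fin 3 → ℝ) ≃ₗ[ℝ] (Fin 3 → ℝ), ∀ i, ∃ c : ℝ, c ≠ 0 ∧
        b i = c • g (realize embPos u i)) ∨
      ∃ g : (Fin 3 → ℝ) ≃ₗ[ℝ] (Fin 3 → ℝ), ∀ i, ∃ c : ℝ, c ≠ 0 ∧
        b i = c • g (realize embNeg u i) := by
  have hG' := hG
  obtain ⟨⟨⟨a1, a2⟩, ⟨a3, a4⟩, ⟨a5, a6⟩, ⟨a7, a8⟩, ⟨a9, a10⟩, a11⟩, -, -⟩ := hG'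
  obtain ⟨-, -, ⟨d0, d1, d2, d3⟩, hS⟩ := hD
  have iff : ∀ i j k, det3 (u i) (u j) (u k) = 0 ↔ det3 (b i) (b j) (b k) = 0 := fun i j k =>
    (det3_realize_eq_zero_iff embPos_injective).symm.trans (hb i j k)
  have hbneg : SamePattern (realize embNeg u) b := fun i j k =>
    (det3_realize_eq_zero_iff embNeg_injective).trans (iff i j k)
  have hr0 : ∀ {f : ℤ√5 →+* ℝ}, Function.Injective f → ∀ i, realize f u i ≠ 0 := by
    intro f hf i h0
    apply hu0 i
    funext m
    exact (map_eq_zero_iff f hf).1 (congrFun h0 m)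
  obtain ⟨g₀, h0, h1, h2, h3⟩ := exists_linearEquiv_of_frame
    (x₀ := ![1, 0, 0]) (x₁ := ![0, 1, 0]) (x₂ := ![0, 0, 1]) (x₃ := ![1, 1, 1])
    (by simp [det3]) (by simp [det3]) (by simp [det3]) (by simp [det3])
    ((iff _ _ _).not.1 d0) ((iff _ _ _).not.1 d1) ((iff _ _ _).not.1 d2) ((iff _ _ _).not.1 d3)
  have pull : ∀ {i j k : Fin n} {x y z : Fin 3 → ℝ},
      (∃ c : ℝ, c ≠ 0 ∧ b i = c • g₀ x) → (∃ c : ℝ, c ≠ 0 ∧ b j = c • g₀ y) →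
      (∃ c : ℝ, c ≠ 0 ∧ b k = c • g₀ z) →
      (det3 (u i) (u j) (u k) = 0 ↔ det3 x y z = 0) := by
    rintro i j k x y z ⟨c, hc, hi⟩ ⟨d, hd, hj⟩ ⟨e, he, hk⟩
    rw [iff, hi, hj, hk, det3_smul, ← det3_map_linearEquiv g₀]
    simp [hc, hd, he]
  have self : ∀ i, ∃ c : ℝ, c ≠ 0 ∧ b i = c • g₀ (g₀.symm (b i)) := fun i =>
    ⟨1, one_ne_zero, by simp⟩
  have nz : ∀ i, g₀.symm (b i) ≠ 0 := fun i => by simpa using hb0 i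
  obtain ⟨α, τ, hα, hτ, hx⟩ := golden_of_incidence
    ((pull h0 h1 (self G.x)).1 a1) ((pull (self G.x) h1 h2).not.1 a2) (nz G.y₄) (nz G.y₅)
    (nz G.y₇) (nz G.y₉) ((pull (self _) h0 h1).1 a3) ((pull (self _) h2 h3).1 a4)
    ((pull (self _) h0 h3).1 a5) ((pull (self _) h1 h2).1 a6)
    ((pull (self _) h2 (self _)).1 a7) ((pull (self _) (self _) (self _)).1 a8)
    ((pull (self _) h1 h3).1 a9) ((pull (self _) h0 (self _)).1 a10)
    ((pull (self _) (self _) (self _)).1 a11)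
  rw [LinearEquiv.symm_apply_eq, map_smul] at hx
  have h5 : √(5 : ℝ) ^ 2 = 5 := Real.sq_sqrt (by norm_num)
  have hroots : (τ - (1 - √5) / 2) * (τ - (1 + √5) / 2) = 0 := by nlinarith
  rcases mul_eq_zero.1 hroots with h | h
  · left
    refine hG.exists_forall_eq_smul hS embPos_injective hb hb0 (hr0 embPos_injective) h0 h1 h2 h3
      ⟨α, hα, ?_⟩
    rw [hx, sub_eq_zero.1 h, embPos_apply]
    norm_num [sub_eq_add_neg]
  · right
    refine hG.exists_forall_eq_smul hS embNeg_injective hbneg hb0 (hr0 embNeg_injective)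
      h0 h1 h2 h3 ⟨α, hα, ?_⟩
    rw [hx, sub_eq_zero.1 h, embNeg_apply]
    norm_num

/-- Systems over the golden field are determined up to the permutation of the labels given by Galois
conjugation. -/
theorem isRigidVeeSystem_of_golden {G : GoldenData n} {D : IncidenceData n}
    {u : Fin n → Fin 3 → ℤ√5} (hG : G.IsValid D u) (hD : D.IsValid u [G.x])
    {s : Fin n → ℝ} (hs0 : ∀ i, s i ≠ 0) {w : Fin n → ℤ√5} {B : Fin 3 → Fin 3 → ℤ√5} {c : ℤ√5}
    (hv : IsWeightedVee u D.lines w B c) {ρ : ℝ} (hρ : ρ ≠ 0) (hc : c ≠ 0)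
    (hs : ∀ i, s i ^ 2 = ρ * embPos (w i))
    (hperm : ∀ i, w (G.perm i) * bil3 B (u (G.perm i)) (u (G.perm i)) =
      w i * bil3 B (u i) (u i)) :
    IsRigidVeeSystem fun i => s i • realize embPos u i := by
  obtain ⟨h, ha, happ⟩ := hv.exists_isVeeConfig hD.1 embPos_injective hs0 hρ hc hs
  have hr0 : ∀ i, realize embPos u i ≠ 0 := fun i h0 => ha.ne_zero i (by simp [h0])
  have hu0 : ∀ i, u i ≠ 0 := fun i h0 => hr0 i (by funext m; simp [realize, h0])
  have hnorm : ∀ i, h (s (G.perm i) • realize embPos u (G.perm i))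
      (s (G.perm i) • realize embPos u (G.perm i)) =
        h (s i • realize embPos u i) (s i • realize embPos u i) := by
    have : ∀ i, h (s i • realize embPos u i) (s i • realize embPos u i) =
        ρ * (ρ * embPos c)⁻¹ * embPos (w i * bil3 B (u i) (u i)) := by
      intro i
      have hbil : bil3 (fun k l => embPos (B k l)) (realize embPos u i) (realize embPos u i) =
          embPos (bil3 B (u i) (u i)) := bil3_map _ _ _ _
      rw [map_smul, map_smul, LinearMap.smul_apply, happ, map_mul, hbil]
      simp only [smul_eq_mul]
      rw [show ∀ x y : ℝ, s i * (s i * (x * y)) = s i ^ 2 * x * y by intros; ring, hs]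
      ring
    intro i
    rw [this, this, hperm]
  refine isRigidVeeSystem_of_projective embPos_injective hs0 hD.1 hD.2.1 ha fun b hb hb0 => ?_
  rcases hG.dichotomy hD hb hb0 hu0 with ⟨g, hg⟩ | ⟨g, hg⟩
  · exact ⟨Equiv.refl _, g, hg, fun i => rfl⟩
  · obtain ⟨-, -, hN, hinj, hpar⟩ := hG
    let π : Equiv.Perm (Fin n) := Equiv.ofBijective G.perm
      ((Finite.injective_iff_bijective).1 hinj)
    have hNr : det3 (fun l => embPos (G.N 0 l)) (fun l => embPos (G.N 1 l))
        (fun l => embPos (G.N 2 l)) ≠ 0 := by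
      rw [det3_map]; exact (map_ne_zero_iff _ embPos_injective).2 hN
    obtain ⟨gN, hgN⟩ := exists_linearEquiv_apply3 (M := fun k l => embPos (G.N k l)) hNr
    refine ⟨π.symm, gN.symm.trans g, fun i => ?_, fun i => ?_⟩
    · obtain ⟨j, rfl⟩ := π.surjective i
      rw [Equiv.symm_apply_apply]
      obtain ⟨d, hd0, hd⟩ := hg j
      have hneg : realize embNeg u j = fun m => embPos (star (u j m)) := by
        funext m; exact embNeg_eq_embPos_star _
      have hne : (fun m => embPos (star (u j m))) ≠ 0 := by
        intro h0
        apply hb0 j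
        rw [hd, hneg, h0, map_zero, smul_zero]
      obtain ⟨e, he0, he⟩ := exists_smul_of_cross3_apply3 hgN hne (hr0 (G.perm j)) (hpar j)
      refine ⟨d * e⁻¹, mul_ne_zero hd0 (inv_ne_zero he0), ?_⟩
      have h1 : gN.symm (realize embPos u (π j)) = e • realize embNeg u j := by
        rw [LinearEquiv.symm_apply_eq, map_smul, hneg]
        exact he
      rw [LinearEquiv.trans_apply, h1, map_smul, smul_smul, mul_assoc, inv_mul_cancel₀ he0,
        mul_one, hd]
    · obtain ⟨j, rfl⟩ := π.surjective i
      rw [Equiv.symm_apply_apply]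
      exact (hnorm j).symm

end Golden

/-! ### The systems without parameters, over the rationals -/

section Catalogue

set_option maxRecDepth 100000

lemma scale_ne_zero {R : Type*} [CommRing R] {n : ℕ} {f : R →+* ℝ} (hf : Function.Injective f)
    {s : Fin n → ℝ} {w : Fin n → R} {ρ : ℝ} (hρ : ρ ≠ 0) (hs : ∀ i, s i ^ 2 = ρ * f (w i))
    (hw : ∀ i, w i ≠ 0) (i : Fin n) : s i ≠ 0 := by
  intro h0
  have h1 := hs i
  rw [h0, zero_pow two_ne_zero, zero_eq_mul, map_eq_zero_iff f hf] at h1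
  exact h1.elim hρ (hw i)

/-- The criterion for directions in `ℤ³` and scale factors whose squares are proportional to
integers. -/
theorem isRigidVeeSystem_of_weights {n : ℕ} {u : Fin n → Fin 3 → ℤ} {D : IncidenceData n}
    (hD : D.IsValid u []) {s : Fin n → ℝ} {w : Fin n → ℤ} {B : Fin 3 → Fin 3 → ℤ} {c : ℤ}
    (hv : IsWeightedVee u D.lines w B c) (hc : c ≠ 0) {ρ : ℝ} (hρ : ρ ≠ 0)
    (hs : ∀ i, s i ^ 2 = ρ * Int.castRingHom ℝ (w i)) (hw : ∀ i, w i ≠ 0 := by decide) :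
    IsRigidVeeSystem fun i => s i • realize (Int.castRingHom ℝ) u i := by
  have hf : Function.Injective (Int.castRingHom ℝ) := Int.cast_injective
  have hs0 := scale_ne_zero hf hρ hs hw
  obtain ⟨h, ha, -⟩ := hv.exists_isVeeConfig hD.1 hf hs0 hρ hc hs
  exact isRigidVeeSystem_of_frame hD hf hs0 ⟨h, ha⟩

/-- The directions of the covectors of `(E₆, A₃)`. -/
def e6a3Dir : Fin 8 → Fin 3 → ℤ :=
  ![![1, 1, 0], ![1, -1, 0], ![1, 0, 0], ![4, 1, 1], ![-4, 1, 1], ![2, -1, 1], ![-2, -1, 1],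
    ![0, 1, 1]]

/-- The matroid of `(E₆, A₃)`. -/
def e6a3Incidence : IncidenceData 8 where
  lines := [[0, 1, 2], [0, 3, 5], [0, 4], [0, 6, 7], [1, 3], [1, 4, 6], [1, 5, 7], [2, 3, 4, 7],
    [2, 5, 6], [3, 6], [4, 5]]
  core := ⟨0, 1, 3, ![2, 1, 5], [(1, 2)], [(3, 5)]⟩
  f₀ := 0
  f₁ := 1
  f₂ := 3
  f₃ := 7
  steps := [⟨2, 0, 1, 3, 7⟩, ⟨5, 0, 3, 1, 7⟩, ⟨6, 0, 7, 2, 5⟩, ⟨4, 1, 6, 2, 3⟩]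

/-- The factors by which the covectors of `(E₆, A₃)` differ from the directions. -/
noncomputable def e6a3Scale : Fin 8 → ℝ :=
  ![2, 2, 2 * √6, 1 / 2, 1 / 2, 1, 1, √6 / 2]

/-- The squares of the scale factors of `(E₆, A₃)`, up to a common factor. -/
def e6a3Weight : Fin 8 → ℤ :=
  ![16, 16, 96, 1, 1, 4, 4, 6]

lemma e6a3_isValid : e6a3Incidence.IsValid e6a3Dir [] := by decide +kernel

lemma e6a3_isWeightedVee : IsWeightedVee e6a3Dir e6a3Incidence.lines e6a3Weight
    ![![1, 0, 0], ![0, 4, 0], ![0, 0, 12]] 192 := by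
  decide +kernel

lemma e6a3Scale_sq (i : Fin 8) : e6a3Scale i ^ 2 = 1 / 4 * Int.castRingHom ℝ (e6a3Weight i) := by
  fin_cases i <;> norm_num [e6a3Scale, e6a3Weight, mul_pow, div_pow]

lemma sysE6A3_eq : sysE6A3 = fun i => e6a3Scale i • realize (Int.castRingHom ℝ) e6a3Dir i := by
  funext i m
  fin_cases m <;> fin_cases i <;>
    norm_num [sysE6A3, e6a3Scale, e6a3Dir, realize]

theorem isRigidVeeSystem_sysE6A3 : IsRigidVeeSystem sysE6A3 := by
  rw [sysE6A3_eq]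
  exact isRigidVeeSystem_of_weights e6a3_isValid e6a3_isWeightedVee
    (by norm_num) (by norm_num) e6a3Scale_sq

/-- The directions of the covectors of `(E₆, A₁³)`. -/
def e6a111Dir : Fin 10 → Fin 3 → ℤ :=
  ![![1, 1, 0], ![1, -1, 0], ![1, 0, 0], ![0, 1, 0], ![2, 1, 1], ![-2, -1, 1], ![-2, 1, 1],
    ![2, -1, 1], ![0, 1, 1], ![0, -1, 1]]

/-- The matroid of `(E₆, A₁³)`. -/
def e6a111Incidence : IncidenceData 10 where
  lines := [[0, 1, 2, 3], [0, 4, 9], [0, 5, 8], [0, 6], [0, 7], [1, 4], [1, 5], [1, 6, 9],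
    [1, 7, 8], [2, 4, 6, 8], [2, 5, 7, 9], [3, 4, 7], [3, 5, 6], [3, 8, 9], [4, 5], [6, 7]]
  core := ⟨0, 4, 5, ![9, 4, 8], [(4, 9)], [(5, 8)]⟩
  f₀ := 0
  f₁ := 2
  f₂ := 4
  f₃ := 5
  steps := [⟨8, 0, 5, 2, 4⟩, ⟨9, 0, 4, 2, 5⟩, ⟨3, 0, 2, 8, 9⟩, ⟨6, 2, 4, 3, 5⟩, ⟨7, 2, 5, 3, 4⟩,
    ⟨1, 0, 2, 6, 9⟩]

/-- The factors by which the covectors of `(E₆, A₁³)` differ from the directions. -/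
noncomputable def e6a111Scale : Fin 10 → ℝ :=
  ![√2, √2, 2 * √3, 2, √2 / 2, √2 / 2, √2 / 2, √2 / 2, 1, 1]

/-- The squares of the scale factors of `(E₆, A₁³)`, up to a common factor. -/
def e6a111Weight : Fin 10 → ℤ :=
  ![4, 4, 24, 8, 1, 1, 1, 1, 2, 2]

lemma e6a111_isValid : e6a111Incidence.IsValid e6a111Dir [] := by decide +kernel

lemma e6a111_isWeightedVee : IsWeightedVee e6a111Dir e6a111Incidence.lines e6a111Weight
    ![![1, 0, 0], ![0, 2, 0], ![0, 0, 6]] 48 := by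
  decide +kernel

lemma e6a111Scale_sq (i : Fin 10) :
    e6a111Scale i ^ 2 = 1 / 2 * Int.castRingHom ℝ (e6a111Weight i) := by
  fin_cases i <;> norm_num [e6a111Scale, e6a111Weight, mul_pow, div_pow]

lemma sysE6A1A1A1_eq :
    sysE6A1A1A1 = fun i => e6a111Scale i • realize (Int.castRingHom ℝ) e6a111Dir i := by
  funext i m
  fin_cases m <;> fin_cases i <;>
    norm_num [sysE6A1A1A1, e6a111Scale, e6a111Dir, realize] <;> ring

theorem isRigidVeeSystem_sysE6A1A1A1 : IsRigidVeeSystem sysE6A1A1A1 := by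
  rw [sysE6A1A1A1_eq]
  exact isRigidVeeSystem_of_weights e6a111_isValid e6a111_isWeightedVee
    (by norm_num) (by norm_num) e6a111Scale_sq

/-- The directions of the covectors of `(E₇, A₁² × A₂)`. -/
def e7Dir : Fin 13 → Fin 3 → ℤ :=
  ![![1, 1, 0], ![1, -1, 0], ![1, 0, 0], ![0, 1, 0], ![0, 0, 1], ![1, 3, 1], ![-1, -3, 1],
    ![-1, 3, 1], ![1, -3, 1], ![1, 1, 1], ![-1, -1, 1], ![-1, 1, 1], ![1, -1, 1]]

/-- The matroid of `(E₇, A₁² × A₂)`. -/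
def e7Incidence : IncidenceData 13 where
  lines := [[0, 1, 2, 3], [0, 4, 9, 10], [0, 5, 11], [0, 6, 12], [0, 7], [0, 8], [1, 4, 11, 12],
    [1, 5], [1, 6], [1, 7, 9], [1, 8, 10], [2, 4], [2, 5, 7], [2, 6, 8], [2, 9, 11], [2, 10, 12],
    [3, 4], [3, 5, 8, 9, 12], [3, 6, 7, 10, 11], [4, 5, 6], [4, 7, 8], [5, 10], [6, 9], [7, 12],
    [8, 11]]
  core := ⟨0, 5, 6, ![11, 4, 12], [(5, 11)], [(6, 12)]⟩
  f₀ := 0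
  f₁ := 1
  f₂ := 5
  f₃ := 12
  steps := [⟨3, 0, 1, 5, 12⟩, ⟨11, 0, 5, 1, 12⟩, ⟨6, 0, 12, 3, 11⟩, ⟨4, 1, 11, 5, 6⟩,
    ⟨9, 0, 4, 3, 5⟩, ⟨10, 0, 4, 3, 6⟩, ⟨2, 0, 1, 9, 11⟩, ⟨7, 1, 9, 2, 5⟩, ⟨8, 1, 10, 2, 6⟩]

/-- The factors by which the covectors of `(E₇, A₁² × A₂)` differ from the directions. -/
noncomputable def e7Scale : Fin 13 → ℝ :=
  ![√3, √3, 2, 2 * √6, 1, √(1 / 2), √(1 / 2), √(1 / 2), √(1 / 2), √(3 / 2), √(3 / 2), √(3 / 2),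
    √(3 / 2)]

/-- The squares of the scale factors of `(E₇, A₁² × A₂)`, up to a common factor. -/
def e7Weight : Fin 13 → ℤ :=
  ![6, 6, 8, 48, 2, 1, 1, 1, 1, 3, 3, 3, 3]

lemma e7_isValid : e7Incidence.IsValid e7Dir [] := by decide +kernel

lemma e7_isWeightedVee : IsWeightedVee e7Dir e7Incidence.lines e7Weight
    ![![3, 0, 0], ![0, 1, 0], ![0, 0, 6]] 108 := by
  decide +kernel

lemma e7Scale_sq (i : Fin 13) : e7Scale i ^ 2 = 1 / 2 * Int.castRingHom ℝ (e7Weight i) := by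
  fin_cases i <;> norm_num [e7Scale, e7Weight, mul_pow, div_pow]

lemma sysE7A1A1A2_eq : sysE7A1A1A2 = fun i => e7Scale i • realize (Int.castRingHom ℝ) e7Dir i := by
  funext i m
  fin_cases m <;> fin_cases i <;>
    norm_num [sysE7A1A1A2, e7Scale, e7Dir, realize] <;> ring

theorem isRigidVeeSystem_sysE7A1A1A2 : IsRigidVeeSystem sysE7A1A1A2 := by
  rw [sysE7A1A1A2_eq]
  exact isRigidVeeSystem_of_weights e7_isValid e7_isWeightedVee
    (by norm_num) (by norm_num) e7Scale_sq

/-- The directions of the covectors of `(E₈, A₁ × A₄)`. -/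
def e8a1a4Dir : Fin 16 → Fin 3 → ℤ :=
  ![![1, 1, 0], ![1, -1, 0], ![1, 0, 1], ![1, 0, -1], ![0, 1, 1], ![0, 1, -1], ![1, 0, 0],
    ![0, 1, 0], ![2, 5, 1], ![-2, 5, 1], ![2, -3, 1], ![-2, -3, 1], ![2, 1, 1], ![-2, 1, 1],
    ![0, -5, 1], ![0, 3, 1]]

/-- The matroid of `(E₈, A₁ × A₄)`. -/
def e8a1a4Incidence : IncidenceData 16 where
  lines := [[0, 1, 6, 7], [0, 2, 5, 11, 12], [0, 3, 4], [0, 8, 13, 15], [0, 9], [0, 10, 14],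
    [1, 2, 4], [1, 3, 5, 10, 13], [1, 8], [1, 9, 12, 15], [1, 11, 14], [2, 3, 6], [2, 7],
    [2, 8, 14], [2, 9], [2, 10, 15], [2, 13], [3, 7], [3, 8], [3, 9, 14], [3, 11, 15], [3, 12],
    [4, 5, 7, 14, 15], [4, 6, 12, 13], [4, 8, 11], [4, 9, 10], [5, 6], [5, 8], [5, 9], [6, 8, 9],
    [6, 10, 11], [6, 14], [6, 15], [7, 8, 10, 12], [7, 9, 11, 13], [12, 14], [13, 14]]
  core := ⟨0, 3, 14, ![4, 9, 10], [(3, 4)], [(14, 10)]⟩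
  f₀ := 0
  f₁ := 1
  f₂ := 2
  f₃ := 3
  steps := [⟨4, 0, 3, 1, 2⟩, ⟨5, 0, 2, 1, 3⟩, ⟨6, 0, 1, 2, 3⟩, ⟨7, 0, 1, 4, 5⟩, ⟨12, 0, 2, 4, 6⟩,
    ⟨13, 1, 3, 4, 6⟩, ⟨15, 0, 13, 1, 12⟩, ⟨8, 0, 13, 7, 12⟩, ⟨9, 1, 12, 6, 8⟩, ⟨10, 1, 3, 2, 15⟩,
    ⟨11, 0, 2, 3, 15⟩, ⟨14, 0, 10, 1, 11⟩]

/-- The factors by which the covectors of `(E₈, A₁ × A₄)` differ from the directions. -/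
noncomputable def e8a1a4Scale : Fin 16 → ℝ :=
  ![√10, √10, √2, √2, √5, √10, 2, 2 * √10, 1 / 2, 1 / 2, √5 / 2, √5 / 2, √10 / 2, √10 / 2,
    √(1 / 2), √10 / 2]

/-- The squares of the scale factors of `(E₈, A₁ × A₄)`, up to a common factor. -/
def e8a1a4Weight : Fin 16 → ℤ :=
  ![40, 40, 8, 8, 20, 40, 16, 160, 1, 1, 5, 5, 10, 10, 2, 10]

lemma e8a1a4_isValid : e8a1a4Incidence.IsValid e8a1a4Dir [] := by decide +kernel

lemma e8a1a4_isWeightedVee : IsWeightedVee e8a1a4Dir e8a1a4Incidence.lines e8a1a4Weight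
    ![![5, 0, 0], ![0, 2, 0], ![0, 0, 10]] 1200 := by
  decide +kernel

lemma e8a1a4Scale_sq (i : Fin 16) :
    e8a1a4Scale i ^ 2 = 1 / 4 * Int.castRingHom ℝ (e8a1a4Weight i) := by
  fin_cases i <;> norm_num [e8a1a4Scale, e8a1a4Weight, mul_pow, div_pow]

lemma sysE8A1A4_eq :
    sysE8A1A4 = fun i => e8a1a4Scale i • realize (Int.castRingHom ℝ) e8a1a4Dir i := by
  funext i m
  fin_cases m <;> fin_cases i <;>
    norm_num [sysE8A1A4, e8a1a4Scale, e8a1a4Dir, realize] <;> ring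

theorem isRigidVeeSystem_sysE8A1A4 : IsRigidVeeSystem sysE8A1A4 := by
  rw [sysE8A1A4_eq]
  exact isRigidVeeSystem_of_weights e8a1a4_isValid e8a1a4_isWeightedVee
    (by norm_num) (by norm_num) e8a1a4Scale_sq

/-- The directions of the covectors of `(E₈, A₂ × A₃)`. -/
def e8a2a3Dir : Fin 17 → Fin 3 → ℤ :=
  ![![1, 1, 0], ![1, -1, 0], ![0, 1, 1], ![0, 1, -1], ![1, 0, 1], ![1, 0, -1], ![1, 0, 0],
    ![0, 1, 0], ![3, 4, 1], ![3, -4, 1], ![-3, 2, 1], ![-3, -2, 1], ![3, 0, 1], ![-1, 4, 1],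
    ![-1, -4, 1], ![1, 2, 1], ![1, -2, 1]]

/-- The matroid of `(E₈, A₂ × A₃)`. -/
def e8a2a3Incidence : IncidenceData 17 where
  lines := [[0, 1, 6, 7], [0, 2, 5, 8, 11, 15], [0, 3, 4], [0, 9], [0, 10, 13], [0, 12, 14, 16],
    [1, 2, 4], [1, 3, 5, 9, 10, 16], [1, 8], [1, 11, 14], [1, 12, 13, 15], [2, 3, 7], [2, 6],
    [2, 9], [2, 10, 12], [2, 13, 16], [2, 14], [3, 6], [3, 8], [3, 11, 12], [3, 13], [3, 14, 15],
    [4, 5, 6, 12], [4, 7, 15, 16], [4, 8, 14], [4, 9, 13], [4, 10], [4, 11], [5, 7, 13, 14],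
    [6, 8, 13], [6, 9, 14], [6, 10, 15], [6, 11, 16], [7, 8, 9, 12], [7, 10, 11], [8, 10],
    [8, 16], [9, 11], [9, 15], [10, 14], [11, 13]]
  core := ⟨0, 3, 13, ![4, 3, 10], [(3, 4)], [(13, 10)]⟩
  f₀ := 0
  f₁ := 1
  f₂ := 2
  f₃ := 3
  steps := [⟨4, 0, 3, 1, 2⟩, ⟨5, 0, 2, 1, 3⟩, ⟨6, 0, 1, 4, 5⟩, ⟨7, 0, 1, 2, 3⟩, ⟨15, 0, 2, 4, 7⟩,
    ⟨16, 1, 3, 4, 7⟩, ⟨10, 1, 3, 6, 15⟩, ⟨11, 0, 2, 6, 16⟩, ⟨12, 0, 16, 1, 15⟩,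
    ⟨13, 0, 10, 1, 12⟩, ⟨14, 0, 12, 1, 11⟩, ⟨8, 0, 2, 4, 14⟩, ⟨9, 1, 3, 4, 13⟩]

/-- The factors by which the covectors of `(E₈, A₂ × A₃)` differ from the directions. -/
noncomputable def e8a2a3Scale : Fin 17 → ℝ :=
  ![2 * √3, 2 * √3, 2, 2, √3, √(15 / 2), 2 * √3, 2 * √6, 1 / 2, 1 / 2, 1, 1, √6 / 2, √3 / 2,
    √3 / 2, √3, √3]

/-- The squares of the scale factors of `(E₈, A₂ × A₃)`, up to a common factor. -/
def e8a2a3Weight : Fin 17 → ℤ :=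
  ![48, 48, 16, 16, 12, 30, 48, 96, 1, 1, 4, 4, 6, 3, 3, 12, 12]

lemma e8a2a3_isValid : e8a2a3Incidence.IsValid e8a2a3Dir [] := by decide +kernel

lemma e8a2a3_isWeightedVee : IsWeightedVee e8a2a3Dir e8a2a3Incidence.lines e8a2a3Weight
    ![![4, 0, 0], ![0, 3, 0], ![0, 0, 12]] 1440 := by
  decide +kernel

lemma e8a2a3Scale_sq (i : Fin 17) :
    e8a2a3Scale i ^ 2 = 1 / 4 * Int.castRingHom ℝ (e8a2a3Weight i) := by
  fin_cases i <;> norm_num [e8a2a3Scale, e8a2a3Weight, mul_pow, div_pow]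

lemma sysE8A2A3_eq :
    sysE8A2A3 = fun i => e8a2a3Scale i • realize (Int.castRingHom ℝ) e8a2a3Dir i := by
  funext i m
  fin_cases m <;> fin_cases i <;>
    norm_num [sysE8A2A3, e8a2a3Scale, e8a2a3Dir, realize] <;> ring

theorem isRigidVeeSystem_sysE8A2A3 : IsRigidVeeSystem sysE8A2A3 := by
  rw [sysE8A2A3_eq]
  exact isRigidVeeSystem_of_weights e8a2a3_isValid e8a2a3_isWeightedVee
    (by norm_num) (by norm_num) e8a2a3Scale_sq

/-- The directions of the covectors of `(E₈, A₁² × A₃)`. -/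
def e8a11a3Dir : Fin 17 → Fin 3 → ℤ :=
  ![![1, 1, 0], ![1, -1, 0], ![0, 1, 1], ![0, 1, -1], ![1, 0, 1], ![1, 0, -1], ![1, 0, 0],
    ![0, 1, 0], ![0, 0, 1], ![1, 4, 1], ![1, -4, -1], ![1, -4, 1], ![1, 4, -1], ![1, 2, 1],
    ![1, -2, -1], ![1, -2, 1], ![1, 2, -1]]

/-- The matroid of `(E₈, A₁² × A₃)`. -/
def e8a11a3Incidence : IncidenceData 17 where
  lines := [[0, 1, 6, 7], [0, 2, 5, 13], [0, 3, 4, 16], [0, 8], [0, 9, 14], [0, 10], [0, 11],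
    [0, 12, 15], [1, 2, 4, 14], [1, 3, 5, 15], [1, 8], [1, 9], [1, 10, 13], [1, 11, 16], [1, 12],
    [2, 3, 7, 8], [2, 6], [2, 9, 16], [2, 10, 15], [2, 11], [2, 12], [3, 6], [3, 9], [3, 10],
    [3, 11, 14], [3, 12, 13], [4, 5, 6, 8], [4, 7, 9, 11, 13, 15], [4, 10], [4, 12],
    [5, 7, 10, 12, 14, 16], [5, 9], [5, 11], [6, 9, 10], [6, 11, 12], [6, 13, 14], [6, 15, 16],
    [8, 9, 12], [8, 10, 11], [8, 13, 16], [8, 14, 15]]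
  core := ⟨0, 9, 12, ![14, 8, 15], [(9, 14)], [(12, 15)]⟩
  f₀ := 0
  f₁ := 1
  f₂ := 2
  f₃ := 3
  steps := [⟨4, 0, 3, 1, 2⟩, ⟨5, 0, 2, 1, 3⟩, ⟨6, 0, 1, 4, 5⟩, ⟨7, 0, 1, 2, 3⟩, ⟨8, 2, 3, 4, 5⟩,
    ⟨13, 0, 2, 4, 7⟩, ⟨14, 1, 2, 5, 7⟩, ⟨15, 1, 3, 4, 7⟩, ⟨16, 0, 3, 5, 7⟩, ⟨9, 0, 14, 2, 16⟩,
    ⟨10, 1, 13, 2, 15⟩, ⟨11, 1, 16, 3, 14⟩, ⟨12, 0, 15, 3, 13⟩]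

/-- The factors by which the covectors of `(E₈, A₁² × A₃)` differ from the directions. -/
noncomputable def e8a11a3Scale : Fin 17 → ℝ :=
  ![2, 2, 2, 2, 2, 2, 2, 2 * √10, 2, √2 / 2, √2 / 2, √2 / 2, √2 / 2, √2, √2, √2, √2]

/-- The squares of the scale factors of `(E₈, A₁² × A₃)`, up to a common factor. -/
def e8a11a3Weight : Fin 17 → ℤ :=
  ![8, 8, 8, 8, 8, 8, 8, 80, 8, 1, 1, 1, 1, 4, 4, 4, 4]

lemma e8a11a3_isValid : e8a11a3Incidence.IsValid e8a11a3Dir [] := by decide +kernel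

lemma e8a11a3_isWeightedVee : IsWeightedVee e8a11a3Dir e8a11a3Incidence.lines e8a11a3Weight
    ![![4, 0, 0], ![0, 1, 0], ![0, 0, 4]] 240 := by
  decide +kernel

lemma e8a11a3Scale_sq (i : Fin 17) :
    e8a11a3Scale i ^ 2 = 1 / 2 * Int.castRingHom ℝ (e8a11a3Weight i) := by
  fin_cases i <;> norm_num [e8a11a3Scale, e8a11a3Weight, mul_pow, div_pow]

lemma sysE8A1A1A3_eq :
    sysE8A1A1A3 = fun i => e8a11a3Scale i • realize (Int.castRingHom ℝ) e8a11a3Dir i := by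
  funext i m
  fin_cases m <;> fin_cases i <;>
    norm_num [sysE8A1A1A3, e8a11a3Scale, e8a11a3Dir, realize] <;> ring

theorem isRigidVeeSystem_sysE8A1A1A3 : IsRigidVeeSystem sysE8A1A1A3 := by
  rw [sysE8A1A1A3_eq]
  exact isRigidVeeSystem_of_weights e8a11a3_isValid e8a11a3_isWeightedVee
    (by norm_num) (by norm_num) e8a11a3Scale_sq

/-- The directions of the covectors of `(E₈, A₁³ × A₂)`. -/
def e8a111a2Dir : Fin 19 → Fin 3 → ℤ :=
  ![![1, 1, 0], ![1, -1, 0], ![0, 1, -1], ![0, 1, 1], ![1, 0, -1], ![1, 0, 1], ![1, 0, 0],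
    ![0, 1, 0], ![0, 0, 1], ![1, 2, -3], ![1, 2, 3], ![1, -2, 3], ![1, -2, -3], ![1, 2, -1],
    ![1, -2, -1], ![1, 2, 1], ![1, -2, 1], ![1, 0, -3], ![1, 0, 3]]

/-- The matroid of `(E₈, A₁³ × A₂)`. -/
def e8a111a2Incidence : IncidenceData 19 where
  lines := [[0, 1, 6, 7], [0, 2, 5, 11, 13], [0, 3, 4, 12, 15], [0, 8], [0, 9, 18], [0, 10, 17],
    [0, 14], [0, 16], [1, 2, 4, 9, 16], [1, 3, 5, 10, 14], [1, 8], [1, 11, 17], [1, 12, 18],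
    [1, 13], [1, 15], [2, 3, 7, 8], [2, 6], [2, 10], [2, 12], [2, 14, 17], [2, 15, 18], [3, 6],
    [3, 9], [3, 11], [3, 13, 17], [3, 16, 18], [4, 5, 6, 8, 17, 18], [4, 7, 13, 14], [4, 10],
    [4, 11], [5, 7, 15, 16], [5, 9], [5, 12], [6, 9, 11], [6, 10, 12], [6, 13, 16], [6, 14, 15],
    [7, 9, 12, 17], [7, 10, 11, 18], [8, 9, 10, 13, 15], [8, 11, 12, 14, 16], [9, 14], [10, 16],
    [11, 15], [12, 13], [13, 18], [14, 18], [15, 17], [16, 17]]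
  core := ⟨2, 14, 15, ![17, 6, 18], [(14, 17)], [(15, 18)]⟩
  f₀ := 0
  f₁ := 1
  f₂ := 2
  f₃ := 3
  steps := [⟨4, 0, 3, 1, 2⟩, ⟨5, 0, 2, 1, 3⟩, ⟨6, 0, 1, 4, 5⟩, ⟨7, 0, 1, 2, 3⟩, ⟨8, 2, 3, 4, 5⟩,
    ⟨13, 0, 2, 4, 7⟩, ⟨14, 1, 3, 4, 7⟩, ⟨15, 0, 3, 5, 7⟩, ⟨16, 1, 2, 5, 7⟩, ⟨17, 2, 14, 3, 13⟩,
    ⟨18, 2, 15, 3, 16⟩, ⟨9, 0, 18, 1, 2⟩, ⟨10, 0, 17, 1, 3⟩, ⟨11, 0, 2, 1, 17⟩, ⟨12, 0, 3, 1, 18⟩]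

/-- The factors by which the covectors of `(E₈, A₁³ × A₂)` differ from the directions. -/
noncomputable def e8a111a2Scale : Fin 19 → ℝ :=
  ![√2, √2, √6, √6, √6, √6, 2, 2 * √3, 2 * √6, √2 / 2, √2 / 2, √2 / 2, √2 / 2, √6 / 2, √6 / 2,
    √6 / 2, √6 / 2, 1, 1]

/-- The squares of the scale factors of `(E₈, A₁³ × A₂)`, up to a common factor. -/
def e8a111a2Weight : Fin 19 → ℤ :=
  ![4, 4, 12, 12, 12, 12, 8, 24, 48, 1, 1, 1, 1, 3, 3, 3, 3, 2, 2]

lemma e8a111a2_isValid : e8a111a2Incidence.IsValid e8a111a2Dir [] := by decide +kernel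

lemma e8a111a2_isWeightedVee : IsWeightedVee e8a111a2Dir e8a111a2Incidence.lines e8a111a2Weight
    ![![6, 0, 0], ![0, 3, 0], ![0, 0, 2]] 360 := by
  decide +kernel

lemma e8a111a2Scale_sq (i : Fin 19) :
    e8a111a2Scale i ^ 2 = 1 / 2 * Int.castRingHom ℝ (e8a111a2Weight i) := by
  fin_cases i <;> norm_num [e8a111a2Scale, e8a111a2Weight, mul_pow, div_pow]

lemma sysE8A1A1A1A2_eq :
    sysE8A1A1A1A2 = fun i => e8a111a2Scale i • realize (Int.castRingHom ℝ) e8a111a2Dir i := by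
  funext i m
  fin_cases m <;> fin_cases i <;>
    norm_num [sysE8A1A1A1A2, e8a111a2Scale, e8a111a2Dir, realize] <;> ring

theorem isRigidVeeSystem_sysE8A1A1A1A2 : IsRigidVeeSystem sysE8A1A1A1A2 := by
  rw [sysE8A1A1A1A2_eq]
  exact isRigidVeeSystem_of_weights e8a111a2_isValid e8a111a2_isWeightedVee
    (by norm_num) (by norm_num) e8a111a2Scale_sq

/-- The directions of the covectors of `(E₈, A₂² × A₁)`. -/
def e8a22a1Dir : Fin 19 → Fin 3 → ℤ :=
  ![![1, 1, 0], ![1, 0, 1], ![0, 1, 1], ![1, -1, 0], ![1, 0, -1], ![0, 1, -1], ![1, 0, 0],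
    ![0, 1, 0], ![0, 0, 1], ![1, 1, 3], ![1, 1, 4], ![1, 1, 2], ![1, 2, 3], ![1, 0, 3],
    ![0, 1, 3], ![2, 1, 3], ![1, 0, 2], ![0, 1, 2], ![1, 1, 1]]

/-- The matroid of `(E₈, A₂² × A₁)`. -/
def e8a22a1Incidence : IncidenceData 19 where
  lines := [[0, 1, 5], [0, 2, 4], [0, 3, 6, 7], [0, 8, 9, 10, 11, 18], [0, 12, 14], [0, 13, 15],
    [0, 16], [0, 17], [1, 2, 3, 11, 12, 15], [1, 4, 6, 8, 13, 16], [1, 7, 18], [1, 9, 17],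
    [1, 10, 14], [2, 5, 7, 8, 14, 17], [2, 6, 18], [2, 9, 16], [2, 10, 13], [3, 4, 5], [3, 8],
    [3, 9], [3, 10, 16, 17], [3, 13, 14], [3, 18], [4, 7], [4, 9], [4, 10, 15], [4, 11, 14],
    [4, 12, 17, 18], [5, 6], [5, 9], [5, 10, 12], [5, 11, 13], [5, 15, 16, 18], [6, 9, 14, 15],
    [6, 10], [6, 11, 17], [6, 12], [7, 9, 12, 13], [7, 10], [7, 11, 16], [7, 15], [8, 12],
    [8, 15], [12, 16], [13, 17], [13, 18], [14, 16], [14, 18], [15, 17]]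
  core := ⟨0, 1, 14, ![5, 10, 12], [(1, 5)], [(14, 12)]⟩
  f₀ := 0
  f₁ := 1
  f₂ := 2
  f₃ := 6
  steps := [⟨3, 0, 6, 1, 2⟩, ⟨4, 0, 2, 1, 6⟩, ⟨5, 0, 1, 3, 4⟩, ⟨7, 0, 3, 2, 5⟩, ⟨8, 1, 4, 2, 5⟩,
    ⟨11, 0, 8, 1, 2⟩, ⟨13, 1, 4, 5, 11⟩, ⟨14, 2, 5, 3, 13⟩, ⟨15, 0, 13, 1, 2⟩, ⟨16, 1, 4, 5, 15⟩,
    ⟨17, 2, 5, 3, 16⟩, ⟨18, 0, 8, 1, 7⟩, ⟨9, 0, 8, 1, 17⟩, ⟨10, 0, 8, 1, 14⟩, ⟨12, 0, 14, 1, 2⟩]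

/-- The factors by which the covectors of `(E₈, A₂² × A₁)` differ from the directions. -/
noncomputable def e8a22a1Scale : Fin 19 → ℝ :=
  ![√3, 3, 3, 1, √3, √3, √6, √6, 6 * √2, √6, √3, 3, 1, √3, √3, 1, √6, √6, √6]

/-- The squares of the scale factors of `(E₈, A₂² × A₁)`, up to a common factor. -/
def e8a22a1Weight : Fin 19 → ℤ :=
  ![3, 9, 9, 1, 3, 3, 6, 6, 72, 6, 3, 9, 1, 3, 3, 1, 6, 6, 6]

lemma e8a22a1_isValid : e8a22a1Incidence.IsValid e8a22a1Dir [] := by decide +kernel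

lemma e8a22a1_isWeightedVee : IsWeightedVee e8a22a1Dir e8a22a1Incidence.lines e8a22a1Weight
    ![![5, -1, -1], ![-1, 5, -1], ![-1, -1, 1]] 180 := by
  decide +kernel

lemma e8a22a1Scale_sq (i : Fin 19) :
    e8a22a1Scale i ^ 2 = 1 * Int.castRingHom ℝ (e8a22a1Weight i) := by
  fin_cases i <;> norm_num [e8a22a1Scale, e8a22a1Weight, mul_pow, div_pow]

lemma sysE8A2A2A1_eq :
    sysE8A2A2A1 = fun i => e8a22a1Scale i • realize (Int.castRingHom ℝ) e8a22a1Dir i := by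
  funext i m
  fin_cases m <;> fin_cases i <;>
    norm_num [sysE8A2A2A1, e8a22a1Scale, e8a22a1Dir, realize] <;> ring

theorem isRigidVeeSystem_sysE8A2A2A1 : IsRigidVeeSystem sysE8A2A2A1 := by
  rw [sysE8A2A2A1_eq]
  exact isRigidVeeSystem_of_weights e8a22a1_isValid e8a22a1_isWeightedVee
    (by norm_num) (by norm_num) e8a22a1Scale_sq

end Catalogue

/-! ### The systems over the golden field -/

section Catalogue

set_option maxRecDepth 100000

/-- The directions of the covectors of `H₃`. -/
def h3Dir : Fin 15 → Fin 3 → ℤ√5 :=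
  ![![1, 0, 0], ![0, 1, 0], ![0, 0, 1], ![2, ⟨1, 1⟩, ⟨3, 1⟩], ![-2, ⟨1, 1⟩, ⟨3, 1⟩],
    ![2, ⟨-1, -1⟩, ⟨3, 1⟩], ![2, ⟨1, 1⟩, ⟨-3, -1⟩], ![⟨1, 1⟩, ⟨-3, -1⟩, 2],
    ![⟨-1, -1⟩, ⟨3, 1⟩, 2], ![⟨1, 1⟩, ⟨3, 1⟩, -2], ![⟨1, 1⟩, ⟨3, 1⟩, 2], ![⟨3, 1⟩, 2, ⟨-1, -1⟩],
    ![⟨3, 1⟩, -2, ⟨1, 1⟩], ![⟨-3, -1⟩, 2, ⟨1, 1⟩], ![⟨3, 1⟩, 2, ⟨1, 1⟩]]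

/-- The matroid of `H₃`. -/
def h3Incidence : IncidenceData 15 where
  lines := [[0, 1], [0, 2], [0, 3, 4, 13, 14], [0, 5, 6, 11, 12], [0, 7, 9], [0, 8, 10], [1, 2],
    [1, 3, 5], [1, 4, 6], [1, 7, 10, 12, 14], [1, 8, 9, 11, 13], [2, 3, 6, 9, 10],
    [2, 4, 5, 7, 8], [2, 11, 14], [2, 12, 13], [3, 7], [3, 8, 12], [3, 11], [4, 9], [4, 10, 11],
    [4, 12], [5, 9, 14], [5, 10], [5, 13], [6, 7, 13], [6, 8], [6, 14], [7, 11], [8, 14], [9, 12],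
    [10, 13]]
  core := ⟨0, 1, 2, ![0, 1, 0], [(7, 9), (6, 13), (1, 4)], [(7, 9), (13, 6), (2, 12)]⟩
  f₀ := 0
  f₁ := 3
  f₂ := 1
  f₃ := 6
  steps := [⟨4, 0, 3, 1, 6⟩, ⟨5, 0, 6, 1, 3⟩, ⟨7, 1, 14, 4, 5⟩, ⟨9, 0, 7, 3, 6⟩, ⟨10, 1, 7, 3, 6⟩,
    ⟨11, 0, 5, 1, 9⟩, ⟨12, 0, 5, 1, 7⟩, ⟨13, 0, 3, 1, 9⟩, ⟨2, 3, 6, 4, 5⟩, ⟨8, 0, 10, 1, 9⟩]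

/-- The golden data of `H₃`: conjugation permutes the covectors. -/
def h3Golden : GoldenData 15 where
  x := 14
  y₄ := 4
  y₅ := 5
  y₇ := 7
  y₉ := 9
  M := ![![⟨1, 1⟩, 0, ⟨1, -1⟩], ![0, 0, ⟨2, -2⟩], ![0, 2, ⟨1, -1⟩]]
  N := ![![1, 0, 0], ![0, 0, 1], ![0, 1, 0]]
  perm := ![0, 2, 1, 11, 12, 14, 13, 7, 10, 9, 8, 3, 4, 6, 5]

/-- The squares of the scale factors of `H₃`, up to a common factor. -/
def h3Weight : Fin 15 → ℤ√5 :=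
  ![⟨24, 8⟩, ⟨24, 8⟩, ⟨24, 8⟩, 1, 1, 1, 1, 1, 1, 1, 1, 1, 1, 1, 1]

/-- The factors by which the covectors of `H₃` differ from the directions. -/
noncomputable def h3Scale : Fin 15 → ℝ :=
  ![1 + √5, 1 + √5, 1 + √5, 1 / 2, 1 / 2, 1 / 2, 1 / 2, 1 / 2, 1 / 2, 1 / 2, 1 / 2, 1 / 2, 1 / 2,
    1 / 2, 1 / 2]

lemma h3_isValid : h3Incidence.IsValid h3Dir [h3Golden.x] := by decide +kernel

lemma h3Golden_isValid : h3Golden.IsValid h3Incidence h3Dir := by decide +kernel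

lemma h3_isWeightedVee : IsWeightedVee h3Dir h3Incidence.lines h3Weight
    ![![1, 0, 0], ![0, 1, 0], ![0, 0, 1]] ⟨120, 40⟩ := by
  decide +kernel

lemma sqrt_five_sq : √(5 : ℝ) ^ 2 = 5 := Real.sq_sqrt (by norm_num)

lemma h3Scale_sq (i : Fin 15) : h3Scale i ^ 2 = 1 / 4 * embPos (h3Weight i) := by
  have h5 := sqrt_five_sq
  fin_cases i <;> norm_num [h3Scale, h3Weight, embPos_apply] <;> linear_combination h5

lemma sysH3_eq : sysH3 ((1 + √5) / 2) = fun i => h3Scale i • realize embPos h3Dir i := by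
  have hφ : Real.goldenRatio = (1 + √5) / 2 := rfl
  funext i m
  fin_cases m <;> fin_cases i <;>
    norm_num [sysH3, h3Scale, h3Dir, realize, embPos_apply] <;> linarith

theorem isRigidVeeSystem_sysH3 : IsRigidVeeSystem (sysH3 ((1 + √5) / 2)) := by
  rw [sysH3_eq]
  exact isRigidVeeSystem_of_golden h3Golden_isValid h3_isValid
    (scale_ne_zero embPos_injective (by norm_num) h3Scale_sq (by decide)) h3_isWeightedVee
    (by norm_num) (by decide) h3Scale_sq (by decide +kernel)

/-- The directions of the covectors of `(H₄, A₁)`. -/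
def h4a1Dir : Fin 31 → Fin 3 → ℤ√5 :=
  ![![1, 0, 0], ![0, 1, 0], ![0, 0, 1], ![1, 1, 1], ![1, 1, -1], ![1, -1, 1], ![1, -1, -1],
    ![⟨1, 1⟩, 2, ⟨-1, 1⟩], ![⟨1, 1⟩, 2, ⟨1, -1⟩], ![⟨1, 1⟩, -2, ⟨-1, 1⟩], ![⟨1, 1⟩, -2, ⟨1, -1⟩],
    ![⟨-1, 1⟩, ⟨1, 1⟩, 2], ![⟨-1, 1⟩, ⟨1, 1⟩, -2], ![⟨-1, 1⟩, ⟨-1, -1⟩, 2],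
    ![⟨-1, 1⟩, ⟨-1, -1⟩, -2], ![2, ⟨-1, 1⟩, ⟨1, 1⟩], ![2, ⟨-1, 1⟩, ⟨-1, -1⟩],
    ![2, ⟨1, -1⟩, ⟨1, 1⟩], ![2, ⟨1, -1⟩, ⟨-1, -1⟩], ![⟨1, 1⟩, ⟨-1, 1⟩, 0], ![⟨1, 1⟩, ⟨1, -1⟩, 0],
    ![0, ⟨1, 1⟩, ⟨-1, 1⟩], ![0, ⟨1, 1⟩, ⟨1, -1⟩], ![⟨-1, 1⟩, 0, ⟨1, 1⟩], ![⟨-1, 1⟩, 0, ⟨-1, -1⟩],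
    ![2, ⟨1, 1⟩, 0], ![2, ⟨-1, -1⟩, 0], ![0, 2, ⟨1, 1⟩], ![0, 2, ⟨-1, -1⟩], ![⟨1, 1⟩, 0, 2],
    ![⟨-1, -1⟩, 0, 2]]

/-- The matroid of `(H₄, A₁)`. -/
def h4a1Incidence : IncidenceData 31 where
  lines := [[0, 1, 19, 20, 25, 26], [0, 2, 23, 24, 29, 30], [0, 3, 6], [0, 4, 5],
    [0, 7, 10, 11, 14], [0, 8, 9, 12, 13], [0, 15, 18], [0, 16, 17], [0, 21], [0, 22], [0, 27],
    [0, 28], [1, 2, 21, 22, 27, 28], [1, 3, 5], [1, 4, 6], [1, 7, 9], [1, 8, 10],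
    [1, 11, 13, 15, 17], [1, 12, 14, 16, 18], [1, 23], [1, 24], [1, 29], [1, 30], [2, 3, 4],
    [2, 5, 6], [2, 7, 8, 15, 16], [2, 9, 10, 17, 18], [2, 11, 12], [2, 13, 14], [2, 19], [2, 20],
    [2, 25], [2, 26], [3, 7, 18, 19, 27, 30], [3, 8, 24], [3, 9, 11, 21, 26, 29], [3, 10],
    [3, 12, 15, 23, 25, 28], [3, 13], [3, 14, 20], [3, 16], [3, 17, 22], [4, 7, 23],
    [4, 8, 17, 19, 28, 29], [4, 9], [4, 10, 12, 22, 26, 30], [4, 11, 16, 24, 25, 27], [4, 13, 20],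
    [4, 14], [4, 15], [4, 18, 21], [5, 7, 13, 22, 25, 29], [5, 8], [5, 9, 16, 20, 28, 30],
    [5, 10, 24], [5, 11], [5, 12, 19], [5, 14, 17, 23, 26, 27], [5, 15, 21], [5, 18], [6, 7],
    [6, 8, 14, 21, 25, 30], [6, 9, 23], [6, 10, 15, 20, 27, 29], [6, 11, 19], [6, 12],
    [6, 13, 18, 24, 26, 28], [6, 16, 22], [6, 17], [7, 12, 17], [7, 20, 21], [7, 24], [7, 26],
    [7, 28], [8, 11, 18], [8, 20, 22], [8, 23], [8, 26], [8, 27], [9, 14, 15], [9, 19, 22],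
    [9, 24], [9, 25], [9, 27], [10, 13, 16], [10, 19, 21], [10, 23], [10, 25], [10, 28], [11, 20],
    [11, 22, 23], [11, 28], [11, 30], [12, 20], [12, 21, 24], [12, 27], [12, 29], [13, 19],
    [13, 21, 23], [13, 27], [13, 30], [14, 19], [14, 22, 24], [14, 28], [14, 29], [15, 19, 24],
    [15, 22], [15, 26], [15, 30], [16, 19, 23], [16, 21], [16, 26], [16, 29], [17, 20, 24],
    [17, 21], [17, 25], [17, 30], [18, 20, 23], [18, 22], [18, 25], [18, 29]]
  core := ⟨0, 3, 4, ![6, 2, 5], [(3, 6)], [(4, 5)]⟩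
  f₀ := 2
  f₁ := 7
  f₂ := 1
  f₃ := 10
  steps := [⟨8, 1, 10, 2, 7⟩, ⟨9, 1, 7, 2, 10⟩, ⟨11, 7, 10, 1, 15⟩, ⟨12, 8, 9, 2, 11⟩,
    ⟨13, 8, 9, 1, 11⟩, ⟨14, 7, 10, 1, 12⟩, ⟨16, 1, 12, 2, 7⟩, ⟨17, 1, 11, 2, 9⟩,
    ⟨18, 1, 12, 2, 9⟩, ⟨19, 7, 18, 8, 17⟩, ⟨20, 1, 19, 9, 16⟩, ⟨21, 1, 2, 9, 11⟩,
    ⟨22, 1, 2, 10, 12⟩, ⟨23, 12, 15, 14, 17⟩, ⟨24, 2, 23, 11, 16⟩, ⟨25, 1, 19, 12, 15⟩,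
    ⟨26, 1, 19, 9, 11⟩, ⟨27, 1, 2, 7, 18⟩, ⟨28, 1, 2, 12, 15⟩, ⟨29, 2, 23, 9, 11⟩,
    ⟨30, 2, 23, 7, 18⟩, ⟨0, 1, 19, 2, 23⟩, ⟨3, 7, 18, 8, 24⟩, ⟨4, 2, 3, 7, 23⟩, ⟨5, 0, 4, 1, 3⟩,
    ⟨6, 0, 3, 1, 4⟩]

/-- The golden data of `(H₄, A₁)`: conjugation permutes the covectors. -/
def h4a1Golden : GoldenData 31 where
  x := 15
  y₄ := 8
  y₅ := 9
  y₇ := 13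
  y₉ := 14
  M := ![![⟨1, -1⟩, 0, ⟨1, 1⟩], ![⟨2, -2⟩, 0, 0], ![⟨1, -1⟩, 2, 0]]
  N := ![![0, 0, 1], ![0, -1, 0], ![1, 0, 0]]
  perm := ![2, 1, 0, 5, 4, 3, 6, 7, 10, 9, 8, 16, 17, 18, 15, 14, 11, 12, 13, 22, 21, 20, 19, 23,
    24, 27, 28, 25, 26, 30, 29]

/-- The squares of the scale factors of `(H₄, A₁)`, up to a common factor. -/
def h4a1Weight : Fin 31 → ℤ√5 :=
  ![16, 16, 16, 8, 8, 8, 8, 1, 1, 1, 1, 1, 1, 1, 1, 1, 1, 1, 1, 2, 2, 2, 2, 2, 2, ⟨5, -1⟩,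
    ⟨5, -1⟩, ⟨5, -1⟩, ⟨5, -1⟩, ⟨5, -1⟩, ⟨5, -1⟩]

/-- The factors by which the covectors of `(H₄, A₁)` differ from the directions. -/
noncomputable def h4a1Scale (w : ℝ) : Fin 31 → ℝ :=
  ![1, 1, 1, √2 / 2, √2 / 2, √2 / 2, √2 / 2, 1 / 4, 1 / 4, 1 / 4, 1 / 4, 1 / 4, 1 / 4, 1 / 4, 1 / 4,
    1 / 4, 1 / 4, 1 / 4, 1 / 4, √2 / 4, √2 / 4, √2 / 4, √2 / 4, √2 / 4, √2 / 4,
    w / 2, w / 2, w / 2, w / 2, w / 2, w / 2]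

lemma h4a1_isValid : h4a1Incidence.IsValid h4a1Dir [h4a1Golden.x] := by decide +kernel

lemma h4a1Golden_isValid : h4a1Golden.IsValid h4a1Incidence h4a1Dir := by decide +kernel

lemma h4a1_isWeightedVee : IsWeightedVee h4a1Dir h4a1Incidence.lines h4a1Weight
    ![![1, 0, 0], ![0, 1, 0], ![0, 0, 1]] 240 := by
  decide +kernel

lemma h4a1Scale_sq {w : ℝ} (hw : w ^ 2 = (-1 + √5) / 4 * √5) (i : Fin 31) :
    h4a1Scale w i ^ 2 = 1 / 16 * embPos (h4a1Weight i) := by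
  have h5 := sqrt_five_sq
  fin_cases i <;> norm_num [h4a1Scale, h4a1Weight, embPos_apply, div_pow, hw] <;>
    linear_combination (1 / 16) * h5

set_option maxHeartbeats 2000000 in
lemma sysH4A1_eq (w : ℝ) : sysH4A1 ((1 + √5) / 4) ((-1 + √5) / 4) w =
    fun i => h4a1Scale w i • realize embPos h4a1Dir i := by
  funext i m
  fin_cases m <;> fin_cases i <;>
    simp [sysH4A1, h4a1Scale, h4a1Dir, realize, embPos_apply] <;> ring

theorem isRigidVeeSystem_sysH4A1 :
    IsRigidVeeSystem (sysH4A1 ((1 + √5) / 4) ((-1 + √5) / 4) √((-1 + √5) / 4 * √5)) := by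
  have h1 : 1 ≤ √(5 : ℝ) := Real.one_le_sqrt.2 (by norm_num)
  have hs := h4a1Scale_sq (Real.sq_sqrt (mul_nonneg (by linarith) (by linarith)))
  rw [sysH4A1_eq]
  exact isRigidVeeSystem_of_golden h4a1Golden_isValid h4a1_isValid
    (scale_ne_zero embPos_injective (by norm_num) hs (by decide)) h4a1_isWeightedVee
    (by norm_num) (by decide) hs (by decide +kernel)

end Catalogue

/-! ### Verification of the `∨`-conditions for weights polynomial in a parameter -/

section Poly

/-- The value at `t` of the polynomial with the given list of coefficients, constant term first. -/
def evalList (t : ℝ) : List ℤ → ℝ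
  | [] => 0
  | a :: p => a + t * evalList t p

/-- The sum of polynomials given by lists of coefficients. -/
def addList : List ℤ → List ℤ → List ℤ
  | [], q => q
  | p, [] => p
  | a :: p, b :: q => (a + b) :: addList p q

/-- An integer multiple of a polynomial given by a list of coefficients. -/
def smulList (z : ℤ) : List ℤ → List ℤ
  | [] => []
  | a :: p => z * a :: smulList z p

/-- The product of polynomials given by lists of coefficients. -/
def mulList : List ℤ → List ℤ → List ℤ
  | [], _ => []
  | a :: p, q => addList (smulList a q) (0 :: mulList p q)

/-- The sum of a list of polynomials. -/
def sumList : List (List ℤ) → List ℤ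
  | [] => []
  | p :: l => addList p (sumList l)

variable (t : ℝ)

lemma evalList_add (p q : List ℤ) :
    evalList t (addList p q) = evalList t p + evalList t q := by
  induction p generalizing q with
  | nil => simp [addList, evalList]
  | cons a p ih =>
    cases q with
    | nil => simp [addList, evalList]
    | cons b q => simp only [addList, evalList, ih]; push_cast; ring

lemma evalList_smul (z : ℤ) (p : List ℤ) : evalList t (smulList z p) = z * evalList t p := by
  induction p with
  | nil => simp [smulList, evalList]
  | cons a p ih => simp only [smulList, evalList, ih]; push_cast; ring

lemma evalList_mul (p q : List ℤ) :
    evalList t (mulList p q) = evalList t p * evalList t q := by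
  induction p with
  | nil => simp [mulList, evalList]
  | cons a p ih =>
    simp only [mulList, evalList, evalList_add, evalList_smul, ih]; push_cast; ring

lemma evalList_sum {α : Type*} (f : α → List ℤ) (l : List α) :
    evalList t (sumList (l.map f)) = (l.map fun k => evalList t (f k)).sum := by
  induction l with
  | nil => rfl
  | cons a l ih => simp [sumList, evalList_add, ih]

lemma evalList_eq_zero {p : List ℤ} (hp : ∀ a ∈ p, a = 0) : evalList t p = 0 := by
  induction p with
  | nil => rfl
  | cons a p ih =>
    rw [List.forall_mem_cons] at hp
    simp [evalList, hp.1, ih hp.2]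

/-- The linear form `B x` applied to `y`, for a matrix `B` of polynomials. -/
def rowList (r : Fin 3 → List ℤ) (y : Fin 3 → ℤ) : List ℤ :=
  sumList [smulList (y 0) (r 0), smulList (y 1) (r 1), smulList (y 2) (r 2)]

lemma evalList_rowList (r : Fin 3 → List ℤ) (y : Fin 3 → ℤ) : evalList t (rowList r y) =
    evalList t (r 0) * y 0 + evalList t (r 1) * y 1 + evalList t (r 2) * y 2 := by
  simp only [rowList, sumList, evalList_add, evalList_smul, evalList]
  ring

variable {n : ℕ}

/-- The `∨`-conditions, as in `IsWeightedVee`, for weights and a form which depend polynomially on a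
parameter. -/
def IsPolyVee (u : Fin n → Fin 3 → ℤ) (lines : List (List (Fin n))) (w : Fin n → List ℤ)
    (B : Fin 3 → Fin 3 → List ℤ) (c : List ℤ) : Prop :=
  (∀ k l, B k l = B l k) ∧
    (∀ k l, ∀ a ∈ addList (smulList (-1) (if k = l then c else []))
        (sumList ((List.finRange n).map fun i =>
          smulList (u i l) (mulList (w i) (rowList (B k) (u i))))), a = 0) ∧
    ∀ L ∈ lines, ∀ i ∈ L, ∀ m, ∀ a ∈ sumList (L.map fun k =>
      smulList (cross3 (u k) (u i) m)
        (mulList (w k) (rowList (fun a => rowList (B a) (u i)) (u k)))), a = 0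

instance IsPolyVee.decidable (u : Fin n → Fin 3 → ℤ) (lines : List (List (Fin n)))
    (w : Fin n → List ℤ) (B : Fin 3 → Fin 3 → List ℤ) (c : List ℤ) :
    Decidable (IsPolyVee u lines w B c) := by
  unfold IsPolyVee; infer_instance

lemma cross3_sum_left {α : Type*} (l : List α) (f : α → ℝ) (v : α → Fin 3 → ℝ) (y : Fin 3 → ℝ)
    (m : Fin 3) : cross3 (fun m => (l.map fun k => f k * v k m).sum) y m =
      (l.map fun k => cross3 (v k) y m * f k).sum := by
  induction l with
  | nil => fin_cases m <;> simp [cross3]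
  | cons a l ih =>
    rw [List.map_cons, List.sum_cons, ← ih]
    fin_cases m <;> simp [cross3] <;> ring

lemma IsPolyVee.isWeightedVee {u : Fin n → Fin 3 → ℤ} {lines : List (List (Fin n))}
    {w : Fin n → List ℤ} {B : Fin 3 → Fin 3 → List ℤ} {c : List ℤ}
    (h : IsPolyVee u lines w B c) (t : ℝ) :
    IsWeightedVee (realize (Int.castRingHom ℝ) u) lines (fun i => evalList t (w i))
      (fun k l => evalList t (B k l)) (evalList t c) := by
  obtain ⟨h1, h2, h3⟩ := h
  refine ⟨fun k l => congrArg (evalList t) (h1 k l), fun k l => ?_, fun L hL i hi => ?_⟩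
  · have h4 := evalList_eq_zero t (h2 k l)
    rw [evalList_add, evalList_smul, evalList_sum, ← List.ofFn_eq_map, List.sum_ofFn] at h4
    simp only [evalList_smul, evalList_mul, evalList_rowList] at h4
    have h5 : evalList t (if k = l then c else []) = if k = l then evalList t c else 0 := by
      split_ifs <;> rfl
    rw [← h5]
    simp only [realize, eq_intCast]
    rw [← sub_eq_zero, ← h4, sub_eq_neg_add]
    push_cast
    rw [neg_one_mul]
    congr 1
    exact Finset.sum_congr rfl fun i _ => by ring
  · funext m
    have h4 := evalList_eq_zero t (h3 L hL i hi m)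
    rw [evalList_sum] at h4
    simp only [evalList_smul, evalList_mul, evalList_rowList] at h4
    rw [cross3_sum_left, Pi.zero_apply, ← h4]
    congr 1
    refine List.map_congr_left fun k _ => ?_
    have h5 := congrFun (cross3_map (Int.castRingHom ℝ) (u k) (u i)) m
    rw [show cross3 (realize (Int.castRingHom ℝ) u k) (realize (Int.castRingHom ℝ) u i) m =
      ((cross3 (u k) (u i) m : ℤ) : ℝ) from h5]
    simp only [bil3, realize, eq_intCast]
    ring

end Poly

/-! ### The systems depending on parameters -/

section Catalogue

set_option maxRecDepth 100000

/-- The criterion for directions in `ℤ³` and real scale factors. -/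
theorem isRigidVeeSystem_of_real_weights {n : ℕ} {u : Fin n → Fin 3 → ℤ} {D : IncidenceData n}
    (hD : D.IsValid u []) {s w : Fin n → ℝ} {B : Fin 3 → Fin 3 → ℝ} {c ρ : ℝ}
    (hv : IsWeightedVee (realize (Int.castRingHom ℝ) u) D.lines w B c) (hc : c ≠ 0) (hρ : ρ ≠ 0)
    (hs : ∀ i, s i ^ 2 = ρ * w i) (hw : ∀ i, w i ≠ 0) :
    IsRigidVeeSystem fun i => s i • realize (Int.castRingHom ℝ) u i := by
  have hf : Function.Injective (Int.castRingHom ℝ) := Int.cast_injective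
  have hs0 := scale_ne_zero (f := RingHom.id ℝ) Function.injective_id hρ hs hw
  obtain ⟨h, ha, -⟩ := hD.1.exists_isVeeConfig hf hs0 hρ hc hs hv.1 hv.2.1 hv.2.2
  exact isRigidVeeSystem_of_frame hD hf hs0 ⟨h, ha⟩

/-- The directions of the covectors of `A₃`. -/
def a3Dir : Fin 6 → Fin 3 → ℤ :=
  ![![1, 0, 0], ![0, 1, 0], ![0, 0, 1], ![-1, 1, 0], ![-1, 0, 1], ![0, -1, 1]]

/-- The matroid of `A₃`. -/
def a3Incidence : IncidenceData 6 where
  lines := [[0, 1, 3], [0, 2, 4], [0, 5], [1, 2, 5], [1, 4], [2, 3], [3, 4, 5]]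
  core := ⟨0, 1, 2, ![3, 5, 4], [(1, 3)], [(2, 4)]⟩
  f₀ := 0
  f₁ := 1
  f₂ := 4
  f₃ := 5
  steps := [⟨2, 0, 4, 1, 5⟩, ⟨3, 0, 1, 4, 5⟩]

/-- The factors by which the covectors of `A₃` differ from the directions. -/
noncomputable def a3Scale (c₁ c₂ c₃ : ℝ) : Fin 6 → ℝ :=
  ![√c₁, √c₂, √c₃, √(c₁ * c₂), √(c₁ * c₃), √(c₂ * c₃)]

/-- The squares of the scale factors of `A₃`, up to a common factor. -/
def a3Weight (c₁ c₂ c₃ : ℝ) : Fin 6 → ℝ :=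
  ![c₁, c₂, c₃, c₁ * c₂, c₁ * c₃, c₂ * c₃]

lemma a3_isValid : a3Incidence.IsValid a3Dir [] := by decide +kernel

lemma a3_isWeightedVee (c₁ c₂ c₃ : ℝ) :
    IsWeightedVee (realize (Int.castRingHom ℝ) a3Dir) a3Incidence.lines (a3Weight c₁ c₂ c₃)
      ![![c₂ * c₃ + c₁ * c₂ * c₃, c₁ * c₂ * c₃, c₁ * c₂ * c₃],
      ![c₁ * c₂ * c₃, c₁ * c₃ + c₁ * c₂ * c₃, c₁ * c₂ * c₃],
      ![c₁ * c₂ * c₃, c₁ * c₂ * c₃, c₁ * c₂ + c₁ * c₂ * c₃]]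
      ((1 + c₁ + c₂ + c₃) * (c₁ * c₂ * c₃)) := by
  refine ⟨fun k l => ?_, fun k l => ?_, ?_⟩
  · fin_cases k <;> fin_cases l <;> rfl
  · fin_cases k <;> fin_cases l <;>
      simp [Fin.sum_univ_succ, realize, a3Dir, a3Weight] <;> ring
  · simp only [a3Incidence, List.forall_mem_cons]
    repeat' apply And.intro
    all_goals
      first
      | exact List.forall_mem_nil _
      | funext m
        fin_cases m <;>
          simp only [cross3, bil3, realize, a3Dir, a3Weight, List.map_cons, List.map_nil,
            List.sum_cons, List.sum_nil, Matrix.cons_val, eq_intCast, Int.cast_zero, Int.cast_one,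
            Int.cast_neg, Fin.mk_one, Fin.reduceFinMk, Pi.zero_apply, Fin.zero_eta] <;>
          ring

lemma sysA3_eq (c₁ c₂ c₃ : ℝ) :
    sysA3 c₁ c₂ c₃ = fun i => a3Scale c₁ c₂ c₃ i • realize (Int.castRingHom ℝ) a3Dir i := by
  funext i m
  fin_cases m <;> fin_cases i <;> simp [sysA3, a3Scale, a3Dir, realize]

theorem isRigidVeeSystem_sysA3 {c₁ c₂ c₃ : ℝ} (h₁ : 0 < c₁) (h₂ : 0 < c₂) (h₃ : 0 < c₃) :
    IsRigidVeeSystem (sysA3 c₁ c₂ c₃) := by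
  rw [sysA3_eq]
  refine isRigidVeeSystem_of_real_weights a3_isValid (a3_isWeightedVee c₁ c₂ c₃) (by positivity)
    one_ne_zero (fun i => ?_) fun i => ?_
  · fin_cases i <;> simp [a3Scale, a3Weight, Real.sq_sqrt, mul_pow, h₁.le, h₂.le, h₃.le]
  · fin_cases i <;> simp [a3Weight, h₁.ne', h₂.ne', h₃.ne']

/-- The directions of the covectors of `D₃`. -/
def d3Dir : Fin 7 → Fin 3 → ℤ :=
  ![![1, 1, 1], ![1, -1, -1], ![1, -1, 1], ![1, 1, -1], ![0, 1, 0], ![0, 0, 1], ![1, 0, 0]]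

/-- The matroid of `D₃`. -/
def d3Incidence : IncidenceData 7 where
  lines := [[0, 1, 6], [0, 2, 4], [0, 3, 5], [1, 2, 5], [1, 3, 4], [2, 3, 6], [4, 5], [4, 6],
    [5, 6]]
  core := ⟨0, 1, 2, ![6, 5, 4], [(1, 6)], [(2, 4)]⟩
  f₀ := 0
  f₁ := 1
  f₂ := 2
  f₃ := 3
  steps := [⟨4, 0, 2, 1, 3⟩, ⟨5, 0, 3, 1, 2⟩, ⟨6, 0, 1, 2, 3⟩]

/-- The factors by which the covectors of `D₃` differ from the directions. -/
noncomputable def d3Scale (t s : ℝ) : Fin 7 → ℝ :=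
  ![1, 1, 1, 1, √(2 * (s - t + 1) / t), √(2 * (t - s + 1) / s), √(2 * (s + t - 1))]

/-- The squares of the scale factors of `D₃`, up to a common factor. -/
def d3Weight (t s : ℝ) : Fin 7 → ℝ :=
  ![t * s, t * s, t * s, t * s, 2 * s * (s - t + 1), 2 * t * (t - s + 1), 2 * t * s * (s + t - 1)]

lemma d3_isValid : d3Incidence.IsValid d3Dir [] := by decide +kernel

lemma d3_isWeightedVee (t s : ℝ) :
    IsWeightedVee (realize (Int.castRingHom ℝ) d3Dir) d3Incidence.lines (d3Weight t s)
      ![![1, 0, 0], ![0, t, 0], ![0, 0, s]]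
      (2 * t * s * (s + t + 1)) := by
  refine ⟨fun k l => ?_, fun k l => ?_, ?_⟩
  · fin_cases k <;> fin_cases l <;> rfl
  · fin_cases k <;> fin_cases l <;>
      simp [Fin.sum_univ_succ, realize, d3Dir, d3Weight] <;> ring
  · simp only [d3Incidence, List.forall_mem_cons]
    repeat' apply And.intro
    all_goals
      first
      | exact List.forall_mem_nil _
      | funext m
        fin_cases m <;>
          simp only [cross3, bil3, realize, d3Dir, d3Weight, List.map_cons, List.map_nil,
            List.sum_cons, List.sum_nil, Matrix.cons_val, eq_intCast, Int.cast_zero, Int.cast_one,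
            Int.cast_neg, Fin.mk_one, Fin.reduceFinMk, Pi.zero_apply, Fin.zero_eta] <;>
          ring

lemma sysD3_eq (t s : ℝ) :
    sysD3 t s = fun i => d3Scale t s i • realize (Int.castRingHom ℝ) d3Dir i := by
  funext i m
  fin_cases m <;> fin_cases i <;> simp [sysD3, d3Scale, d3Dir, realize]

theorem isRigidVeeSystem_sysD3 {t s : ℝ} (h₁ : 0 < s + t - 1) (h₂ : 0 < (s - t + 1) / t)
    (h₃ : 0 < (t - s + 1) / s) : IsRigidVeeSystem (sysD3 t s) := by
  have ht : t ≠ 0 := by rintro rfl; simp at h₂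
  have hs : s ≠ 0 := by rintro rfl; simp at h₃
  have h4 : s - t + 1 ≠ 0 := by intro h0; simp [h0] at h₂
  have h5 : t - s + 1 ≠ 0 := by intro h0; simp [h0] at h₃
  have h6 : 0 ≤ 2 * (s - t + 1) / t := by rw [mul_div_assoc]; positivity
  have h7 : 0 ≤ 2 * (t - s + 1) / s := by rw [mul_div_assoc]; positivity
  have h8 : 0 ≤ 2 * (s + t - 1) := by positivity
  have h9 : s + t + 1 ≠ 0 := by linarith
  rw [sysD3_eq]
  refine isRigidVeeSystem_of_real_weights d3_isValid (d3_isWeightedVee t s) (by positivity)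
    (ρ := (t * s)⁻¹) (by positivity) (fun i => ?_) fun i => ?_
  · fin_cases i <;>
      norm_num [d3Scale, d3Weight, Real.sq_sqrt h6, Real.sq_sqrt h7, Real.sq_sqrt h8,
        -Real.sqrt_mul, -Real.sqrt_mul', -Real.sqrt_div, -Real.sqrt_div'] <;>
      field_simp
  · fin_cases i <;> simp [d3Weight, ht, hs, h4, h5, h₁.ne']

/-- The directions of the covectors of `B₃`. -/
def b3Dir : Fin 9 → Fin 3 → ℤ :=
  ![![1, 0, 0], ![0, 1, 0], ![0, 0, 1], ![0, 1, 1], ![1, 0, 1], ![1, 1, 0], ![0, -1, 1],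
    ![-1, 0, 1], ![-1, 1, 0]]

/-- The matroid of `B₃`. -/
def b3Incidence : IncidenceData 9 where
  lines := [[0, 1, 5, 8], [0, 2, 4, 7], [0, 3], [0, 6], [1, 2, 3, 6], [1, 4], [1, 7], [2, 5],
    [2, 8], [3, 4, 8], [3, 5, 7], [4, 5, 6], [6, 7, 8]]
  core := ⟨3, 4, 5, ![8, 6, 7], [(4, 8)], [(5, 7)]⟩
  f₀ := 0
  f₁ := 3
  f₂ := 4
  f₃ := 5
  steps := [⟨7, 0, 4, 3, 5⟩, ⟨8, 0, 5, 3, 4⟩, ⟨6, 4, 5, 7, 8⟩, ⟨1, 0, 5, 3, 6⟩, ⟨2, 0, 4, 1, 3⟩]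

/-- The factors by which the covectors of `B₃` differ from the directions. -/
noncomputable def b3Scale (c₁ c₂ c₃ γ : ℝ) : Fin 9 → ℝ :=
  ![√(2 * c₁ * (c₁ + γ)), √(2 * c₂ * (c₂ + γ)), √(2 * c₃ * (c₃ + γ)), √(c₂ * c₃), √(c₁ * c₃),
    √(c₁ * c₂), √(c₂ * c₃), √(c₁ * c₃), √(c₁ * c₂)]

/-- The squares of the scale factors of `B₃`, up to a common factor. -/
def b3Weight (c₁ c₂ c₃ γ : ℝ) : Fin 9 → ℝ :=
  ![2 * c₁ * (c₁ + γ), 2 * c₂ * (c₂ + γ), 2 * c₃ * (c₃ + γ), c₂ * c₃, c₁ * c₃, c₁ * c₂, c₂ * c₃,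
    c₁ * c₃, c₁ * c₂]

lemma b3_isValid : b3Incidence.IsValid b3Dir [] := by decide +kernel

lemma b3_isWeightedVee (c₁ c₂ c₃ γ : ℝ) :
    IsWeightedVee (realize (Int.castRingHom ℝ) b3Dir) b3Incidence.lines (b3Weight c₁ c₂ c₃ γ)
      ![![c₂ * c₃, 0, 0], ![0, c₁ * c₃, 0], ![0, 0, c₁ * c₂]]
      (2 * (c₁ + c₂ + c₃ + γ) * (c₁ * c₂ * c₃)) := by
  refine ⟨fun k l => ?_, fun k l => ?_, ?_⟩
  · fin_cases k <;> fin_cases l <;> rfl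
  · fin_cases k <;> fin_cases l <;>
      simp [Fin.sum_univ_succ, realize, b3Dir, b3Weight] <;> ring
  · simp only [b3Incidence, List.forall_mem_cons]
    repeat' apply And.intro
    all_goals
      first
      | exact List.forall_mem_nil _
      | funext m
        fin_cases m <;>
          simp only [cross3, bil3, realize, b3Dir, b3Weight, List.map_cons, List.map_nil,
            List.sum_cons, List.sum_nil, Matrix.cons_val, eq_intCast, Int.cast_zero, Int.cast_one,
            Int.cast_neg, Fin.mk_one, Fin.reduceFinMk, Pi.zero_apply, Fin.zero_eta] <;>
          ring

lemma sysB3_eq (c₁ c₂ c₃ γ : ℝ) :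
    sysB3 c₁ c₂ c₃ γ = fun i => b3Scale c₁ c₂ c₃ γ i • realize (Int.castRingHom ℝ) b3Dir i := by
  funext i m
  fin_cases m <;> fin_cases i <;> simp [sysB3, b3Scale, b3Dir, realize]

theorem isRigidVeeSystem_sysB3 {c₁ c₂ c₃ γ : ℝ} (h₁₂ : 0 < c₁ * c₂) (h₁₃ : 0 < c₁ * c₃)
    (h₂₃ : 0 < c₂ * c₃) (h₁ : 0 < c₁ * (c₁ + γ)) (h₂ : 0 < c₂ * (c₂ + γ))
    (h₃ : 0 < c₃ * (c₃ + γ)) : IsRigidVeeSystem (sysB3 c₁ c₂ c₃ γ) := by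
  have h4 : c₁ ≠ 0 := left_ne_zero_of_mul h₁₂.ne'
  have h5 : c₂ ≠ 0 := left_ne_zero_of_mul h₂₃.ne'
  have h6 : c₃ ≠ 0 := right_ne_zero_of_mul h₂₃.ne'
  -- all of `c₁`, `c₂`, `c₃`, `c₁ + γ` have the same sign
  have h7 : c₁ + c₂ + c₃ + γ ≠ 0 := by
    intro h0
    have : 0 < c₁ * (c₁ + c₂ + c₃ + γ) := by linarith
    simp [h0] at this
  rw [sysB3_eq]
  refine isRigidVeeSystem_of_real_weights b3_isValid (b3_isWeightedVee c₁ c₂ c₃ γ) ?_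
    one_ne_zero (fun i => ?_) fun i => ?_
  · simp [h4, h5, h6, h7]
  · rw [one_mul]
    fin_cases i <;> refine Real.sq_sqrt ?_ <;> first | positivity | (rw [mul_assoc]; positivity)
  · fin_cases i <;> simp [b3Weight, h4, h5, h6, right_ne_zero_of_mul h₁.ne',
      right_ne_zero_of_mul h₂.ne', right_ne_zero_of_mul h₃.ne']

/-- The directions of the covectors of `(AB₄(t), A₁)₂`. -/
def ab4sDir : Fin 10 → Fin 3 → ℤ :=
  ![![1, 0, 0], ![0, 1, 0], ![0, 0, 1], ![1, 1, 0], ![1, -1, 0], ![1, 0, 1], ![1, 0, -1],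
    ![0, 1, 1], ![0, 1, -1], ![1, 1, 1]]

/-- The matroid of `(AB₄(t), A₁)₂`. -/
def ab4sIncidence : IncidenceData 10 where
  lines := [[0, 1, 3, 4], [0, 2, 5, 6], [0, 7, 9], [0, 8], [1, 2, 7, 8], [1, 5, 9], [1, 6],
    [2, 3, 9], [2, 4], [3, 5, 8], [3, 6, 7], [4, 5, 7], [4, 6, 8], [4, 9], [6, 9], [8, 9]]
  core := ⟨3, 5, 7, ![8, 4, 6], [(5, 8)], [(7, 6)]⟩
  f₀ := 0
  f₁ := 1
  f₂ := 2
  f₃ := 9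
  steps := [⟨3, 0, 1, 2, 9⟩, ⟨5, 0, 2, 1, 9⟩, ⟨7, 0, 9, 1, 2⟩, ⟨8, 1, 2, 3, 5⟩, ⟨4, 0, 1, 5, 7⟩,
    ⟨6, 0, 2, 3, 7⟩]

/-- The factors by which the covectors of `(AB₄(t), A₁)₂` differ from the directions. -/
noncomputable def ab4sScale (t : ℝ) : Fin 10 → ℝ :=
  ![√2, √2, √2, 1, 1 / √(4 * t ^ 2 + 1), 1, 1 / √(4 * t ^ 2 + 1), 1, 1 / √(4 * t ^ 2 + 1),
    t * √2 / √(t ^ 2 + 1)]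

/-- The squares of the scale factors of `(AB₄(t), A₁)₂`, up to a common factor, as
polynomials in `t`. -/
def ab4sWeight : Fin 10 → List ℤ :=
  ![[2, 0, 10, 0, 8], [2, 0, 10, 0, 8], [2, 0, 10, 0, 8], [1, 0, 5, 0, 4], [1, 0, 1],
    [1, 0, 5, 0, 4], [1, 0, 1], [1, 0, 5, 0, 4], [1, 0, 1], [0, 0, 2, 0, 8]]

lemma ab4s_isValid : ab4sIncidence.IsValid ab4sDir [] := by decide +kernel

lemma ab4s_isPolyVee : IsPolyVee ab4sDir ab4sIncidence.lines ab4sWeight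
    ![![[1, 0, 3], [0, 0, -1], [0, 0, -1]], ![[0, 0, -1], [1, 0, 3], [0, 0, -1]],
      ![[0, 0, -1], [0, 0, -1], [1, 0, 3]]]
    [6, 0, 42, 0, 84, 0, 48] := by
  decide +kernel

lemma sysAB4second_eq (t : ℝ) :
    sysAB4second t = fun i => ab4sScale t i • realize (Int.castRingHom ℝ) ab4sDir i := by
  funext i m
  fin_cases m <;> fin_cases i <;> simp [sysAB4second, ab4sScale, ab4sDir, realize] <;> ring

theorem isRigidVeeSystem_sysAB4second {t : ℝ} (h : t ≠ 0) :
    IsRigidVeeSystem (sysAB4second t) := by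
  rw [sysAB4second_eq]
  refine isRigidVeeSystem_of_real_weights ab4s_isValid (ab4s_isPolyVee.isWeightedVee t) ?_
    (ρ := ((4 * t ^ 2 + 1) * (t ^ 2 + 1))⁻¹) (by positivity) (fun i => ?_) fun i => ?_
  · norm_num [evalList, ← mul_assoc, h]
    nlinarith [sq_nonneg t, sq_nonneg (t ^ 2), sq_nonneg (t ^ 3)]
  · have h1 : √(4 * t ^ 2 + 1) ^ 2 = 4 * t ^ 2 + 1 := Real.sq_sqrt (by positivity)
    have h2 : √(t ^ 2 + 1) ^ 2 = t ^ 2 + 1 := Real.sq_sqrt (by positivity)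
    have h4 : √(2 : ℝ) ^ 2 = 2 := Real.sq_sqrt (by positivity)
    fin_cases i <;>
      simp only [ab4sScale, ab4sWeight, evalList, Fin.zero_eta, Fin.mk_one, Fin.reduceFinMk,
        Matrix.cons_val,
      mul_pow, div_pow, h1, h2, h4, one_pow] <;>
      push_cast <;> field_simp <;> ring
  · fin_cases i <;> norm_num [ab4sWeight, evalList, ← mul_assoc, h] <;>
      nlinarith [sq_nonneg t, sq_nonneg (t ^ 2), sq_nonneg (t ^ 3)]

/-- The directions of the covectors of `(AB₄(t), A₁)₁`. -/
def ab4fDir : Fin 11 → Fin 3 → ℤ :=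
  ![![1, 0, 0], ![0, 1, 0], ![0, 0, 1], ![1, 1, 0], ![1, -1, 0], ![1, 0, 1], ![1, 0, -1],
    ![1, 2, 1], ![1, -2, 1], ![1, 2, -1], ![1, -2, -1]]

/-- The matroid of `(AB₄(t), A₁)₁`. -/
def ab4fIncidence : IncidenceData 11 where
  lines := [[0, 1, 3, 4], [0, 2, 5, 6], [0, 7, 10], [0, 8, 9], [1, 2], [1, 5, 7, 8],
    [1, 6, 9, 10], [2, 3], [2, 4], [2, 7, 9], [2, 8, 10], [3, 5, 9], [3, 6, 7], [3, 8], [3, 10],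
    [4, 5, 10], [4, 6, 8], [4, 7], [4, 9]]
  core := ⟨0, 7, 9, ![10, 2, 8], [(7, 10)], [(9, 8)]⟩
  f₀ := 0
  f₁ := 1
  f₂ := 5
  f₃ := 9
  steps := [⟨3, 0, 1, 5, 9⟩, ⟨6, 0, 5, 1, 9⟩, ⟨7, 1, 5, 3, 6⟩, ⟨8, 0, 9, 1, 5⟩, ⟨10, 0, 7, 1, 6⟩,
    ⟨2, 0, 5, 7, 9⟩, ⟨4, 0, 1, 5, 10⟩]

/-- The factors by which the covectors of `(AB₄(t), A₁)₁` differ from the directions. -/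
noncomputable def ab4fScale (t : ℝ) : Fin 11 → ℝ :=
  ![√(2 * (2 * t ^ 2 + 1)), 2 * √(2 * (t ^ 2 + 1)), t * √(2 * (2 * t ^ 2 - 1) / (t ^ 2 + 1)), √2,
    √2, t * √2, t * √2, t, t, t, t]

/-- The squares of the scale factors of `(AB₄(t), A₁)₁`, up to a common factor, as
polynomials in `t`. -/
def ab4fWeight : Fin 11 → List ℤ :=
  ![[2, 0, 6, 0, 4], [8, 0, 16, 0, 8], [0, 0, -2, 0, 4], [2, 0, 2], [2, 0, 2], [0, 0, 2, 0, 2],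
    [0, 0, 2, 0, 2], [0, 0, 1, 0, 1], [0, 0, 1, 0, 1], [0, 0, 1, 0, 1], [0, 0, 1, 0, 1]]

lemma ab4f_isValid : ab4fIncidence.IsValid ab4fDir [] := by decide +kernel

lemma ab4f_isPolyVee : IsPolyVee ab4fDir ab4fIncidence.lines ab4fWeight
    ![![[0, 0, 2], [], []], ![[], [0, 0, 1], []], ![[], [], [2, 0, 2]]]
    [0, 0, 12, 0, 36, 0, 24] := by
  decide +kernel

lemma sysAB4first_eq (t : ℝ) :
    sysAB4first t = fun i => ab4fScale t i • realize (Int.castRingHom ℝ) ab4fDir i := by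
  funext i m
  fin_cases m <;> fin_cases i <;> simp [sysAB4first, ab4fScale, ab4fDir, realize] <;> ring

theorem isRigidVeeSystem_sysAB4first {t : ℝ} (h : 0 < 2 * t ^ 2 - 1) :
    IsRigidVeeSystem (sysAB4first t) := by
  have ht : t ≠ 0 := by rintro rfl; norm_num at h
  rw [sysAB4first_eq]
  refine isRigidVeeSystem_of_real_weights ab4f_isValid (ab4f_isPolyVee.isWeightedVee t) ?_
    (ρ := (t ^ 2 + 1)⁻¹) (by positivity) (fun i => ?_) fun i => ?_
  · norm_num [evalList, ← mul_assoc, ht]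
    nlinarith [sq_nonneg t, sq_nonneg (t ^ 2), sq_nonneg (t ^ 3)]
  · have h1 : √(2 * (2 * t ^ 2 + 1)) ^ 2 = 2 * (2 * t ^ 2 + 1) := Real.sq_sqrt (by positivity)
    have h2 : √(2 * (t ^ 2 + 1)) ^ 2 = 2 * (t ^ 2 + 1) := Real.sq_sqrt (by positivity)
    have h3 : √(2 * (2 * t ^ 2 - 1) / (t ^ 2 + 1)) ^ 2 = 2 * (2 * t ^ 2 - 1) / (t ^ 2 + 1) :=
      Real.sq_sqrt (by positivity)
    have h4 : √(2 : ℝ) ^ 2 = 2 := Real.sq_sqrt (by positivity)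
    fin_cases i <;>
      simp only [ab4fScale, ab4fWeight, evalList, Fin.zero_eta, Fin.mk_one, Fin.reduceFinMk,
        Matrix.cons_val,
      mul_pow, h1, h2, h3, h4] <;>
      push_cast <;> field_simp <;> ring
  · fin_cases i <;> norm_num [ab4fWeight, evalList, ← mul_assoc, ht] <;>
      nlinarith [sq_nonneg t, sq_nonneg (t ^ 2)]

/-- The directions of the covectors of `G₃`. -/
def g3Dir : Fin 13 → Fin 3 → ℤ :=
  ![![1, 0, 0], ![0, 1, 0], ![1, 1, 0], ![1, -1, 0], ![2, 1, 0], ![1, 2, 0], ![0, 0, 1],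
    ![1, 0, 1], ![1, 0, -1], ![0, 1, 1], ![0, 1, -1], ![1, 1, 1], ![1, 1, -1]]

/-- The matroid of `G₃`. -/
def g3Incidence : IncidenceData 13 where
  lines := [[0, 1, 2, 3, 4, 5], [0, 6, 7, 8], [0, 9, 11], [0, 10, 12], [1, 6, 9, 10], [1, 7, 11],
    [1, 8, 12], [2, 6, 11, 12], [2, 7, 10], [2, 8, 9], [3, 6], [3, 7, 9], [3, 8, 10], [3, 11],
    [3, 12], [4, 6], [4, 7, 12], [4, 8, 11], [4, 9], [4, 10], [5, 6], [5, 7], [5, 8], [5, 9, 12],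
    [5, 10, 11]]
  core := ⟨0, 9, 12, ![11, 5, 10], [(9, 11)], [(12, 10)]⟩
  f₀ := 0
  f₁ := 1
  f₂ := 6
  f₃ := 11
  steps := [⟨2, 0, 1, 6, 11⟩, ⟨7, 0, 6, 1, 11⟩, ⟨9, 0, 11, 1, 6⟩, ⟨10, 1, 6, 2, 7⟩,
    ⟨12, 0, 10, 2, 6⟩, ⟨3, 0, 1, 7, 9⟩, ⟨4, 0, 1, 7, 12⟩, ⟨5, 0, 1, 9, 12⟩, ⟨8, 0, 6, 1, 12⟩]

/-- The factors by which the covectors of `G₃` differ from the directions. -/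
noncomputable def g3Scale (t : ℝ) : Fin 13 → ℝ :=
  ![√(2 * t + 1), √(2 * t + 1), √(2 * t + 1), √((2 * t - 1) / 3), √((2 * t - 1) / 3),
    √((2 * t - 1) / 3), √(3 / t), 1, 1, 1, 1, 1, 1]

/-- The squares of the scale factors of `G₃`, up to a common factor, as
polynomials in `t`. -/
def g3Weight : Fin 13 → List ℤ :=
  ![[0, 3, 6], [0, 3, 6], [0, 3, 6], [0, -1, 2], [0, -1, 2], [0, -1, 2], [9], [0, 3], [0, 3],
    [0, 3], [0, 3], [0, 3], [0, 3]]

lemma g3_isValid : g3Incidence.IsValid g3Dir [] := by decide +kernel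

lemma g3_isPolyVee : IsPolyVee g3Dir g3Incidence.lines g3Weight
    ![![[2], [-1], []], ![[-1], [2], []], ![[], [], [0, 2]]]
    [0, 18, 36] := by
  decide +kernel

lemma sysG3_eq (t : ℝ) :
    sysG3 t = fun i => g3Scale t i • realize (Int.castRingHom ℝ) g3Dir i := by
  funext i m
  fin_cases m <;> fin_cases i <;> simp [sysG3, g3Scale, g3Dir, realize] <;> ring

theorem isRigidVeeSystem_sysG3 {t : ℝ} (h : 0 < 2 * t - 1) : IsRigidVeeSystem (sysG3 t) := by
  have ht : 0 < t := by linarith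
  rw [sysG3_eq]
  refine isRigidVeeSystem_of_real_weights g3_isValid (g3_isPolyVee.isWeightedVee t) ?_
    (ρ := (3 * t)⁻¹) (by positivity) (fun i => ?_) fun i => ?_
  · norm_num [evalList, ← mul_assoc, ht.ne']
    exact ne_of_gt (by positivity)
  · have h1 : √(2 * t + 1) ^ 2 = 2 * t + 1 := Real.sq_sqrt (by positivity)
    have h2 : √((2 * t - 1) / 3) ^ 2 = (2 * t - 1) / 3 := Real.sq_sqrt (by positivity)
    have h3 : √(3 / t) ^ 2 = 3 / t := Real.sq_sqrt (by positivity)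
    fin_cases i <;>
      simp only [g3Scale, g3Weight, evalList, Fin.zero_eta, Fin.mk_one, Fin.reduceFinMk,
        Matrix.cons_val,
      h1, h2, h3, one_pow] <;>
      push_cast <;> field_simp <;> ring
  · fin_cases i <;> norm_num [g3Weight, evalList, ← mul_assoc, ht.ne'] <;> linarith

/-- The directions of the covectors of `F₃`. -/
def f3Dir : Fin 13 → Fin 3 → ℤ :=
  ![![1, 0, 0], ![0, 1, 0], ![0, 0, 1], ![1, 1, 0], ![1, -1, 0], ![1, 0, 1], ![1, 0, -1],
    ![0, 1, 1], ![0, 1, -1], ![1, 1, 1], ![1, -1, 1], ![1, 1, -1], ![1, -1, -1]]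

/-- The matroid of `F₃`. -/
def f3Incidence : IncidenceData 13 where
  lines := [[0, 1, 3, 4], [0, 2, 5, 6], [0, 7, 9, 12], [0, 8, 10, 11], [1, 2, 7, 8],
    [1, 5, 9, 10], [1, 6, 11, 12], [2, 3, 9, 11], [2, 4, 10, 12], [3, 5, 8], [3, 6, 7], [3, 10],
    [3, 12], [4, 5, 7], [4, 6, 8], [4, 9], [4, 11], [5, 11], [5, 12], [6, 9], [6, 10], [7, 10],
    [7, 11], [8, 9], [8, 12]]
  core := ⟨3, 5, 7, ![8, 4, 6], [(5, 8)], [(7, 6)]⟩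
  f₀ := 0
  f₁ := 1
  f₂ := 2
  f₃ := 9
  steps := [⟨3, 0, 1, 2, 9⟩, ⟨5, 0, 2, 1, 9⟩, ⟨7, 0, 9, 1, 2⟩, ⟨8, 1, 2, 3, 5⟩, ⟨10, 0, 8, 1, 5⟩,
    ⟨11, 0, 8, 2, 3⟩, ⟨12, 0, 7, 1, 11⟩, ⟨4, 0, 1, 2, 10⟩, ⟨6, 0, 2, 1, 11⟩]

/-- The factors by which the covectors of `F₃` differ from the directions. -/
noncomputable def f3Scale (t : ℝ) : Fin 13 → ℝ :=
  ![√(4 * t ^ 2 + 2), √(4 * t ^ 2 + 2), √(4 * t ^ 2 + 2), 1, 1, 1, 1, 1, 1, t * √2, t * √2,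
    t * √2, t * √2]

/-- The squares of the scale factors of `F₃`, up to a common factor, as
polynomials in `t`. -/
def f3Weight : Fin 13 → List ℤ :=
  ![[2, 0, 4], [2, 0, 4], [2, 0, 4], [1], [1], [1], [1], [1], [1], [0, 0, 2], [0, 0, 2],
    [0, 0, 2], [0, 0, 2]]

lemma f3_isValid : f3Incidence.IsValid f3Dir [] := by decide +kernel

lemma f3_isPolyVee : IsPolyVee f3Dir f3Incidence.lines f3Weight
    ![![[1], [], []], ![[], [1], []], ![[], [], [1]]]
    [6, 0, 12] := by
  decide +kernel

lemma sysF3_eq (t : ℝ) :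
    sysF3 t = fun i => f3Scale t i • realize (Int.castRingHom ℝ) f3Dir i := by
  funext i m
  fin_cases m <;> fin_cases i <;> simp [sysF3, f3Scale, f3Dir, realize]

theorem isRigidVeeSystem_sysF3 {t : ℝ} (h : t ≠ 0) : IsRigidVeeSystem (sysF3 t) := by
  rw [sysF3_eq]
  refine isRigidVeeSystem_of_real_weights f3_isValid (f3_isPolyVee.isWeightedVee t) ?_
    one_ne_zero (fun i => ?_) fun i => ?_
  · norm_num [evalList, ← mul_assoc, h]
    nlinarith [sq_nonneg t, sq_nonneg (t ^ 2), sq_nonneg (t ^ 3)]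
  · have h1 : √(4 * t ^ 2 + 2) ^ 2 = 4 * t ^ 2 + 2 := Real.sq_sqrt (by positivity)
    fin_cases i <;> norm_num [f3Scale, f3Weight, evalList, mul_pow, h1] <;> ring
  · fin_cases i <;> norm_num [f3Weight, evalList, ← mul_assoc, h] <;>
      nlinarith [sq_nonneg t, sq_nonneg (t ^ 2), sq_nonneg (t ^ 3)]

end Catalogue

theorem mainTheorem8 {n : ℕ} (a : Fin n → Fin 3 → ℝ) (ha : IsKnownVeeSystem a) :
    (IsVeeSystem a ∧ IsIrreducibleSystem a ∧ ∃ ν : Set (Fin n) → ℝ, IsNuFunction a ν) ∧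
      IsUniquelyDetermined a ∧ IsLocallyUniquelyDetermined a := by
  cases ha with
  | A3 c₁ c₂ c₃ h₁ h₂ h₃ => exact isRigidVeeSystem_sysA3 h₁ h₂ h₃
  | D3 t s h₁ h₂ h₃ => exact isRigidVeeSystem_sysD3 h₁ h₂ h₃
  | E6A3 => exact isRigidVeeSystem_sysE6A3
  | B3 c₁ c₂ c₃ γ h₁₂ h₁₃ h₂₃ h₁ h₂ h₃ => exact isRigidVeeSystem_sysB3 h₁₂ h₁₃ h₂₃ h₁ h₂ h₃
  | E6A1A1A1 => exact isRigidVeeSystem_sysE6A1A1A1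
  | AB4second t h => exact isRigidVeeSystem_sysAB4second h
  | AB4first t h => exact isRigidVeeSystem_sysAB4first h
  | G3 t h => exact isRigidVeeSystem_sysG3 h
  | E7A1A1A2 => exact isRigidVeeSystem_sysE7A1A1A2
  | F3 t h => exact isRigidVeeSystem_sysF3 h
  | H3 => exact isRigidVeeSystem_sysH3
  | E8A1A4 => exact isRigidVeeSystem_sysE8A1A4
  | E8A2A3 => exact isRigidVeeSystem_sysE8A2A3
  | E8A1A1A3 => exact isRigidVeeSystem_sysE8A1A1A3
  | E8A1A1A1A2 => exact isRigidVeeSystem_sysE8A1A1A1A2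
  | E8A2A2A1 => exact isRigidVeeSystem_sysE8A2A2A1
  | H4A1 => exact isRigidVeeSystem_sysH4A1
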